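/- **Theorem (covering number of $G$-gate unitaries).** For $n\ge 2$ and $G\ge 1$ let $U^G\subseteq U(2^n)$ be the set of $n$-qubit unitaries that are a product of $G$ two-qubit gates, a two-qubit gate being an arbitrary element of $U(4)$ acting on an arbitrary pair of distinct qubits, tensored with the identity on the other qubits. For a distance $d$ on $U(2^n)$, let $\mathcal N(U^G,d,\epsilon)$ be the smallest cardinality of a set $N\subseteq U^G$ such that every $U\in U^G$ satisfies $d(U,V)\le\epsilon$ for some $V\in N$; the metric entropy is $\log\mathcal N(U^G,d,\epsilon)$. Consider the normalized Frobenius distance $d_F(U,V)=2^{-n/2}\|U-V\|_F$; the diamond distance $$d_\diamond(U,V)=\max_\rho\bigl\|(U\otimes I)\rho(U\otimes I)^\dagger-(V\otimes I)\rho(V\otimes I)^\dagger\bigr\|_1,$$ where $\rho$ ranges over the density matrices of the system with an ancilla of arbitrary finite dimension; and the average-case distance $$d_{\mathrm{avg}}(U,V)=\sqrt{\mathbb E_{|\psi\rangle}\bigl[\mathrm{d_{tr}}(U|\psi\rangle,V|\psi\rangle)^2\bigr]},$$ where $|\psi\rangle$ is a Haar-random $n$-qubit pure state and $\mathrm{d_{tr}}(|\psi\rangle,|\phi\rangle)=\tfrac12\bigl\||\psi\rangle\langle\psi|-|\phi\rangle\langle\phi|\bigr\|_1$.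 1. There are universal constants $c_1,c_2,C>0$ such that for all $n\ge2$, all $\epsilon\in(0,1]$ and all integers $G$ with $1\le G/C\le 4^{n+1}$, $$\frac{G}{4C}\log\Bigl(\frac{c_1}{\epsilon}\Bigr)\le\log\mathcal N(U^G,d_F,\epsilon)\le 16G\log\Bigl(\frac{c_2G}{\epsilon}\Bigr)+2G\log n.$$ 2. For all $n\ge2$, $G\ge1$ and $\epsilon\in(0,1]$, $$\log\mathcal N(U^G,d_\diamond,\epsilon)\le 32G\log\Bigl(\frac{12G}{\epsilon}\Bigr)+2G\log n.$$ 3. There are universal constants $c_1,c_2,C>0$ such that for all $n\ge2$, all $\epsilon\in(0,1]$ and all integers $G$ with $1\le G/C\le 4^{n+1}$, $$\frac{G}{4C}\log\Bigl(\frac{c_1}{8\epsilon}\Bigr)-\log\Bigl(\frac{c_2}{2\epsilon}\Bigr)\le\log\mathcal N(U^G,d_{\mathrm{avg}},\epsilon)\le 16G\log\Bigl(\frac{c_2G}{\epsilon}\Bigr)+2G\log n.$$ -/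

import Mathlib

open scoped Matrix Kronecker ComplexOrder

noncomputable section

/-! ### Covering numbers -/

/-- `N` is an `ε`-covering net of `K` with respect to the distance function `d`:
`N ⊆ K`, and every point of `K` is within distance `ε` of a point of `N`. -/
def IsCoveringNet {X : Type*} (d : X → X → ℝ) (K : Set X) (ε : ℝ) (N : Set X) : Prop :=
  N ⊆ K ∧ ∀ x ∈ K, ∃ y ∈ N, d x y ≤ ε

/-- The smallest cardinality of an `ε`-covering net of `K` (it is `⊤` if there is no finite one). -/
def coveringNumber {X : Type*} (d : X → X → ℝ) (K : Set X) (ε : ℝ) : ℕ∞ :=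
  ⨅ (N : Set X) (_ : IsCoveringNet d K ε N), N.encard

/-- The metric entropy: the natural logarithm of the covering number, with the conventions
`log 0 = ⊥` and `log ⊤ = ⊤`, so that an upper bound by a real number includes finiteness. -/
def metricEntropy {X : Type*} (d : X → X → ℝ) (K : Set X) (ε : ℝ) : EReal :=
  ENNReal.log (coveringNumber d K ε : ENNReal)

/-! ### Qubits, two-qubit gates and circuits -/

/-- The computational basis of `n` qubits (bit strings of length `n`). -/
abbrev QubitBasis (n : ℕ) : Type := Fin n → Fin 2

/-- The group of `n`-qubit unitaries, `U(2 ^ n)`. -/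
abbrev QubitUnitary (n : ℕ) : Type := Matrix.unitaryGroup (QubitBasis n) ℂ

/-- The `n`-qubit operator that acts as `V` on the qubits `i`, `j` (in this order) and as the
identity on all the other qubits. -/
def actOnPair {n : ℕ} (i j : Fin n) (V : Matrix (Fin 2 × Fin 2) (Fin 2 × Fin 2) ℂ) :
    Matrix (QubitBasis n) (QubitBasis n) ℂ :=
  open Classical in
  Matrix.of fun x y =>
    if ∀ k, k ≠ i → k ≠ j → x k = y k then V (x i, x j) (y i, y j) else 0

/-- The `n`-qubit unitaries that are a single two-qubit gate: an arbitrary element of `U(4)` applied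
to an arbitrary pair of distinct qubits. -/
def IsTwoQubitGate {n : ℕ} (U : QubitUnitary n) : Prop :=
  ∃ i j : Fin n, i ≠ j ∧ ∃ V ∈ Matrix.unitaryGroup (Fin 2 × Fin 2) ℂ,
    (U : Matrix (QubitBasis n) (QubitBasis n) ℂ) = actOnPair i j V

/-- The set of `n`-qubit unitaries that can be implemented by `G` two-qubit gates. -/
def gateUnitaries (n G : ℕ) : Set (QubitUnitary n) :=
  {U | ∃ gates : List (QubitUnitary n),
    gates.length = G ∧ (∀ g ∈ gates, IsTwoQubitGate g) ∧ gates.prod = U}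

/-! ### Distances between unitaries -/

/-- The Frobenius norm of a complex matrix. -/
def frobeniusNorm {ι : Type*} [Fintype ι] (A : Matrix ι ι ℂ) : ℝ :=
  Matrix.frobeniusNormedAddCommGroup.toNorm.norm A

/-- The trace norm: the sum of the singular values, which are the square roots of the eigenvalues
of `Aᴴ * A`. -/
def traceNorm {ι : Type*} [Fintype ι] [DecidableEq ι] (A : Matrix ι ι ℂ) : ℝ :=
  ∑ i, √((Matrix.isHermitian_conjTranspose_mul_self A).eigenvalues i)

/-- Normalized Frobenius distance `‖U - V‖_F / √(2 ^ n)`. -/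
def frobeniusDist {n : ℕ} (U V : QubitUnitary n) : ℝ :=
  frobeniusNorm (U.1 - V.1) / √(2 ^ n)

/-- Density matrices: positive semidefinite matrices of trace one. -/
def IsDensityMatrix {ι : Type*} [Fintype ι] (ρ : Matrix ι ι ℂ) : Prop :=
  ρ.PosSemidef ∧ ρ.trace = 1

/-- Diamond distance: the largest trace norm of
`(U ⊗ I) ρ (U ⊗ I)ᴴ - (V ⊗ I) ρ (V ⊗ I)ᴴ`, where `ρ` ranges over the density matrices of the system
together with an ancilla of arbitrary finite dimension `m`. -/
def diamondDist {n : ℕ} (U V : QubitUnitary n) : ℝ :=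
  sSup {r : ℝ | ∃ (m : ℕ) (ρ : Matrix (QubitBasis n × Fin m) (QubitBasis n × Fin m) ℂ),
    IsDensityMatrix ρ ∧
    r = traceNorm
      ((U.1 ⊗ₖ (1 : Matrix (Fin m) (Fin m) ℂ)) * ρ * (U.1 ⊗ₖ (1 : Matrix (Fin m) (Fin m) ℂ))ᴴ -
       (V.1 ⊗ₖ (1 : Matrix (Fin m) (Fin m) ℂ)) * ρ * (V.1 ⊗ₖ (1 : Matrix (Fin m) (Fin m) ℂ))ᴴ)}

/-- The trace distance `‖ |ψ⟩⟨ψ| - |φ⟩⟨φ| ‖₁ / 2` of two pure states. -/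
def traceDist {ι : Type*} [Fintype ι] [DecidableEq ι] (ψ φ : ι → ℂ) : ℝ :=
  traceNorm (Matrix.vecMulVec ψ (star ψ) - Matrix.vecMulVec φ (star φ)) / 2

theorem isCompact_unitaryGroup (n : ℕ) :
    IsCompact (Matrix.unitaryGroup (QubitBasis n) ℂ :
      Set (Matrix (QubitBasis n) (QubitBasis n) ℂ)) := by
  have hK : IsCompact (Set.pi Set.univ fun _ : QubitBasis n =>
      Set.pi Set.univ fun _ : QubitBasis n => Metric.closedBall (0 : ℂ) 1) :=
    isCompact_univ_pi fun _ => isCompact_univ_pi fun _ => isCompact_closedBall _ _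
  refine IsCompact.of_isClosed_subset (s := Set.pi Set.univ fun _ : QubitBasis n =>
      Set.pi Set.univ fun _ : QubitBasis n => Metric.closedBall (0 : ℂ) 1) hK ?_ ?_
  · exact isClosed_unitary (R := Matrix (QubitBasis n) (QubitBasis n) ℂ)
  · intro U hU i _ j _
    simpa using entry_norm_bound_of_unitary hU i j

instance instCompactSpaceQubitUnitary (n : ℕ) : CompactSpace (QubitUnitary n) :=
  isCompact_iff_compactSpace.mp (isCompact_unitaryGroup n)

instance instMeasurableSpaceQubitUnitary (n : ℕ) : MeasurableSpace (QubitUnitary n) := borel _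

instance instBorelSpaceQubitUnitary (n : ℕ) : BorelSpace (QubitUnitary n) := ⟨rfl⟩

/-- The Haar probability measure on `U(2 ^ n)`. -/
def haarUnitary (n : ℕ) : MeasureTheory.Measure (QubitUnitary n) :=
  MeasureTheory.Measure.haarMeasure ⊤

/-- The all-zero computational basis state. -/
def zeroState (n : ℕ) : QubitBasis n → ℂ := Pi.single 0 1

/-- Average-case distance: the root mean squared trace distance of `U|ψ⟩` and `V|ψ⟩` for a
Haar-random pure state `|ψ⟩`, i.e. `|ψ⟩ = W|0⟩` with `W` a Haar-random unitary. -/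
def averageDist {n : ℕ} (U V : QubitUnitary n) : ℝ :=
  √(∫ W, traceDist (U.1 *ᵥ (W.1 *ᵥ zeroState n)) (V.1 *ᵥ (W.1 *ᵥ zeroState n)) ^ 2 ∂haarUnitary n)

end

/-! Upper bounds. A circuit is a choice of `G` ordered pairs of qubits and `G` elements of U(4).
Operator-norm errors of the gates add up along a product (`norm_sub_le_of_mul`), and tensoring with
the identity does not enlarge them (`norm_actOnPair_sub_le`). Hence a net `T` of U(4) at a scale
proportional to `ε / G` yields a net of at most `(n ^ 2 * T.card) ^ G` circuits. The three distances
are at most 1, 2 and 1 times the operator norm (`frobeniusDist_le`, `diamondDist_le`,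
`averageDist_le`). The exponent 16 is the real dimension of U(4), obtained from Cayley charts in
`exists_finset_net_unitaryGroup_dim`; the exponent 32 is the real dimension of all complex 4 × 4
matrices.

Frobenius lower bound. On `k` qubits, `15 * 4 ^ k` gates implement every Cayley transform of a
Hermitian matrix exactly (`isCircuit_cayley`): each eigenvector is prepared by a tree of controlled
rotations, and its eigenvalue is applied as a phase. The largest affordable `k ≤ n` has `4 ^ k`
comparable to `G` (`exists_qubits_of_gates`), and idle qubits do not change the normalized distance.
It remains to see that this family, of dimension `d ^ 2` with `d = 2 ^ k`, is hard to cover. This is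
done by counting instead of by Haar volume. Among Hermitian matrices with coordinates on a grid, at
least half have operator norm at most 24 (`half_le_card_filter_norm_le`), by a Chernoff bound and a
net of the unit ball. On these the Cayley transform is injective with a Lipschitz inverse
(`frobeniusNorm_sub_le_of_cayley`), so the grid matrices served by one net point lie in a Euclidean
ball with only exponentially many grid points in `d ^ 2` (`card_filter_sum_sq_le`).

Average-case lower bound. Haar moments express the average-case distance through `|tr (Uᴴ V)|`
(`averageDist_sq`). It therefore controls the Frobenius distance after the best global phase, up to
a factor 2 (`exists_phase_frobeniusDist_le`). Multiplying an average-case net by a net of at most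
`325 / ε` phases gives a Frobenius net at scale `3 ε`; the subtracted logarithm is the price of
these phases. -/

/-! ### Nets in finite-dimensional normed spaces -/

section Nets

open MeasureTheory Module Metric

variable {E : Type*} [NormedAddCommGroup E] [NormedSpace ℝ E] [FiniteDimensional ℝ E]

/-- A `δ`-separated subset of a ball of radius `R` has at most `(1 + 2 R / δ) ^ dim` points. -/
theorem card_le_of_separated_of_norm_le {R δ : ℝ} (hR : 0 ≤ R) (hδ : 0 < δ) (s : Finset E)
    (hs : ∀ c ∈ s, ‖c‖ ≤ R) (h : ∀ c ∈ s, ∀ d ∈ s, c ≠ d → δ ≤ ‖c - d‖) :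
    (s.card : ℝ) ≤ (1 + 2 * R / δ) ^ finrank ℝ E := by
  borelize E
  let μ : Measure E := Measure.addHaar
  have hδ2 : 0 < δ / 2 := by positivity
  have hρ : 0 < R + δ / 2 := by positivity
  -- Volume comparison: the balls of radius `δ / 2` around the points are disjoint and lie in the
  -- ball of radius `R + δ / 2`. Volumes scale with the power `dim`, and the volume of the unit ball
  -- cancels.
  have D : Set.Pairwise (s : Set E)
      (Function.onFun Disjoint fun c => ball (c : E) (δ / 2)) := by
    rintro c hc d hd hcd
    apply ball_disjoint_ball
    rw [dist_eq_norm]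
    linarith [h c hc d hd hcd]
  have A_subset : (⋃ c ∈ s, ball (c : E) (δ / 2)) ⊆ ball (0 : E) (R + δ / 2) := by
    refine Set.iUnion₂_subset fun x hx => ball_subset_ball' ?_
    rw [dist_zero_right]
    linarith [hs x hx]
  have I : (s.card : ENNReal) * ENNReal.ofReal ((δ / 2) ^ finrank ℝ E) * μ (ball 0 1) ≤
      ENNReal.ofReal ((R + δ / 2) ^ finrank ℝ E) * μ (ball 0 1) := by
    have := measure_mono (μ := μ) A_subset
    rw [measure_biUnion_finset D fun c _ => measurableSet_ball] at this
    simp only [μ.addHaar_ball_of_pos _ hδ2, μ.addHaar_ball_of_pos _ hρ, Finset.sum_const,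
      nsmul_eq_mul] at this
    rwa [mul_assoc]
  have J := (ENNReal.mul_le_mul_iff_left
    (measure_ball_pos μ 0 zero_lt_one).ne' measure_ball_lt_top.ne).1 I
  have K := ENNReal.toReal_le_of_le_ofReal (pow_nonneg hρ.le _) J
  rw [ENNReal.toReal_mul, ENNReal.toReal_natCast,
    ENNReal.toReal_ofReal (by positivity), ← le_div_iff₀ (by positivity), ← div_pow] at K
  refine K.trans_eq ?_
  congr 1
  field_simp
  ring

/-- A bounded set has a `δ`-net of at most `(1 + 2 R / δ) ^ dim` of its points. -/
theorem exists_finset_net {R δ : ℝ} (hR : 0 ≤ R) (hδ : 0 < δ) (K : Set E)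
    (hK : ∀ x ∈ K, ‖x‖ ≤ R) :
    ∃ T : Finset E, (↑T ⊆ K) ∧ (∀ x ∈ K, ∃ y ∈ T, ‖x - y‖ ≤ δ) ∧
      (T.card : ℝ) ≤ (1 + 2 * R / δ) ^ finrank ℝ E := by
  classical
  -- The volume bound caps the size of separated subsets of `K`, so there is one of largest size. It
  -- is a net, because a point of `K` farther than `δ` from it could be added.
  let P : ℕ → Prop := fun m => ∃ s : Finset E, ↑s ⊆ K ∧
    (∀ c ∈ s, ∀ d ∈ s, c ≠ d → δ ≤ ‖c - d‖) ∧ s.card = m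
  have hbound : ∀ m, P m → m ≤ ⌊(1 + 2 * R / δ) ^ finrank ℝ E⌋₊ := by
    rintro m ⟨s, hsK, hs, rfl⟩
    exact Nat.le_floor (card_le_of_separated_of_norm_le hR hδ s (fun c hc => hK c (hsK hc)) hs)
  have h0 : P 0 := ⟨∅, by simp, by simp, rfl⟩
  obtain ⟨T, hTK, hT, hcard⟩ := Nat.findGreatest_spec (P := P) (Nat.zero_le
    ⌊(1 + 2 * R / δ) ^ finrank ℝ E⌋₊) h0
  refine ⟨T, hTK, fun x hx => ?_,
    card_le_of_separated_of_norm_le hR hδ T (fun c hc => hK c (hTK hc)) hT⟩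
  by_contra! hcon
  have hxT : x ∉ T := fun hxT => by
    have := hcon x hxT
    rw [sub_self, norm_zero] at this
    linarith
  have hP : P (T.card + 1) := by
    refine ⟨insert x T, ?_, ?_, Finset.card_insert_of_notMem hxT⟩
    · rw [Finset.coe_insert]
      exact Set.insert_subset hx hTK
    · intro c hc d hd hcd
      rw [Finset.mem_insert] at hc hd
      rcases hc with rfl | hc <;> rcases hd with rfl | hd
      · exact absurd rfl hcd
      · exact (hcon d hd).le
      · rw [norm_sub_rev]
        exact (hcon c hc).le
      · exact hT c hc d hd hcd
  have := Nat.le_findGreatest (hbound _ hP) hP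
  omega

end Nets

/-! ### Metric entropy and cardinalities of nets -/

section Entropy

variable {X : Type*} {d : X → X → ℝ} {K : Set X} {ε : ℝ}

theorem metricEntropy_le {N : Finset X} (hN : IsCoveringNet d K ε N) (hne : N.Nonempty) {r : ℝ}
    (hr : Real.log N.card ≤ r) : metricEntropy d K ε ≤ (r : EReal) := by
  have hpos : (0 : ℝ) < N.card := by exact_mod_cast hne.card_pos
  have h1 : coveringNumber d K ε ≤ (N.card : ℕ∞) := by
    rw [← Set.encard_coe_eq_coe_finsetCard]
    exact iInf₂_le (N : Set X) hN
  calc metricEntropy d K ε ≤ ENNReal.log (((N.card : ℕ∞) : ENNReal)) :=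
        ENNReal.log_monotone (ENat.toENNReal_mono h1)
    _ = ENNReal.log (ENNReal.ofReal (N.card : ℝ)) := by
        rw [ENNReal.ofReal_natCast]; simp
    _ = (Real.log N.card : EReal) := ENNReal.log_ofReal_of_pos hpos
    _ ≤ r := by exact_mod_cast hr

/-- Only finite nets have to be tested: an infinite net has cardinality `⊤`, and so does the infimum
over an empty family of nets. -/
theorem le_metricEntropy {r : ℝ}
    (h : ∀ N : Finset X, IsCoveringNet d K ε N → Real.exp r ≤ N.card) :
    (r : EReal) ≤ metricEntropy d K ε := by
  have h1 : ENNReal.ofReal (Real.exp r) ≤ (coveringNumber d K ε : ENNReal) := by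
    -- `ℕ∞` is well-ordered, so the infimum is attained as soon as some net exists.
    by_cases hfin : ∃ N : Set X, IsCoveringNet d K ε N ∧ N.encard = coveringNumber d K ε
    · obtain ⟨N, hN, hNe⟩ := hfin
      rw [← hNe]
      by_cases hf : N.Finite
      · lift N to Finset X using hf
        rw [Set.encard_coe_eq_coe_finsetCard]
        simpa using ENNReal.ofReal_le_ofReal (h N hN)
      · rw [Set.Infinite.encard_eq hf]
        simp
    · have htop : coveringNumber d K ε = ⊤ := by
        by_contra hne
        apply hfin
        have : Nonempty {N : Set X // IsCoveringNet d K ε N} := by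
          by_contra hem
          rw [not_nonempty_iff] at hem
          apply hne
          rw [coveringNumber, iInf_subtype']
          exact iInf_of_empty (fun N : {N : Set X // IsCoveringNet d K ε N} => N.1.encard)
        obtain ⟨⟨N, hN⟩, h2⟩ := ciInf_mem
          (fun N : {N : Set X // IsCoveringNet d K ε N} => N.1.encard)
        refine ⟨N, hN, ?_⟩
        rw [coveringNumber, iInf_subtype']
        exact h2
      rw [htop]
      simp
  calc (r : EReal) = ENNReal.log (ENNReal.ofReal (Real.exp r)) := by
        rw [ENNReal.log_ofReal_of_pos (Real.exp_pos r), Real.log_exp]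
    _ ≤ _ := ENNReal.log_monotone h1

end Entropy

/-! ### The Frobenius norm -/

section Frobenius

open scoped Matrix.Norms.L2Operator

variable {ι : Type*} [Fintype ι]

theorem frobeniusNorm_eq_sqrt (A : Matrix ι ι ℂ) :
    frobeniusNorm A = √(∑ i, ∑ j, ‖A i j‖ ^ 2) := by
  have := @Matrix.frobenius_norm_def ι ι ℂ _ _ _ A
  rw [frobeniusNorm]
  refine this.trans ?_
  rw [Real.sqrt_eq_rpow]
  simp

theorem frobeniusNorm_nonneg (A : Matrix ι ι ℂ) : 0 ≤ frobeniusNorm A := by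
  rw [frobeniusNorm_eq_sqrt]
  positivity

theorem frobeniusNorm_sq (A : Matrix ι ι ℂ) :
    frobeniusNorm A ^ 2 = ∑ i, ∑ j, ‖A i j‖ ^ 2 := by
  rw [frobeniusNorm_eq_sqrt, Real.sq_sqrt (by positivity)]

theorem frobeniusNorm_add_le (A B : Matrix ι ι ℂ) :
    frobeniusNorm (A + B) ≤ frobeniusNorm A + frobeniusNorm B :=
  @norm_add_le _ (Matrix.frobeniusNormedAddCommGroup.toSeminormedAddCommGroup).toSeminormedAddGroup A B

theorem frobeniusNorm_neg (A : Matrix ι ι ℂ) : frobeniusNorm (-A) = frobeniusNorm A := by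
  simp [frobeniusNorm_eq_sqrt]

theorem frobeniusNorm_conjTranspose (A : Matrix ι ι ℂ) :
    frobeniusNorm Aᴴ = frobeniusNorm A := by
  rw [frobeniusNorm_eq_sqrt, frobeniusNorm_eq_sqrt, Finset.sum_comm]
  simp [Matrix.conjTranspose_apply]

theorem frobeniusNorm_smul (c : ℂ) (A : Matrix ι ι ℂ) :
    frobeniusNorm (c • A) = ‖c‖ * frobeniusNorm A := by
  rw [frobeniusNorm_eq_sqrt, frobeniusNorm_eq_sqrt]
  simp only [Matrix.smul_apply, norm_smul, mul_pow, ← Finset.mul_sum]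
  rw [Real.sqrt_mul (by positivity), Real.sqrt_sq (norm_nonneg _)]

theorem trace_conjTranspose_mul_self (A : Matrix ι ι ℂ) :
    (Aᴴ * A).trace = ((frobeniusNorm A ^ 2 : ℝ) : ℂ) := by
  rw [frobeniusNorm_sq, Finset.sum_comm]
  simp only [Matrix.trace, Matrix.diag, Matrix.mul_apply, Matrix.conjTranspose_apply]
  push_cast
  refine Finset.sum_congr rfl fun i _ => Finset.sum_congr rfl fun j _ => ?_
  rw [mul_comm]
  exact RCLike.mul_conj _

variable [DecidableEq ι]

theorem sum_norm_sq_mulVec_le (A : Matrix ι ι ℂ) (x : ι → ℂ) :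
    ∑ i, ‖(A *ᵥ x) i‖ ^ 2 ≤ ‖A‖ ^ 2 * ∑ i, ‖x i‖ ^ 2 := by
  have h := Matrix.l2_opNorm_mulVec A (WithLp.toLp 2 x)
  have h2 := pow_le_pow_left₀ (norm_nonneg _) h 2
  rw [mul_pow, EuclideanSpace.norm_sq_eq, EuclideanSpace.norm_sq_eq] at h2
  exact h2

/-- The squared Frobenius norm is the sum over the columns of `A`, and `X` acts on each column
separately. -/
theorem frobeniusNorm_mul_le_left (X A : Matrix ι ι ℂ) :
    frobeniusNorm (X * A) ≤ ‖X‖ * frobeniusNorm A := by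
  refine le_of_sq_le_sq ?_ (mul_nonneg (norm_nonneg _) (frobeniusNorm_nonneg _))
  rw [mul_pow, frobeniusNorm_sq, frobeniusNorm_sq, Finset.sum_comm,
    Finset.sum_comm (f := fun i j => ‖A i j‖ ^ 2), Finset.mul_sum]
  refine Finset.sum_le_sum fun j _ => ?_
  exact sum_norm_sq_mulVec_le X (fun i => A i j)

theorem frobeniusNorm_mul_le_right (A X : Matrix ι ι ℂ) :
    frobeniusNorm (A * X) ≤ frobeniusNorm A * ‖X‖ := by
  rw [← frobeniusNorm_conjTranspose, Matrix.conjTranspose_mul, mul_comm]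
  refine (frobeniusNorm_mul_le_left _ _).trans_eq ?_
  rw [Matrix.l2_opNorm_conjTranspose, frobeniusNorm_conjTranspose]

theorem frobeniusNorm_one_sq : frobeniusNorm (1 : Matrix ι ι ℂ) ^ 2 = Fintype.card ι := by
  have := trace_conjTranspose_mul_self (1 : Matrix ι ι ℂ)
  simp at this
  exact_mod_cast this.symm

theorem frobeniusNorm_le_opNorm (A : Matrix ι ι ℂ) :
    frobeniusNorm A ≤ ‖A‖ * √(Fintype.card ι) := by
  have h := frobeniusNorm_mul_le_left A 1
  rwa [mul_one, ← Real.sqrt_sq (frobeniusNorm_nonneg 1), frobeniusNorm_one_sq] at h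

end Frobenius

/-! ### Hermitian matrices and the Cayley transform -/

section Cayley

open scoped Matrix.Norms.L2Operator
open Complex

variable {ι : Type*}

/-- The linear identification of real matrices with Hermitian complex matrices,
`A ↦ (A + Aᵀ) / 2 + i (A - Aᵀ) / 2`. -/
noncomputable def hermitianOfReal : Matrix ι ι ℝ →ₗ[ℝ] Matrix ι ι ℂ where
  toFun A := Matrix.of fun i j => (((A i j + A j i) / 2 : ℝ) : ℂ) + ((A i j - A j i) / 2 : ℝ) * I
  map_add' A B := by
    ext i j
    simp only [Matrix.of_apply, Matrix.add_apply]
    push_cast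
    ring
  map_smul' c A := by
    ext i j
    simp only [Matrix.of_apply, Matrix.smul_apply, smul_eq_mul, real_smul, RingHom.id_apply]
    push_cast
    ring

theorem hermitianOfReal_apply (A : Matrix ι ι ℝ) (i j : ι) :
    hermitianOfReal A i j = (((A i j + A j i) / 2 : ℝ) : ℂ) + ((A i j - A j i) / 2 : ℝ) * I := rfl

theorem isHermitian_hermitianOfReal (A : Matrix ι ι ℝ) : (hermitianOfReal A).IsHermitian := by
  ext i j
  simp only [Matrix.conjTranspose_apply, hermitianOfReal_apply]
  apply Complex.ext <;> simp <;> ring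

theorem exists_hermitianOfReal_eq {H : Matrix ι ι ℂ} (hH : H.IsHermitian) :
    ∃ A : Matrix ι ι ℝ, hermitianOfReal A = H ∧ ∀ i j, A i j = (H i j).re + (H i j).im := by
  refine ⟨Matrix.of fun i j => (H i j).re + (H i j).im, ?_, fun i j => rfl⟩
  ext i j
  have h := hH.apply i j
  have h1 : (H i j).re = (H j i).re := by rw [← h]; simp
  have h2 : (H i j).im = -(H j i).im := by rw [← h]; simp
  rw [hermitianOfReal_apply]
  apply Complex.ext <;> simp [h1, h2] <;> ring

variable [Fintype ι]

/-- The real coordinates are isometric for the Frobenius norm, so counting Hermitian matrices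
becomes counting in Euclidean space of dimension `d ^ 2`. -/
theorem frobeniusNorm_hermitianOfReal_sq (A : Matrix ι ι ℝ) :
    frobeniusNorm (hermitianOfReal A) ^ 2 = ∑ i, ∑ j, A i j ^ 2 := by
  have h : ∀ i j, ‖hermitianOfReal A i j‖ ^ 2 = (A i j ^ 2 + A j i ^ 2) / 2 := fun i j => by
    rw [hermitianOfReal_apply, ← normSq_eq_norm_sq, normSq_add_mul_I]
    ring
  rw [frobeniusNorm_sq]
  simp only [h, ← Finset.sum_div, Finset.sum_add_distrib]
  rw [Finset.sum_comm (f := fun i j => A j i ^ 2)]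
  ring

variable [DecidableEq ι]

theorem exists_unitary_diagonal {H : Matrix ι ι ℂ} (hH : H.IsHermitian) :
    ∃ Q ∈ Matrix.unitaryGroup ι ℂ, ∃ l : ι → ℝ,
      H = Q * Matrix.diagonal (fun i => (l i : ℂ)) * Qᴴ := by
  refine ⟨hH.eigenvectorUnitary, hH.eigenvectorUnitary.2, hH.eigenvalues, ?_⟩
  conv_lhs => rw [hH.spectral_theorem]
  rfl

/-- The Cayley transform `(1 + i H) (1 - i H)⁻¹ = 2 (1 - i H)⁻¹ - 1`. -/
noncomputable def cayley (H : Matrix ι ι ℂ) : Matrix ι ι ℂ := (2 : ℂ) • (1 - I • H)⁻¹ - 1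

theorem one_sub_I_mul_ofReal_ne_zero (x : ℝ) : (1 : ℂ) - I * x ≠ 0 := by
  intro h
  simpa using congrArg Complex.re h

theorem conj_unitary_diagonal_mul {Q : Matrix ι ι ℂ} (hQ : Q ∈ Matrix.unitaryGroup ι ℂ)
    (a b : ι → ℂ) :
    (Q * Matrix.diagonal a * Qᴴ) * (Q * Matrix.diagonal b * Qᴴ) =
      Q * Matrix.diagonal (fun i => a i * b i) * Qᴴ := by
  have h : Qᴴ * Q = 1 := Matrix.mem_unitaryGroup_iff'.1 hQ
  calc _ = Q * Matrix.diagonal a * (Qᴴ * Q) * Matrix.diagonal b * Qᴴ := by noncomm_ring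
    _ = _ := by rw [h, mul_one, mul_assoc Q, Matrix.diagonal_mul_diagonal]

theorem conj_unitary_diagonal_one {Q : Matrix ι ι ℂ} (hQ : Q ∈ Matrix.unitaryGroup ι ℂ) :
    Q * Matrix.diagonal (fun _ => (1 : ℂ)) * Qᴴ = 1 := by
  rw [Matrix.diagonal_one, mul_one]
  exact Matrix.mem_unitaryGroup_iff.1 hQ

theorem one_sub_I_smul_eq {Q : Matrix ι ι ℂ} (hQ : Q ∈ Matrix.unitaryGroup ι ℂ) (l : ι → ℝ) :
    1 - I • (Q * Matrix.diagonal (fun i => (l i : ℂ)) * Qᴴ) =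
      Q * Matrix.diagonal (fun i => 1 - I * (l i : ℂ)) * Qᴴ := by
  have : Matrix.diagonal (fun i => 1 - I * (l i : ℂ)) =
      Matrix.diagonal (fun _ : ι => (1 : ℂ)) - I • Matrix.diagonal (fun i => (l i : ℂ)) := by
    rw [← Matrix.diagonal_smul, Matrix.diagonal_sub]
    rfl
  rw [this, mul_sub, sub_mul, conj_unitary_diagonal_one hQ, Matrix.mul_smul, Matrix.smul_mul]

theorem inv_one_sub_I_smul {Q : Matrix ι ι ℂ} (hQ : Q ∈ Matrix.unitaryGroup ι ℂ) (l : ι → ℝ) :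
    (1 - I • (Q * Matrix.diagonal (fun i => (l i : ℂ)) * Qᴴ))⁻¹ =
      Q * Matrix.diagonal (fun i => (1 - I * (l i : ℂ))⁻¹) * Qᴴ := by
  refine Matrix.inv_eq_left_inv ?_
  rw [one_sub_I_smul_eq hQ, conj_unitary_diagonal_mul hQ, ← conj_unitary_diagonal_one hQ]
  simp [inv_mul_cancel₀ (one_sub_I_mul_ofReal_ne_zero _)]

theorem inv_mul_one_sub_I_smul {H : Matrix ι ι ℂ} (hH : H.IsHermitian) :
    (1 - I • H)⁻¹ * (1 - I • H) = 1 := by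
  obtain ⟨Q, hQ, l, rfl⟩ := exists_unitary_diagonal hH
  rw [inv_one_sub_I_smul hQ, one_sub_I_smul_eq hQ, conj_unitary_diagonal_mul hQ,
    ← conj_unitary_diagonal_one hQ]
  simp [inv_mul_cancel₀ (one_sub_I_mul_ofReal_ne_zero _)]

theorem one_sub_I_smul_mul_inv {H : Matrix ι ι ℂ} (hH : H.IsHermitian) :
    (1 - I • H) * (1 - I • H)⁻¹ = 1 :=
  mul_eq_one_comm.1 (inv_mul_one_sub_I_smul hH)

theorem norm_le_one_of_mem_unitaryGroup {U : Matrix ι ι ℂ} (hU : U ∈ Matrix.unitaryGroup ι ℂ) :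
    ‖U‖ ≤ 1 := by
  have h : Uᴴ * U = 1 := Matrix.mem_unitaryGroup_iff'.1 hU
  have h1 := Matrix.l2_opNorm_conjTranspose_mul_self U
  have h2 : ‖(1 : Matrix ι ι ℂ)‖ ≤ 1 := by
    rw [← Matrix.diagonal_one, Matrix.l2_opNorm_diagonal]
    exact (pi_norm_le_iff_of_nonneg zero_le_one).2 fun _ => by simp
  rw [h] at h1
  nlinarith [norm_nonneg U]

theorem norm_conj_unitary_diagonal_le {Q : Matrix ι ι ℂ} (hQ : Q ∈ Matrix.unitaryGroup ι ℂ)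
    {a : ι → ℂ} {r : ℝ} (hr : 0 ≤ r) (ha : ∀ i, ‖a i‖ ≤ r) :
    ‖Q * Matrix.diagonal a * Qᴴ‖ ≤ r := by
  have hd : ‖Matrix.diagonal a‖ ≤ r := by
    rw [Matrix.l2_opNorm_diagonal]
    exact (pi_norm_le_iff_of_nonneg hr).2 ha
  have hQ1 := norm_le_one_of_mem_unitaryGroup hQ
  have hQ2 : ‖Qᴴ‖ ≤ 1 := by rwa [Matrix.l2_opNorm_conjTranspose]
  calc _ ≤ ‖Q‖ * ‖Matrix.diagonal a‖ * ‖Qᴴ‖ :=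
        (norm_mul_le _ _).trans (mul_le_mul_of_nonneg_right (norm_mul_le _ _) (norm_nonneg _))
    _ ≤ 1 * r * 1 := by gcongr
    _ = r := by ring

/-- In an eigenbasis the entries are `1 / (1 - i l)`, whose denominators have real part 1. -/
theorem norm_inv_one_sub_I_smul_le {H : Matrix ι ι ℂ} (hH : H.IsHermitian) :
    ‖(1 - I • H)⁻¹‖ ≤ 1 := by
  obtain ⟨Q, hQ, l, rfl⟩ := exists_unitary_diagonal hH
  rw [inv_one_sub_I_smul hQ]
  refine norm_conj_unitary_diagonal_le hQ zero_le_one fun i => ?_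
  rw [norm_inv]
  refine inv_le_one_of_one_le₀ ?_
  have := Complex.abs_re_le_norm (1 - I * (l i : ℂ))
  simpa using this

/-- The Cayley transform in an eigenbasis. -/
theorem exists_cayley_eq {H : Matrix ι ι ℂ} (hH : H.IsHermitian) :
    ∃ Q ∈ Matrix.unitaryGroup ι ℂ, ∃ z : ι → ℂ, (∀ i, ‖z i‖ = 1) ∧
      cayley H = Q * Matrix.diagonal z * Qᴴ := by
  obtain ⟨Q, hQ, l, rfl⟩ := exists_unitary_diagonal hH
  refine ⟨Q, hQ, fun i => 2 * (1 - I * (l i : ℂ))⁻¹ - 1, fun i => ?_, ?_⟩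
  · have h0 := one_sub_I_mul_ofReal_ne_zero (l i)
    have : 2 * (1 - I * (l i : ℂ))⁻¹ - 1 = (starRingEnd ℂ) (1 - I * (l i : ℂ)) /
        (1 - I * (l i : ℂ)) := by
      field_simp
      simp
      ring
    change ‖2 * (1 - I * (l i : ℂ))⁻¹ - 1‖ = 1
    rw [this, norm_div, RCLike.norm_conj, div_self (norm_ne_zero_iff.2 h0)]
  · rw [cayley, inv_one_sub_I_smul hQ]
    have : Matrix.diagonal (fun i => 2 * (1 - I * (l i : ℂ))⁻¹ - 1) =
        (2 : ℂ) • Matrix.diagonal (fun i => (1 - I * (l i : ℂ))⁻¹) -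
          Matrix.diagonal (fun _ : ι => (1 : ℂ)) := by
      rw [← Matrix.diagonal_smul, Matrix.diagonal_sub]
      rfl
    rw [this, mul_sub, sub_mul, conj_unitary_diagonal_one hQ, Matrix.mul_smul, Matrix.smul_mul]

theorem conj_unitary_diagonal_mem {Q : Matrix ι ι ℂ} (hQ : Q ∈ Matrix.unitaryGroup ι ℂ)
    {z : ι → ℂ} (hz : ∀ i, ‖z i‖ = 1) :
    Q * Matrix.diagonal z * Qᴴ ∈ Matrix.unitaryGroup ι ℂ := by
  have hd : Matrix.diagonal z ∈ Matrix.unitaryGroup ι ℂ := by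
    rw [Matrix.mem_unitaryGroup_iff, Matrix.star_eq_conjTranspose, Matrix.diagonal_conjTranspose,
      Matrix.diagonal_mul_diagonal, ← Matrix.diagonal_one]
    congr 1
    ext i
    have := RCLike.mul_conj (z i)
    simpa [hz i] using this
  exact mul_mem (mul_mem hQ hd) (Unitary.star_mem hQ)

theorem cayley_mem_unitaryGroup {H : Matrix ι ι ℂ} (hH : H.IsHermitian) :
    cayley H ∈ Matrix.unitaryGroup ι ℂ := by
  obtain ⟨Q, hQ, z, hz, h⟩ := exists_cayley_eq hH
  exact h ▸ conj_unitary_diagonal_mem hQ hz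

/-- The resolvent identity. Read forwards, with resolvents of norm at most 1, it makes the Cayley
transform 2-Lipschitz; solved for `H - H'`, it bounds the inverse on bounded sets. -/
theorem cayley_sub_cayley {H H' : Matrix ι ι ℂ} (hH : H.IsHermitian) (hH' : H'.IsHermitian) :
    cayley H - cayley H' = (2 * I) • ((1 - I • H)⁻¹ * (H - H') * (1 - I • H')⁻¹) := by
  have h1 := inv_mul_one_sub_I_smul hH
  have h2 := one_sub_I_smul_mul_inv hH'
  have : I • ((1 - I • H)⁻¹ * (H - H') * (1 - I • H')⁻¹) = (1 - I • H)⁻¹ - (1 - I • H')⁻¹ := by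
    calc _ = (1 - I • H)⁻¹ * ((1 - I • H') - (1 - I • H)) * (1 - I • H')⁻¹ := by
          rw [sub_sub_sub_cancel_left, ← smul_sub, Matrix.mul_smul, Matrix.smul_mul]
      _ = (1 - I • H)⁻¹ * ((1 - I • H') * (1 - I • H')⁻¹) -
            ((1 - I • H)⁻¹ * (1 - I • H)) * (1 - I • H')⁻¹ := by noncomm_ring
      _ = _ := by rw [h1, h2, mul_one, one_mul]
  rw [mul_smul, this, cayley, cayley, smul_sub]
  abel

theorem norm_cayley_sub_cayley_le {H H' : Matrix ι ι ℂ} (hH : H.IsHermitian)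
    (hH' : H'.IsHermitian) : ‖cayley H - cayley H'‖ ≤ 2 * ‖H - H'‖ := by
  rw [cayley_sub_cayley hH hH', norm_smul]
  have h1 := norm_inv_one_sub_I_smul_le hH
  have h2 := norm_inv_one_sub_I_smul_le hH'
  have h3 : ‖(1 - I • H)⁻¹ * (H - H') * (1 - I • H')⁻¹‖ ≤ 1 * ‖H - H'‖ * 1 :=
    (norm_mul_le _ _).trans (by gcongr; exact (norm_mul_le _ _).trans (by gcongr))
  have h4 : ‖2 * I‖ = 2 := by simp
  rw [h4]
  linarith

theorem frobeniusNorm_sub_le_of_cayley {H H' : Matrix ι ι ℂ} (hH : H.IsHermitian)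
    (hH' : H'.IsHermitian) : frobeniusNorm (H - H') ≤
      (1 + ‖H‖) * (1 + ‖H'‖) / 2 * frobeniusNorm (cayley H - cayley H') := by
  have key : (1 - I • H) * (cayley H - cayley H') * (1 - I • H') = (2 * I) • (H - H') := by
    rw [cayley_sub_cayley hH hH', Matrix.mul_smul, Matrix.smul_mul]
    congr 1
    calc _ = ((1 - I • H) * (1 - I • H)⁻¹) * (H - H') * ((1 - I • H')⁻¹ * (1 - I • H')) := by
          noncomm_ring
      _ = _ := by rw [one_sub_I_smul_mul_inv hH, inv_mul_one_sub_I_smul hH', one_mul, mul_one]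
  have hn : ∀ K : Matrix ι ι ℂ, ‖1 - I • K‖ ≤ 1 + ‖K‖ := fun K => by
    refine (norm_sub_le _ _).trans ?_
    rw [norm_smul, norm_I, one_mul]
    gcongr
    exact norm_le_one_of_mem_unitaryGroup (one_mem _)
  have h := congrArg frobeniusNorm key
  rw [frobeniusNorm_smul, norm_mul, norm_I, Complex.norm_ofNat] at h
  have h2 : frobeniusNorm ((1 - I • H) * (cayley H - cayley H') * (1 - I • H')) ≤
      (1 + ‖H‖) * frobeniusNorm (cayley H - cayley H') * (1 + ‖H'‖) := by
    refine (frobeniusNorm_mul_le_right _ _).trans ?_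
    refine mul_le_mul ((frobeniusNorm_mul_le_left _ _).trans ?_) (hn H') (norm_nonneg _) ?_
    · exact mul_le_mul_of_nonneg_right (hn H) (frobeniusNorm_nonneg _)
    · exact mul_nonneg (by positivity) (frobeniusNorm_nonneg _)
  linarith

/-- A unitary close to the identity is the Cayley transform of a bounded Hermitian matrix. -/
theorem exists_cayley_eq_of_norm_sub_one_le {V : Matrix ι ι ℂ}
    (hV : V ∈ Matrix.unitaryGroup ι ℂ) (h1 : ‖V - 1‖ ≤ 1 / 2) :
    ∃ H : Matrix ι ι ℂ, H.IsHermitian ∧ ‖H‖ ≤ 3 ∧ cayley H = V := by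
  -- If `V = cayley H`, then `Y = (1 - i H)⁻¹`; this forces `H = i (Y⁻¹ - 1)`.
  set Y : Matrix ι ι ℂ := (1 / 2 : ℂ) • (1 + V) with hY
  have hY1 : ‖1 - Y‖ ≤ 1 / 4 := by
    have : 1 - Y = (-(1 / 2) : ℂ) • (V - 1) := by rw [hY]; module
    rw [this, norm_smul]
    norm_num
    linarith
  have hunit : IsUnit Y := by
    have := isUnit_one_sub_of_norm_lt_one (x := 1 - Y) (by linarith)
    rwa [sub_sub_cancel] at this
  have hdet := (Matrix.isUnit_iff_isUnit_det Y).1 hunit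
  have hYW : Y * Y⁻¹ = 1 := Matrix.mul_nonsing_inv _ hdet
  have hWY : Y⁻¹ * Y = 1 := Matrix.nonsing_inv_mul _ hdet
  have hone : ‖(1 : Matrix ι ι ℂ)‖ ≤ 1 := norm_le_one_of_mem_unitaryGroup (one_mem _)
  -- A self-bounding estimate: `‖Y⁻¹‖ ≤ 1 + ‖Y⁻¹‖ / 4`. The bound 2 then gives `‖H‖ ≤ 3`.
  have hW : ‖Y⁻¹‖ ≤ 2 := by
    have h2 : Y⁻¹ = 1 + Y⁻¹ * (1 - Y) := by rw [mul_sub, hWY]; simp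
    have h3 : ‖Y⁻¹‖ ≤ 1 + ‖Y⁻¹‖ * (1 / 4) := by
      calc ‖Y⁻¹‖ = ‖1 + Y⁻¹ * (1 - Y)‖ := by rw [← h2]
        _ ≤ ‖(1 : Matrix ι ι ℂ)‖ + ‖Y⁻¹ * (1 - Y)‖ := norm_add_le _ _
        _ ≤ 1 + ‖Y⁻¹‖ * (1 / 4) := by
          gcongr
          exact (norm_mul_le _ _).trans (by gcongr)
    linarith
  have hVV : V * Vᴴ = 1 := Matrix.mem_unitaryGroup_iff.1 hV
  have hYs : Yᴴ = (1 / 2 : ℂ) • (1 + Vᴴ) := by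
    rw [hY, Matrix.conjTranspose_smul, Matrix.conjTranspose_add, Matrix.conjTranspose_one]
    simp
  have hWYs : (Y⁻¹)ᴴ * Yᴴ = 1 := by rw [← Matrix.conjTranspose_mul, hYW]; simp
  have hYWs : Yᴴ * (Y⁻¹)ᴴ = 1 := by rw [← Matrix.conjTranspose_mul, hWY]; simp
  -- This says that `H` is Hermitian. Unitarity of `V` gives `2 Y Yᴴ = Y + Yᴴ`, and one divides by
  -- `Y` on the left and by `Yᴴ` on the right.
  have hsum : Y⁻¹ + (Y⁻¹)ᴴ = 2 := by
    have e1 : Y * Yᴴ + Y * Yᴴ = Y + Yᴴ := by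
      rw [hYs, hY, Matrix.smul_mul, Matrix.mul_smul, add_mul, mul_add, mul_add, hVV]
      simp only [one_mul, mul_one]
      module
    calc Y⁻¹ + (Y⁻¹)ᴴ = Y⁻¹ * (Yᴴ * (Y⁻¹)ᴴ) + (Y⁻¹ * Y) * (Y⁻¹)ᴴ := by
          rw [hYWs, hWY, mul_one, one_mul]
      _ = Y⁻¹ * (Y + Yᴴ) * (Y⁻¹)ᴴ := by noncomm_ring
      _ = (Y⁻¹ * Y) * (Yᴴ * (Y⁻¹)ᴴ) + (Y⁻¹ * Y) * (Yᴴ * (Y⁻¹)ᴴ) := by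
          rw [← e1]; noncomm_ring
      _ = 2 := by rw [hWY, hYWs, mul_one, one_add_one_eq_two]
  have hWs : (Y⁻¹)ᴴ = 2 - Y⁻¹ := eq_sub_of_add_eq' hsum
  refine ⟨I • (Y⁻¹ - 1), ?_, ?_, ?_⟩
  · rw [Matrix.IsHermitian, Matrix.conjTranspose_smul, Matrix.conjTranspose_sub, hWs,
      Matrix.conjTranspose_one, ← one_add_one_eq_two]
    simp only [RCLike.star_def, conj_I]
    module
  · rw [norm_smul, norm_I, one_mul]
    exact (norm_sub_le _ _).trans (by linarith)
  · have : 1 - I • I • (Y⁻¹ - 1) = Y⁻¹ := by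
      rw [smul_smul, I_mul_I]
      module
    rw [cayley, this, Matrix.nonsing_inv_nonsing_inv _ hdet, hY]
    module

end Cayley

/-! ### Circuits -/

section Circuits

open Complex Function

variable {n : ℕ}

/-- The matrix `M` is a product of `m` two-qubit gates. -/
def IsCircuit (m : ℕ) (M : Matrix (QubitBasis n) (QubitBasis n) ℂ) : Prop :=
  ∃ U ∈ gateUnitaries n m, (U : Matrix (QubitBasis n) (QubitBasis n) ℂ) = M

theorem actOnPair_apply (i j : Fin n) (V : Matrix (Fin 2 × Fin 2) (Fin 2 × Fin 2) ℂ)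
    (x y : QubitBasis n) :
    actOnPair i j V x y = open Classical in
      if ∀ k, k ≠ i → k ≠ j → x k = y k then V (x i, x j) (y i, y j) else 0 := rfl

theorem actOnPair_conjTranspose (i j : Fin n) (V : Matrix (Fin 2 × Fin 2) (Fin 2 × Fin 2) ℂ) :
    (actOnPair i j V)ᴴ = actOnPair i j Vᴴ := by
  ext x y
  simp only [Matrix.conjTranspose_apply, actOnPair_apply]
  by_cases h : ∀ k, k ≠ i → k ≠ j → y k = x k
  · rw [if_pos h, if_pos fun k hi hj => (h k hi hj).symm]
  · rw [if_neg h, if_neg fun h' => h fun k hi hj => (h' k hi hj).symm, star_zero]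

theorem actOnPair_one (i j : Fin n) : actOnPair i j 1 = 1 := by
  ext x y
  simp only [actOnPair_apply, Matrix.one_apply, Prod.mk.injEq]
  by_cases hxy : x = y
  · simp [hxy]
  · rw [if_neg hxy]
    by_cases h : ∀ k, k ≠ i → k ≠ j → x k = y k
    · rw [if_pos h, if_neg]
      rintro ⟨hi, hj⟩
      refine hxy (funext fun k => ?_)
      by_cases hki : k = i
      · rw [hki, hi]
      by_cases hkj : k = j
      · rw [hkj, hj]
      exact h k hki hkj
    · rw [if_neg h]

theorem isTwoQubitGate_one (hn : 2 ≤ n) : IsTwoQubitGate (1 : QubitUnitary n) :=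
  ⟨⟨0, by omega⟩, ⟨1, by omega⟩, by simp, 1, one_mem _, by rw [actOnPair_one]; rfl⟩

theorem IsTwoQubitGate.inv {U : QubitUnitary n} (hU : IsTwoQubitGate U) :
    IsTwoQubitGate U⁻¹ := by
  obtain ⟨i, j, hij, V, hV, h⟩ := hU
  refine ⟨i, j, hij, Vᴴ, Unitary.star_mem hV, ?_⟩
  rw [← actOnPair_conjTranspose, ← h]
  rfl

theorem one_mem_gateUnitaries_zero : (1 : QubitUnitary n) ∈ gateUnitaries n 0 :=
  ⟨[], rfl, by simp, rfl⟩

theorem mul_mem_gateUnitaries {a b : ℕ} {U V : QubitUnitary n} (hU : U ∈ gateUnitaries n a)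
    (hV : V ∈ gateUnitaries n b) : U * V ∈ gateUnitaries n (a + b) := by
  obtain ⟨l, hl, hg, rfl⟩ := hU
  obtain ⟨l', hl', hg', rfl⟩ := hV
  refine ⟨l ++ l', by simp [hl, hl'], fun g hg2 => ?_, List.prod_append⟩
  rcases List.mem_append.1 hg2 with h | h
  exacts [hg g h, hg' g h]

theorem inv_mem_gateUnitaries {a : ℕ} {U : QubitUnitary n} (hU : U ∈ gateUnitaries n a) :
    U⁻¹ ∈ gateUnitaries n a := by
  obtain ⟨l, hl, hg, rfl⟩ := hU
  refine ⟨(l.map fun x => x⁻¹).reverse, by simpa using hl, fun g hg2 => ?_,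
    (List.prod_inv_reverse l).symm⟩
  rw [List.mem_reverse, List.mem_map] at hg2
  obtain ⟨a, ha, rfl⟩ := hg2
  exact (hg a ha).inv

/-- Circuits are padded with identity gates; two qubits are needed for the identity to be a gate at
all. -/
theorem gateUnitaries_mono (hn : 2 ≤ n) {a b : ℕ} (hab : a ≤ b) :
    gateUnitaries n a ⊆ gateUnitaries n b := by
  rintro _ ⟨l, hl, hg, rfl⟩
  refine ⟨l ++ List.replicate (b - a) 1, by simp [hl, hab], fun g hg2 => ?_, by simp⟩
  rcases List.mem_append.1 hg2 with h | h
  · exact hg g h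
  · rw [List.eq_of_mem_replicate h]
    exact isTwoQubitGate_one hn

theorem IsCircuit.one : IsCircuit 0 (1 : Matrix (QubitBasis n) (QubitBasis n) ℂ) :=
  ⟨1, one_mem_gateUnitaries_zero, rfl⟩

theorem IsCircuit.mul {a b : ℕ} {M N : Matrix (QubitBasis n) (QubitBasis n) ℂ}
    (hM : IsCircuit a M) (hN : IsCircuit b N) : IsCircuit (a + b) (M * N) := by
  obtain ⟨U, hU, rfl⟩ := hM
  obtain ⟨V, hV, rfl⟩ := hN
  exact ⟨U * V, mul_mem_gateUnitaries hU hV, rfl⟩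

theorem IsCircuit.conjTranspose {a : ℕ} {M : Matrix (QubitBasis n) (QubitBasis n) ℂ}
    (hM : IsCircuit a M) : IsCircuit a Mᴴ := by
  obtain ⟨U, hU, rfl⟩ := hM
  exact ⟨U⁻¹, inv_mem_gateUnitaries hU, rfl⟩

theorem IsCircuit.mono (hn : 2 ≤ n) {a b : ℕ} (hab : a ≤ b)
    {M : Matrix (QubitBasis n) (QubitBasis n) ℂ} (hM : IsCircuit a M) : IsCircuit b M := by
  obtain ⟨U, hU, rfl⟩ := hM
  exact ⟨U, gateUnitaries_mono hn hab hU, rfl⟩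

theorem IsCircuit.mem_unitaryGroup {a : ℕ} {M : Matrix (QubitBasis n) (QubitBasis n) ℂ}
    (hM : IsCircuit a M) : M ∈ Matrix.unitaryGroup (QubitBasis n) ℂ := by
  obtain ⟨U, -, rfl⟩ := hM
  exact U.2

/-! #### Controlled single-qubit operators -/

/-- The operator that acts on the qubit `t` by `A x`, where `x` is the state of the other qubits
(with the qubit `t` set to `0`). -/
def controlled (t : Fin n) (A : QubitBasis n → Matrix (Fin 2) (Fin 2) ℂ) :
    Matrix (QubitBasis n) (QubitBasis n) ℂ :=
  Matrix.of fun x y => if ∀ k, k ≠ t → x k = y k then A (update x t 0) (x t) (y t) else 0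

theorem controlled_apply (t : Fin n) (A : QubitBasis n → Matrix (Fin 2) (Fin 2) ℂ)
    (x y : QubitBasis n) : controlled t A x y =
      if ∀ k, k ≠ t → x k = y k then A (update x t 0) (x t) (y t) else 0 := rfl

theorem sum_ite_agree (t : Fin n) (x : QubitBasis n) (g : QubitBasis n → ℂ) :
    (∑ y, if ∀ k, k ≠ t → x k = y k then g y else 0) = ∑ b, g (update x t b) := by
  rw [← Finset.sum_filter]
  have : (Finset.univ.filter fun y : QubitBasis n => ∀ k, k ≠ t → x k = y k) =
      Finset.univ.map ⟨update x t, update_injective x t⟩ := by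
    ext y
    simp only [Finset.mem_filter, Finset.mem_univ, true_and, Finset.mem_map,
      Embedding.coeFn_mk]
    constructor
    · intro h
      refine ⟨y t, funext fun k => ?_⟩
      by_cases hk : k = t
      · subst hk; simp
      · rw [update_of_ne hk, h k hk]
    · rintro ⟨b, rfl⟩ k hk
      rw [update_of_ne hk]
  rw [this, Finset.sum_map]
  rfl

theorem controlled_mulVec_apply (t : Fin n) (A : QubitBasis n → Matrix (Fin 2) (Fin 2) ℂ)
    (f : QubitBasis n → ℂ) (x : QubitBasis n) :
    (controlled t A *ᵥ f) x = ∑ b, A (update x t 0) (x t) b * f (update x t b) := by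
  have := sum_ite_agree t x fun y => A (update x t 0) (x t) (y t) * f y
  simp only [update_self] at this
  rw [← this, Matrix.mulVec, dotProduct]
  simp only [controlled_apply, ite_mul, zero_mul]

/-- Both operators are block diagonal over the states of the other qubits. Evaluating `A` and `B` at
`update x t 0` makes the block independent of the value of the qubit `t`, so products are taken
blockwise. -/
theorem controlled_mul (t : Fin n) (A B : QubitBasis n → Matrix (Fin 2) (Fin 2) ℂ) :
    controlled t A * controlled t B = controlled t fun x => A x * B x := by
  ext x z
  have h := controlled_mulVec_apply t A (fun y => controlled t B y z) x
  rw [Matrix.mulVec, dotProduct] at h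
  rw [Matrix.mul_apply, h]
  simp only [controlled_apply, update_idem, update_self]
  have hiff : ∀ b, (∀ k, k ≠ t → update x t b k = z k) ↔ ∀ k, k ≠ t → x k = z k := fun b =>
    forall₂_congr fun k hk => by rw [update_of_ne hk]
  simp only [hiff]
  split_ifs
  · rw [Matrix.mul_apply]
  · simp

/-- An operator on one qubit that is controlled by another qubit is a two-qubit gate. -/
theorem isCircuit_one_controlled {c t : Fin n} (hct : c ≠ t)
    {A : QubitBasis n → Matrix (Fin 2) (Fin 2) ℂ} (B : Fin 2 → Matrix (Fin 2) (Fin 2) ℂ)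
    (hB : ∀ b, B b ∈ Matrix.unitaryGroup (Fin 2) ℂ) (hA : ∀ x, A x = B (x c)) :
    IsCircuit 1 (controlled t A) := by
  have hV : Matrix.blockDiagonal B ∈ Matrix.unitaryGroup (Fin 2 × Fin 2) ℂ := by
    rw [Matrix.mem_unitaryGroup_iff, Matrix.star_eq_conjTranspose,
      Matrix.blockDiagonal_conjTranspose, ← Matrix.blockDiagonal_mul, ← Matrix.blockDiagonal_one]
    congr 1
    funext b
    exact Matrix.mem_unitaryGroup_iff.1 (hB b)
  have hEq : controlled t A = actOnPair t c (Matrix.blockDiagonal B) := by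
    ext x y
    rw [controlled_apply, actOnPair_apply, Matrix.blockDiagonal_apply, hA, update_of_ne hct]
    by_cases h : ∀ k, k ≠ t → x k = y k
    · rw [if_pos h, if_pos fun k hk _ => h k hk, if_pos (h c hct)]
    · rw [if_neg h]
      by_cases h2 : ∀ k, k ≠ t → k ≠ c → x k = y k
      · rw [if_pos h2, if_neg]
        intro hc
        refine h fun k hk => ?_
        by_cases hkc : k = c
        · exact hkc ▸ hc
        · exact h2 k hk hkc
      · rw [if_neg h2]
  -- Unitarity is checked in the controlled form, where the operator and its adjoint multiply block
  -- by block.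
  have hU : actOnPair t c (Matrix.blockDiagonal B) ∈ Matrix.unitaryGroup (QubitBasis n) ℂ := by
    have h2 : actOnPair t c (Matrix.blockDiagonal fun b => (B b)ᴴ) =
        controlled t fun x => (A x)ᴴ := by
      ext x y
      have := congrFun (congrFun (congrArg Matrix.conjTranspose hEq) x) y
      rw [actOnPair_conjTranspose, Matrix.blockDiagonal_conjTranspose] at this
      rw [← this, Matrix.conjTranspose_apply, controlled_apply, controlled_apply]
      by_cases h : ∀ k, k ≠ t → x k = y k
      · rw [if_pos h, if_pos fun k hk => (h k hk).symm, Matrix.conjTranspose_apply]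
        congr 2
        funext k
        by_cases hk : k = t
        · subst hk; simp
        · rw [update_of_ne hk, update_of_ne hk, h k hk]
      · rw [if_neg h, if_neg fun h' => h fun k hk => (h' k hk).symm, star_zero]
    rw [Matrix.mem_unitaryGroup_iff, Matrix.star_eq_conjTranspose, actOnPair_conjTranspose,
      Matrix.blockDiagonal_conjTranspose, h2, ← hEq, controlled_mul, ← actOnPair_one t c,
      ← Matrix.blockDiagonal_one]
    have h3 : (fun x => A x * (A x)ᴴ) = fun _ => 1 := funext fun x => by
      rw [hA]
      exact Matrix.mem_unitaryGroup_iff.1 (hB _)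
    rw [h3]
    ext x y
    rw [Matrix.blockDiagonal_one, actOnPair_one, controlled_apply, Matrix.one_apply,
      Matrix.one_apply]
    by_cases hxy : x = y
    · simp [hxy]
    · rw [if_neg hxy]
      by_cases h : ∀ k, k ≠ t → x k = y k
      · rw [if_pos h, if_neg]
        intro ht
        refine hxy (funext fun k => ?_)
        by_cases hk : k = t
        · exact hk ▸ ht
        · exact h k hk
      · rw [if_neg h]
  refine ⟨⟨_, hU⟩, ⟨[⟨_, hU⟩], rfl, fun g hg => ?_, by simp⟩, hEq.symm⟩
  rw [List.mem_singleton.1 hg]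
  exact ⟨t, c, hct.symm, _, hV, rfl⟩

/-- The Pauli matrix `X`. -/
def pauliX : Matrix (Fin 2) (Fin 2) ℂ := !![0, 1; 1, 0]

theorem pauliX_mem_unitaryGroup : pauliX ∈ Matrix.unitaryGroup (Fin 2) ℂ := by
  rw [Matrix.mem_unitaryGroup_iff]
  ext i j
  fin_cases i <;> fin_cases j <;>
    simp [pauliX, Matrix.mul_apply, Fin.sum_univ_two, Matrix.star_apply]

/-- A one-parameter group of unitaries of `ℂ²` that is inverted by conjugation with `X`. -/
structure IsFlippedRotation (T : ℝ → Matrix (Fin 2) (Fin 2) ℂ) : Prop where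
  mem_unitaryGroup : ∀ a, T a ∈ Matrix.unitaryGroup (Fin 2) ℂ
  add : ∀ a b, T (a + b) = T a * T b
  flip : ∀ a, pauliX * T a * pauliX = T (-a)

/-- Uniformly controlled rotations with `k` control qubits need at most `3 * 2 ^ k - 2` gates. -/
theorem isCircuit_controlled_rotation (hn : 2 ≤ n) {T : ℝ → Matrix (Fin 2) (Fin 2) ℂ}
    (hT : IsFlippedRotation T) (t : Fin n) (S : Finset (Fin n)) (htS : t ∉ S)
    (θ : QubitBasis n → ℝ) (hθ : DependsOn θ S) :
    IsCircuit (3 * 2 ^ S.card - 2) (controlled t fun x => T (θ x)) := by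
  induction S using Finset.induction_on generalizing θ with
  | empty =>
    have : Nontrivial (Fin n) := Fin.nontrivial_iff_two_le.2 hn
    obtain ⟨c, hc⟩ := exists_ne t
    refine isCircuit_one_controlled hc (fun _ => T (θ 0)) (fun _ => hT.mem_unitaryGroup _)
      fun x => ?_
    rw [hθ (x := x) (y := 0) (by simp)]
  | insert c S hc ih =>
    have hct : c ≠ t := fun h => htS (h ▸ Finset.mem_insert_self c S)
    have htS' : t ∉ S := fun h => htS (Finset.mem_insert_of_mem h)
    have hdep : ∀ b : Fin 2, DependsOn (fun x => θ (update x c b)) S := fun b x y hxy => by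
      refine hθ fun i hi => ?_
      by_cases hic : i = c
      · subst hic; simp
      · rw [update_of_ne hic, update_of_ne hic]
        exact hxy i (Finset.mem_of_mem_insert_of_ne hi hic)
    -- Conjugation by a CNOT with control `c` turns the angle `β` into `-β` exactly when `c` is 1,
    -- so the total angle is `α + β` or `α - β`, which is `θ` in both cases. The two recursive calls
    -- and two CNOTs cost `2 * (3 * 2 ^ k - 2) + 2 = 3 * 2 ^ (k + 1) - 2`.
    set α : QubitBasis n → ℝ := fun x => (θ (update x c 0) + θ (update x c 1)) / 2 with hα
    set β : QubitBasis n → ℝ := fun x => (θ (update x c 0) - θ (update x c 1)) / 2 with hβ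
    have hαS : DependsOn α S := fun x y hxy => by
      have h0 := hdep 0 hxy
      have h1 := hdep 1 hxy
      simp only [hα] at *
      rw [h0, h1]
    have hβS : DependsOn β S := fun x y hxy => by
      have h0 := hdep 0 hxy
      have h1 := hdep 1 hxy
      simp only [hβ] at *
      rw [h0, h1]
    set B : Fin 2 → Matrix (Fin 2) (Fin 2) ℂ := ![1, pauliX] with hB
    have hcnot : IsCircuit 1 (controlled t fun x => B (x c)) := by
      refine isCircuit_one_controlled hct B (fun b => ?_) fun x => rfl
      fin_cases b
      · exact one_mem _
      · exact pauliX_mem_unitaryGroup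
    have key : (controlled t fun x => T (θ x)) = (controlled t fun x => T (α x)) *
        ((controlled t fun x => B (x c)) * (controlled t fun x => T (β x)) *
          (controlled t fun x => B (x c))) := by
      rw [controlled_mul, controlled_mul, controlled_mul]
      congr 1
      funext x
      have hx : x = update x c (x c) := (update_eq_self c x).symm
      have hcases : ∀ b : Fin 2, b = 0 ∨ b = 1 := by decide
      rcases hcases (x c) with h | h
      · rw [h]
        rw [h] at hx
        simp only [hB, Matrix.cons_val_zero, one_mul, mul_one]
        rw [← hT.add]
        congr 1
        simp only [hα, hβ, ← hx]
        ring
      · rw [h]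
        rw [h] at hx
        simp only [hB, Matrix.cons_val_one, Matrix.cons_val_zero, hT.flip]
        rw [← hT.add]
        congr 1
        simp only [hα, hβ, ← hx]
        ring
    rw [key]
    refine IsCircuit.mono hn ?_
      ((ih htS' α hαS).mul ((hcnot.mul (ih htS' β hβS)).mul hcnot))
    rw [Finset.card_insert_of_notMem hc, pow_succ]
    have := Nat.one_le_two_pow (n := S.card)
    omega

/-- The rotation `diag(e^{ia}, e^{-ia})`. -/
noncomputable def rotationZ (a : ℝ) : Matrix (Fin 2) (Fin 2) ℂ :=
  !![exp (a * I), 0; 0, exp (-a * I)]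

/-- The real rotation by the angle `a`. -/
noncomputable def rotationY (a : ℝ) : Matrix (Fin 2) (Fin 2) ℂ :=
  !![(Real.cos a : ℂ), -(Real.sin a : ℂ); (Real.sin a : ℂ), (Real.cos a : ℂ)]

theorem isFlippedRotation_rotationZ : IsFlippedRotation rotationZ where
  mem_unitaryGroup a := by
    rw [Matrix.mem_unitaryGroup_iff]
    ext i j
    fin_cases i <;> fin_cases j <;>
      simp [rotationZ, Matrix.mul_apply, Fin.sum_univ_two, Matrix.star_apply, ← exp_conj, ← exp_add]
  add a b := by
    ext i j
    fin_cases i <;> fin_cases j <;>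
      simp [rotationZ, Matrix.mul_apply, Fin.sum_univ_two, ← exp_add] <;> ring_nf
  flip a := by
    ext i j
    fin_cases i <;> fin_cases j <;>
      simp [rotationZ, pauliX, Matrix.mul_apply, Fin.sum_univ_two]

theorem isFlippedRotation_rotationY : IsFlippedRotation rotationY where
  mem_unitaryGroup a := by
    have h : (Real.cos a : ℂ) * Real.cos a + Real.sin a * Real.sin a = 1 := by
      have := Real.cos_sq_add_sin_sq a
      rw [sq, sq] at this
      exact_mod_cast this
    rw [Matrix.mem_unitaryGroup_iff]
    ext i j
    fin_cases i <;> fin_cases j <;>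
      simp only [rotationY, Matrix.mul_apply, Fin.sum_univ_two, Matrix.star_apply, Matrix.of_apply,
        Matrix.cons_val', Matrix.cons_val_zero, Matrix.cons_val_one, Fin.zero_eta, Fin.mk_one,
        map_neg, RCLike.star_def, conj_ofReal, Matrix.one_apply_eq, Matrix.cons_val_fin_one]
    · linear_combination h
    · rw [Matrix.one_apply_ne (by decide)]; ring
    · rw [Matrix.one_apply_ne (by decide)]; ring
    · linear_combination h
  add a b := by
    ext i j
    fin_cases i <;> fin_cases j <;>
      simp [rotationY, Matrix.mul_apply, Fin.sum_univ_two, cos_add, sin_add] <;> ring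
  flip a := by
    ext i j
    fin_cases i <;> fin_cases j <;>
      simp [rotationY, pauliX, Matrix.mul_apply, Fin.sum_univ_two]

end Circuits

/-! ### Exact synthesis of diagonal unitaries, pure states and Cayley transforms -/

section CircuitSynthesis

open Complex Function

variable {n : ℕ}

theorem exp_ofReal_mul_I_conj (a : ℝ) : (starRingEnd ℂ) (exp (a * I)) = exp (-a * I) := by
  rw [← exp_conj]
  simp

/-- A diagonal unitary on `k` of the qubits needs at most `3 * 2 ^ k` gates. -/
theorem isCircuit_diagonal (hn : 2 ≤ n) (S : Finset (Fin n)) (φ : QubitBasis n → ℝ)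
    (hφ : DependsOn φ S) :
    IsCircuit (3 * 2 ^ S.card) (Matrix.diagonal fun x => exp (φ x * I)) := by
  induction S using Finset.induction_on generalizing φ with
  | empty =>
    have hct : (⟨1, by omega⟩ : Fin n) ≠ ⟨0, by omega⟩ := by simp
    -- With no qubits left, the diagonal is a global phase: one gate with two equal scalar blocks.
    have h := isCircuit_one_controlled hct
      (A := fun _ => Matrix.diagonal fun _ => exp (φ 0 * I))
      (fun _ => Matrix.diagonal fun _ => exp (φ 0 * I)) (fun _ => ?_) (fun _ => rfl)
    · refine IsCircuit.mono hn (by simp) (?_ : IsCircuit 1 _)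
      convert h using 1
      ext x y
      rw [controlled_apply, Matrix.diagonal_apply, Matrix.diagonal_apply]
      by_cases hxy : x = y
      · simp only [hxy, implies_true, if_true]
        rw [hφ (x := y) (y := 0) (by simp)]
      · rw [if_neg hxy]
        by_cases h : ∀ k, k ≠ (⟨0, by omega⟩ : Fin n) → x k = y k
        · rw [if_pos h, if_neg]
          intro ht
          refine hxy (funext fun k => ?_)
          by_cases hk : k = ⟨0, by omega⟩
          · exact hk ▸ ht
          · exact h k hk
        · rw [if_neg h]
    · rw [Matrix.mem_unitaryGroup_iff, Matrix.star_eq_conjTranspose,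
        Matrix.diagonal_conjTranspose, Matrix.diagonal_mul_diagonal, ← Matrix.diagonal_one]
      congr 1
      funext i
      simp only [Pi.star_apply, RCLike.star_def]
      rw [exp_ofReal_mul_I_conj, ← exp_add]
      simp
  | insert t S ht ih =>
    have hdep : ∀ b : Fin 2, DependsOn (fun x => φ (update x t b)) S := fun b x y hxy => by
      refine hφ fun i hi => ?_
      by_cases hic : i = t
      · subst hic; simp
      · rw [update_of_ne hic, update_of_ne hic]
        exact hxy i (Finset.mem_of_mem_insert_of_ne hi hic)
    -- The half-sum of the two phases no longer involves `t` and is left to the induction; the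
    -- half-difference is a Z-rotation of `t` controlled by `S`.
    set α : QubitBasis n → ℝ := fun x => (φ (update x t 0) + φ (update x t 1)) / 2 with hα
    set β : QubitBasis n → ℝ := fun x => (φ (update x t 0) - φ (update x t 1)) / 2 with hβ
    have hαS : DependsOn α S := fun x y hxy => by
      have h0 := hdep 0 hxy
      have h1 := hdep 1 hxy
      simp only [hα] at *
      rw [h0, h1]
    have hβS : DependsOn β S := fun x y hxy => by
      have h0 := hdep 0 hxy
      have h1 := hdep 1 hxy
      simp only [hβ] at *
      rw [h0, h1]
    have key : (Matrix.diagonal fun x => exp (φ x * I)) =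
        (Matrix.diagonal fun x => exp (α x * I)) *
          (controlled t fun x => rotationZ (β x)) := by
      ext x y
      rw [Matrix.diagonal_mul, controlled_apply, Matrix.diagonal_apply]
      have hβx : β (update x t 0) = β x := by simp only [hβ, update_idem]
      have hx : x = update x t (x t) := (update_eq_self t x).symm
      have hcases : ∀ b : Fin 2, b = 0 ∨ b = 1 := by decide
      by_cases hxy : x = y
      · subst hxy
        rw [if_pos rfl, if_pos fun _ _ => rfl, hβx]
        rcases hcases (x t) with h | h
        · rw [h] at hx ⊢
          simp only [rotationZ, Matrix.of_apply, Matrix.cons_val', Matrix.cons_val_zero]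
          rw [← exp_add]
          congr 1
          simp only [hα, hβ, ← hx]
          push_cast
          ring
        · rw [h] at hx ⊢
          simp only [rotationZ, Matrix.of_apply, Matrix.cons_val', Matrix.cons_val_one,
            Matrix.cons_val_fin_one]
          rw [← exp_add]
          congr 1
          simp only [hα, hβ, ← hx]
          push_cast
          ring
      · rw [if_neg hxy]
        by_cases h : ∀ k, k ≠ t → x k = y k
        · rw [if_pos h]
          have hxyt : x t ≠ y t := fun hxyt => by
            refine hxy (funext fun k => ?_)
            by_cases hk : k = t
            · exact hk ▸ hxyt
            · exact h k hk
          have : rotationZ (β (update x t 0)) (x t) (y t) = 0 := by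
            rcases hcases (x t) with h1 | h1 <;> rcases hcases (y t) with h2 | h2 <;>
              first | exact absurd (h1.trans h2.symm) hxyt | simp [h1, h2, rotationZ]
          rw [this, mul_zero]
        · rw [if_neg h, mul_zero]
    rw [key]
    refine IsCircuit.mono hn ?_ ((ih α hαS).mul
      (isCircuit_controlled_rotation hn isFlippedRotation_rotationZ t S ht β hβS))
    rw [Finset.card_insert_of_notMem ht, pow_succ]
    omega

/-- Bit strings are paired along the qubit `t`, and each pair is charged to its member with `x t =
0`. This matches states in which the qubit `t` is still 0. -/
theorem sum_eq_sum_update (t : Fin n) (F : QubitBasis n → ℝ) :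
    ∑ x, F x = ∑ x, if x t = 0 then F (update x t 0) + F (update x t 1) else 0 := by
  let e := Equiv.funSplitAt t (Fin 2)
  rw [← e.symm.sum_comp, ← e.symm.sum_comp, Fintype.sum_prod_type_right,
    Fintype.sum_prod_type_right]
  refine Finset.sum_congr rfl fun r _ => ?_
  have h1 : ∀ b, e.symm (b, r) t = b := fun b => by simp [e]
  have h2 : ∀ b b', update (e.symm (b, r)) t b' = e.symm (b', r) := fun b b' => by
    funext k
    by_cases hk : k = t
    · subst hk; simp [e]
    · rw [update_of_ne hk]; simp [e, hk]
  simp [Fin.sum_univ_two, h1, h2]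

/-- A real nonnegative unit vector on `k` of the qubits can be prepared by `3 * 2 ^ k` gates. -/
theorem exists_isCircuit_mulVec_eq_ofReal (hn : 2 ≤ n) (S : Finset (Fin n))
    (f : QubitBasis n → ℝ) (hf0 : ∀ x, 0 ≤ f x) (hfS : ∀ x, ∀ i ∉ S, x i ≠ 0 → f x = 0)
    (hf1 : ∑ x, f x ^ 2 = 1) :
    ∃ M : Matrix (QubitBasis n) (QubitBasis n) ℂ, IsCircuit (3 * 2 ^ S.card) M ∧
      M *ᵥ Pi.single 0 1 = fun x => (f x : ℂ) := by
  induction S using Finset.induction_on generalizing f with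
  | empty =>
    have hfne : ∀ x, x ≠ 0 → f x = 0 := fun x hx => by
      obtain ⟨i, hi⟩ := Function.ne_iff.1 hx
      exact hfS x i (by simp) hi
    have hf0' : f 0 = 1 := by
      rw [Finset.sum_eq_single 0 (fun x _ hx => by rw [hfne x hx]; ring) (by simp)] at hf1
      nlinarith [hf0 0]
    refine ⟨1, IsCircuit.one.mono hn (Nat.zero_le _), ?_⟩
    rw [Matrix.one_mulVec]
    funext x
    by_cases hx : x = 0
    · simp [hx, hf0']
    · simp [hx, hfne x hx]
  | insert t S ht ih =>
    -- The two amplitudes along `t` form one complex number. Its modulus `g` is a state on `S`,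
    -- prepared by induction; its argument is the angle of the Y-rotation that splits the modulus
    -- back into the two amplitudes, as cosine and sine.
    set w : QubitBasis n → ℂ := fun x => ⟨f (update x t 0), f (update x t 1)⟩ with hw
    set g : QubitBasis n → ℝ := fun x => if x t = 0 then ‖w x‖ else 0 with hg
    have hgS : ∀ x, ∀ i ∉ S, x i ≠ 0 → g x = 0 := fun x i hi hxi => by
      by_cases hit : i = t
      · subst hit
        exact if_neg hxi
      · have hiS : i ∉ insert t S := by simp [hit, hi]
        have hz : w x = 0 := by
          apply Complex.ext
          · exact hfS _ i hiS (by rwa [update_of_ne hit])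
          · exact hfS _ i hiS (by rwa [update_of_ne hit])
        simp [hg, hz]
    have hg1 : ∑ x, g x ^ 2 = 1 := by
      rw [← hf1, sum_eq_sum_update t fun x => f x ^ 2]
      refine Finset.sum_congr rfl fun x _ => ?_
      by_cases hx : x t = 0
      · simp only [hg, hx, if_true]
        rw [← normSq_eq_norm_sq, normSq_apply]
        simp only [hw]
        ring
      · simp [hg, hx]
    obtain ⟨M, hM, hMg⟩ := ih g
      (fun x => by simp only [hg]; split_ifs <;> positivity) hgS hg1
    -- Resetting the qubits outside `S` makes the angle depend on `S` only, without changing it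
    -- where the prepared state is supported.
    set proj : QubitBasis n → QubitBasis n := fun x i => if i ∈ S then x i else 0 with hproj
    set θ : QubitBasis n → ℝ := fun x => arg (w (proj x)) with hθ
    have hθS : DependsOn θ S := fun x y hxy => by
      have : proj x = proj y := by
        funext i
        by_cases hi : i ∈ S
        · simp [hproj, hi, hxy i hi]
        · simp [hproj, hi]
      simp only [hθ, this]
    refine ⟨_, IsCircuit.mono hn ?_ ((isCircuit_controlled_rotation hn
      isFlippedRotation_rotationY t S ht θ hθS).mul hM), ?_⟩
    · rw [Finset.card_insert_of_notMem ht, pow_succ]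
      omega
    rw [← Matrix.mulVec_mulVec, hMg]
    funext x
    rw [controlled_mulVec_apply, Fin.sum_univ_two]
    have hg1 : g (update x t 1) = 0 := by simp [hg]
    have hg0 : g (update x t 0) = ‖w x‖ := by simp [hg, hw]
    rw [hg1, hg0, ofReal_zero, mul_zero, add_zero]
    by_cases hx : ∀ i ∉ insert t S, x i = 0
    · have hpx : proj (update x t 0) = update x t 0 := by
        funext i
        simp only [hproj]
        split_ifs with hi
        · rfl
        · by_cases hit : i = t
          · subst hit; simp
          · rw [update_of_ne hit, hx i (by simp [hit, hi])]
      have hθx : θ (update x t 0) = arg (w x) := by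
        simp only [hθ, hpx]
        simp only [hw, update_idem]
      rw [hθx]
      have hx' : x = update x t (x t) := (update_eq_self t x).symm
      have hcases : ∀ b : Fin 2, b = 0 ∨ b = 1 := by decide
      rcases hcases (x t) with h | h
      · rw [h] at hx' ⊢
        simp only [rotationY, Matrix.of_apply, Matrix.cons_val', Matrix.cons_val_zero]
        rw [← ofReal_mul, mul_comm, norm_mul_cos_arg]
        simp only [hw, ← hx']
      · rw [h] at hx' ⊢
        simp only [rotationY, Matrix.of_apply, Matrix.cons_val', Matrix.cons_val_one,
          Matrix.cons_val_zero]
        rw [← ofReal_mul, mul_comm, norm_mul_sin_arg]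
        simp only [hw, ← hx']
    · push Not at hx
      obtain ⟨i, hi, hxi⟩ := hx
      have hit : i ≠ t := fun h => hi (h ▸ Finset.mem_insert_self _ _)
      have hz : w x = 0 := by
        apply Complex.ext
        · exact hfS _ i hi (by rwa [update_of_ne hit])
        · exact hfS _ i hi (by rwa [update_of_ne hit])
      rw [hz, hfS x i hi hxi]
      simp

/-- Every pure state can be prepared by `6 * 2 ^ n` gates. -/
theorem exists_isCircuit_mulVec_eq (hn : 2 ≤ n) (v : QubitBasis n → ℂ)
    (hv : ∑ x, ‖v x‖ ^ 2 = 1) :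
    ∃ M : Matrix (QubitBasis n) (QubitBasis n) ℂ, IsCircuit (6 * 2 ^ n) M ∧
      M *ᵥ Pi.single 0 1 = v := by
  -- The moduli are prepared first, and a diagonal unitary supplies the phases: `3 * 2 ^ n` gates
  -- each.
  obtain ⟨M, hM, hMv⟩ := exists_isCircuit_mulVec_eq_ofReal hn Finset.univ (fun x => ‖v x‖)
    (fun _ => norm_nonneg _) (by simp) hv
  have hD := isCircuit_diagonal hn Finset.univ (fun x => arg (v x))
    (by rw [Finset.coe_univ]; exact dependsOn_univ _)
  refine ⟨_, (hD.mul hM).mono hn (by simp; omega), ?_⟩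
  rw [← Matrix.mulVec_mulVec, hMv]
  funext x
  rw [Matrix.mulVec_diagonal, mul_comm]
  exact norm_mul_exp_arg_mul_I (v x)

/-- The operator depends on `Q` only through its column `j`. Hence `Q` may be replaced by any
unitary with that column, in particular by a short circuit that prepares it. -/
theorem conj_unitary_diagonal_update_one {ι : Type*} [Fintype ι] [DecidableEq ι]
    {Q : Matrix ι ι ℂ} (hQ : Q ∈ Matrix.unitaryGroup ι ℂ) (j : ι) (z : ℂ) :
    Q * Matrix.diagonal (update 1 j z) * Qᴴ =
      1 + (z - 1) • Matrix.vecMulVec (Q *ᵥ Pi.single j 1) (star (Q *ᵥ Pi.single j 1)) := by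
  have h1 : Matrix.diagonal (update (1 : ι → ℂ) j z) = 1 + (z - 1) •
      Matrix.vecMulVec (Pi.single j (1 : ℂ)) (star (Pi.single j (1 : ℂ))) := by
    ext a b
    rw [Matrix.diagonal_apply, Matrix.add_apply, Matrix.smul_apply, Matrix.vecMulVec_apply,
      Matrix.one_apply]
    by_cases hab : a = b
    · subst hab
      by_cases haj : a = j
      · subst haj; simp
      · simp [haj]
    · by_cases haj : a = j
      · have hbj : b ≠ j := fun h => hab (haj.trans h.symm)
        simp [hab, hbj]
      · simp [hab, haj]
  rw [h1, mul_add, add_mul, mul_one, Matrix.mul_smul, Matrix.smul_mul, Matrix.mul_vecMulVec,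
    Matrix.vecMulVec_mul, ← Matrix.star_mulVec]
  congr 1
  exact Matrix.mem_unitaryGroup_iff.1 hQ

/-- A unitary with one nontrivial eigenvalue needs at most `15 * 2 ^ n` gates. -/
theorem isCircuit_conj_unitary_diagonal_update (hn : 2 ≤ n)
    {Q : Matrix (QubitBasis n) (QubitBasis n) ℂ}
    (hQ : Q ∈ Matrix.unitaryGroup (QubitBasis n) ℂ) (j : QubitBasis n) {z : ℂ} (hz : ‖z‖ = 1) :
    IsCircuit (15 * 2 ^ n) (Q * Matrix.diagonal (update 1 j z) * Qᴴ) := by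
  have hv : ∑ x, ‖(Q *ᵥ Pi.single j 1) x‖ ^ 2 = 1 := by
    have h : (Qᴴ * Q) j j = 1 := by
      rw [← Matrix.star_eq_conjTranspose, Matrix.mem_unitaryGroup_iff'.1 hQ, Matrix.one_apply_eq]
    rw [Matrix.mul_apply] at h
    have h2 : (((∑ x, ‖Q x j‖ ^ 2 : ℝ)) : ℂ) = 1 := by
      rw [← h]
      push_cast
      refine Finset.sum_congr rfl fun x _ => ?_
      rw [Matrix.conjTranspose_apply, mul_comm]
      exact (RCLike.mul_conj _).symm
    simp only [Matrix.mulVec_single_one]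
    exact_mod_cast h2
  -- `P` sends the zero state to the eigenvector, so the phase is moved from the index `j` to the
  -- index 0. The cost of `P`, the diagonal and `Pᴴ` is 6 + 3 + 6 = 15 times `2 ^ n`.
  obtain ⟨P, hP, hPv⟩ := exists_isCircuit_mulVec_eq hn _ hv
  have hD := isCircuit_diagonal hn Finset.univ
    (fun x => if x = (0 : QubitBasis n) then arg z else 0)
    (by rw [Finset.coe_univ]; exact dependsOn_univ _)
  have hDz : (fun x => exp ((if x = (0 : QubitBasis n) then arg z else 0 : ℝ) * I)) =
      update (1 : QubitBasis n → ℂ) 0 z := by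
    funext x
    by_cases hx : x = 0
    · subst hx
      have := norm_mul_exp_arg_mul_I z
      rw [hz, ofReal_one, one_mul] at this
      simpa using this
    · simp [hx]
  rw [hDz] at hD
  rw [conj_unitary_diagonal_update_one hQ, ← hPv,
    ← conj_unitary_diagonal_update_one hP.mem_unitaryGroup]
  refine ((hP.mul hD).mul hP.conjTranspose).mono hn ?_
  simp
  omega

/-- Every diagonalized unitary needs at most `15 * 4 ^ n` gates. -/
theorem isCircuit_conj_unitary_diagonal (hn : 2 ≤ n)
    {Q : Matrix (QubitBasis n) (QubitBasis n) ℂ}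
    (hQ : Q ∈ Matrix.unitaryGroup (QubitBasis n) ℂ) {z : QubitBasis n → ℂ}
    (hz : ∀ i, ‖z i‖ = 1) : IsCircuit (15 * 4 ^ n) (Q * Matrix.diagonal z * Qᴴ) := by
  -- The eigenvalues are switched on one at a time; there are `2 ^ n` of them.
  have key : ∀ s : Finset (QubitBasis n), IsCircuit (s.card * (15 * 2 ^ n))
      (Q * Matrix.diagonal (fun i => if i ∈ s then z i else 1) * Qᴴ) := by
    intro s
    induction s using Finset.induction_on with
    | empty => simpa [Matrix.mem_unitaryGroup_iff.1 hQ, ← Matrix.star_eq_conjTranspose] using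
        IsCircuit.one
    | insert j s hj ih =>
      have h := ih.mul (isCircuit_conj_unitary_diagonal_update hn hQ j (hz j))
      rw [conj_unitary_diagonal_mul hQ] at h
      rw [Finset.card_insert_of_notMem hj, add_one_mul]
      convert h using 5 with i
      by_cases hij : i = j
      · subst hij; simp [hj]
      · simp [hij]
  have h := key Finset.univ
  simp only [Finset.mem_univ, if_true] at h
  refine h.mono hn (le_of_eq ?_)
  have : (4 : ℕ) ^ n = 2 ^ n * 2 ^ n := by rw [← mul_pow]; rfl
  rw [this]
  simp
  ring

/-- Cayley transforms of Hermitian matrices are products of `15 * 4 ^ n` two-qubit gates. -/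
theorem isCircuit_cayley (hn : 2 ≤ n) {H : Matrix (QubitBasis n) (QubitBasis n) ℂ}
    (hH : H.IsHermitian) : IsCircuit (15 * 4 ^ n) (cayley H) := by
  obtain ⟨Q, hQ, z, hz, h⟩ := exists_cayley_eq hH
  exact h ▸ isCircuit_conj_unitary_diagonal hn hQ hz

end CircuitSynthesis

/-! ### Operators acting on some of the tensor factors -/

section TensorFactor

open scoped Matrix.Norms.L2Operator

variable {α β γ : Type*} [Fintype α] [DecidableEq α] [Fintype β] [DecidableEq β]
  [Fintype γ] [DecidableEq γ]

/-- The embedding `A ↦ A ⊗ 1` of matrix algebras given by a factorization of the index set. -/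
def tensorFactorHom (e : α ≃ β × γ) : Matrix β β ℂ →⋆ₐ[ℂ] Matrix α α ℂ where
  toFun A := (A ⊗ₖ (1 : Matrix γ γ ℂ)).submatrix e e
  map_one' := by rw [Matrix.one_kronecker_one, Matrix.submatrix_one_equiv]
  map_mul' A B := by
    rw [Matrix.submatrix_mul_equiv, ← Matrix.mul_kronecker_mul, mul_one]
  map_zero' := by rw [Matrix.zero_kronecker]; rfl
  map_add' A B := by rw [Matrix.add_kronecker]; rfl
  commutes' r := by
    simp only [Algebra.algebraMap_eq_smul_one]
    rw [Matrix.smul_kronecker, Matrix.one_kronecker_one]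
    change r • ((1 : Matrix (β × γ) (β × γ) ℂ).submatrix e e) = _
    rw [Matrix.submatrix_one_equiv]
  map_star' A := by
    simp only [Matrix.star_eq_conjTranspose]
    rw [Matrix.conjTranspose_submatrix, Matrix.conjTranspose_kronecker,
      Matrix.conjTranspose_one]

theorem tensorFactorHom_apply (e : α ≃ β × γ) (A : Matrix β β ℂ) (x y : α) :
    tensorFactorHom e A x y = if (e x).2 = (e y).2 then A (e x).1 (e y).1 else 0 := by
  change A (e x).1 (e y).1 * (1 : Matrix γ γ ℂ) (e x).2 (e y).2 = _
  rw [Matrix.one_apply, mul_ite, mul_one, mul_zero]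

/-- Star homomorphisms of C⋆-algebras are contractive. -/
theorem norm_tensorFactorHom_le (e : α ≃ β × γ) (A : Matrix β β ℂ) :
    ‖tensorFactorHom e A‖ ≤ ‖A‖ :=
  NonUnitalStarAlgHom.norm_apply_le (tensorFactorHom e) A

theorem tensorFactorHom_mem_unitaryGroup (e : α ≃ β × γ) {A : Matrix β β ℂ}
    (hA : A ∈ Matrix.unitaryGroup β ℂ) : tensorFactorHom e A ∈ Matrix.unitaryGroup α ℂ :=
  Unitary.map_mem (tensorFactorHom e) hA

theorem frobeniusNorm_tensorFactorHom_sq (e : α ≃ β × γ) (A : Matrix β β ℂ) :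
    frobeniusNorm (tensorFactorHom e A) ^ 2 = Fintype.card γ * frobeniusNorm A ^ 2 := by
  have h : (tensorFactorHom e A)ᴴ * tensorFactorHom e A = tensorFactorHom e (Aᴴ * A) := by
    rw [map_mul, ← Matrix.star_eq_conjTranspose, ← map_star]
    rfl
  have h1 := trace_conjTranspose_mul_self (tensorFactorHom e A)
  have h2 : (tensorFactorHom e (Aᴴ * A)).trace = (Aᴴ * A).trace * Fintype.card γ := by
    change ((Aᴴ * A) ⊗ₖ (1 : Matrix γ γ ℂ) |>.submatrix e e).trace = _
    rw [← Matrix.trace_one, ← Matrix.trace_kronecker]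
    exact Fintype.sum_equiv e _ _ fun _ => rfl
  rw [h, h2, trace_conjTranspose_mul_self] at h1
  have h3 : frobeniusNorm A ^ 2 * Fintype.card γ = frobeniusNorm (tensorFactorHom e A) ^ 2 := by
    exact_mod_cast h1
  rw [← h3, mul_comm]

variable {k n : ℕ}

/-- The bit strings of length `n` factor through an injection `Fin k → Fin n`. -/
noncomputable def splitQubits (σ : Fin k ↪ Fin n) :
    QubitBasis n ≃ QubitBasis k × ({i // ¬ i ∈ Set.range σ} → Fin 2) :=
  open Classical in
  (Equiv.piEquivPiSubtypeProd (fun i => i ∈ Set.range σ) fun _ => Fin 2).trans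
    (Equiv.prodCongr ((Equiv.ofInjective σ σ.injective).arrowCongr (Equiv.refl _)).symm
      (Equiv.refl _))

theorem splitQubits_fst (σ : Fin k ↪ Fin n) (x : QubitBasis n) :
    (splitQubits σ x).1 = fun i => x (σ i) := rfl

theorem splitQubits_snd (σ : Fin k ↪ Fin n) (x : QubitBasis n) :
    (splitQubits σ x).2 = fun i => x i.1 := rfl

theorem splitQubits_snd_eq_iff (σ : Fin k ↪ Fin n) (x y : QubitBasis n) :
    (splitQubits σ x).2 = (splitQubits σ y).2 ↔ ∀ i, i ∉ Set.range σ → x i = y i := by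
  rw [splitQubits_snd, splitQubits_snd, funext_iff, Subtype.forall]

open Classical in
/-- The embedding of the operators on `k` qubits into those on `n` qubits. -/
noncomputable def liftQubits (σ : Fin k ↪ Fin n) :
    Matrix (QubitBasis k) (QubitBasis k) ℂ →⋆ₐ[ℂ] Matrix (QubitBasis n) (QubitBasis n) ℂ :=
  tensorFactorHom (splitQubits σ)

theorem actOnPair_eq {i j : Fin n} (V : Matrix (Fin 2 × Fin 2) (Fin 2 × Fin 2) ℂ)
    {x y : QubitBasis n} (h : ∀ k, k ≠ i → k ≠ j → x k = y k) :
    actOnPair i j V x y = V (x i, x j) (y i, y j) := by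
  rw [actOnPair_apply, if_pos h]

theorem actOnPair_eq_zero {i j : Fin n} (V : Matrix (Fin 2 × Fin 2) (Fin 2 × Fin 2) ℂ)
    {x y : QubitBasis n} (h : ¬ ∀ k, k ≠ i → k ≠ j → x k = y k) :
    actOnPair i j V x y = 0 := by
  rw [actOnPair_apply, if_neg h]

theorem liftQubits_actOnPair (σ : Fin k ↪ Fin n) (i j : Fin k)
    (V : Matrix (Fin 2 × Fin 2) (Fin 2 × Fin 2) ℂ) :
    liftQubits σ (actOnPair i j V) = actOnPair (σ i) (σ j) V := by
  classical
  ext x y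
  rw [liftQubits, tensorFactorHom_apply]
  by_cases h : ∀ l, l ≠ σ i → l ≠ σ j → x l = y l
  · rw [if_pos ((splitQubits_snd_eq_iff σ x y).2 fun l hl =>
      h l (fun h => hl (h ▸ Set.mem_range_self i)) (fun h => hl (h ▸ Set.mem_range_self j))),
      actOnPair_eq V h, actOnPair_eq]
    · rfl
    · intro l hi hj
      exact h (σ l) (fun h => hi (σ.injective h)) (fun h => hj (σ.injective h))
  · rw [actOnPair_eq_zero V h]
    by_cases h1 : ∀ l, l ∉ Set.range σ → x l = y l
    · rw [if_pos ((splitQubits_snd_eq_iff σ x y).2 h1), actOnPair_eq_zero]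
      refine fun h2 => h fun l hi hj => ?_
      by_cases hl : l ∈ Set.range σ
      · obtain ⟨m, rfl⟩ := hl
        exact h2 m (fun h => hi (h ▸ rfl)) (fun h => hj (h ▸ rfl))
      · exact h1 l hl
    · rw [if_neg (mt (splitQubits_snd_eq_iff σ x y).1 h1)]

theorem IsCircuit.liftQubits (σ : Fin k ↪ Fin n) {m : ℕ}
    {M : Matrix (QubitBasis k) (QubitBasis k) ℂ} (hM : IsCircuit m M) :
    IsCircuit m (liftQubits σ M) := by
  classical
  obtain ⟨_, ⟨l, hl, hg, rfl⟩, rfl⟩ := hM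
  induction l generalizing m with
  | nil =>
    subst hl
    have : ((([] : List (QubitUnitary k)).prod : QubitUnitary k) :
        Matrix (QubitBasis k) (QubitBasis k) ℂ) = 1 := rfl
    rw [this, map_one]
    exact IsCircuit.one
  | cons g l ih =>
    subst hl
    have h := ih rfl fun g' hg' => hg g' (List.mem_cons_of_mem _ hg')
    rw [List.prod_cons, Submonoid.coe_mul, map_mul, List.length_cons, add_comm]
    refine IsCircuit.mul ?_ h
    obtain ⟨i, j, hij, V, hV, hgV⟩ := hg g List.mem_cons_self
    have hU : _root_.liftQubits σ g ∈ Matrix.unitaryGroup (QubitBasis n) ℂ :=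
      tensorFactorHom_mem_unitaryGroup _ g.2
    refine ⟨⟨_, hU⟩, ⟨[⟨_, hU⟩], rfl, fun g' hg' => ?_, by simp⟩, rfl⟩
    rw [List.mem_singleton.1 hg']
    exact ⟨σ i, σ j, fun h => hij (σ.injective h), V, hV, by
      rw [← liftQubits_actOnPair, ← hgV]⟩

/-- Idle qubits multiply the squared Frobenius norm by their dimension, which the normalization
removes. A packing on `k` qubits is thus a packing on `n` qubits at the same scale. -/
theorem frobeniusNorm_liftQubits_div (σ : Fin k ↪ Fin n)
    (M : Matrix (QubitBasis k) (QubitBasis k) ℂ) :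
    frobeniusNorm (liftQubits σ M) / √(2 ^ n) = frobeniusNorm M / √(2 ^ k) := by
  classical
  have hcard := Fintype.card_congr (splitQubits σ)
  rw [Fintype.card_prod] at hcard
  have h := frobeniusNorm_tensorFactorHom_sq (splitQubits σ) M
  have h2 : (2 : ℝ) ^ n = 2 ^ k * Fintype.card ({i // ¬ i ∈ Set.range σ} → Fin 2) := by
    simp only [Fintype.card_fun, Fintype.card_fin] at hcard ⊢
    exact_mod_cast hcard
  have hpos : (0 : ℝ) < Fintype.card ({i // ¬ i ∈ Set.range σ} → Fin 2) := by
    exact_mod_cast Fintype.card_pos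
  rw [← Real.sqrt_sq (frobeniusNorm_nonneg (liftQubits σ M)),
    ← Real.sqrt_sq (frobeniusNorm_nonneg M), ← Real.sqrt_div (sq_nonneg _),
    ← Real.sqrt_div (sq_nonneg _)]
  congr 1
  rw [liftQubits, h, h2]
  field_simp

/-- The injection `Fin 2 → Fin n` with values `i`, `j`. -/
def pairEmbedding {i j : Fin n} (hij : i ≠ j) : Fin 2 ↪ Fin n where
  toFun := ![i, j]
  inj' a b h := by
    fin_cases a <;> fin_cases b <;> simp_all [eq_comm]

theorem exists_tensorFactorHom_eq_actOnPair {i j : Fin n} (hij : i ≠ j) :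
    ∃ (s : Finset (Fin n)) (e : QubitBasis n ≃ (Fin 2 × Fin 2) × ({l // l ∉ s} → Fin 2)),
      ∀ V, actOnPair i j V = tensorFactorHom e V := by
  classical
  have hr : ∀ l, ¬ l ∈ Set.range (pairEmbedding hij) ↔ l ∉ ({i, j} : Finset (Fin n)) := by
    intro l
    change (¬ ∃ a, ![i, j] a = l) ↔ _
    simp [eq_comm]
  let e0 : ({l // ¬ l ∈ Set.range (pairEmbedding hij)} → Fin 2) ≃
      ({l // l ∉ ({i, j} : Finset (Fin n))} → Fin 2) :=
    (Equiv.subtypeEquivRight hr).arrowCongr (Equiv.refl _)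
  refine ⟨{i, j}, (splitQubits (pairEmbedding hij)).trans
    (Equiv.prodCongr (finTwoArrowEquiv (Fin 2)) e0), fun V => ?_⟩
  ext x y
  rw [tensorFactorHom_apply, actOnPair_apply]
  simp only [Equiv.trans_apply, Equiv.prodCongr_apply, Prod.map_snd, Prod.map_fst,
    EmbeddingLike.apply_eq_iff_eq, splitQubits_snd_eq_iff, splitQubits_fst]
  refine if_congr ?_ rfl rfl
  refine forall_congr' fun l => ?_
  rw [hr]
  simp

theorem actOnPair_mem_unitaryGroup {i j : Fin n} (hij : i ≠ j)
    {V : Matrix (Fin 2 × Fin 2) (Fin 2 × Fin 2) ℂ}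
    (hV : V ∈ Matrix.unitaryGroup (Fin 2 × Fin 2) ℂ) :
    actOnPair i j V ∈ Matrix.unitaryGroup (QubitBasis n) ℂ := by
  obtain ⟨s, e, he⟩ := exists_tensorFactorHom_eq_actOnPair hij
  rw [he]
  exact tensorFactorHom_mem_unitaryGroup e hV

theorem norm_actOnPair_sub_le {i j : Fin n} (hij : i ≠ j)
    (V W : Matrix (Fin 2 × Fin 2) (Fin 2 × Fin 2) ℂ) :
    ‖actOnPair i j V - actOnPair i j W‖ ≤ ‖V - W‖ := by
  obtain ⟨s, e, he⟩ := exists_tensorFactorHom_eq_actOnPair hij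
  rw [he, he, ← map_sub]
  exact norm_tensorFactorHom_le e _

end TensorFactor

/-! ### Counting integer points -/

section Counting

open Finset Real

/-- Comparison with `1 / j ^ 2` gives summability. One `B` serves all centres because an integer
shift permutes the terms; the added 1 secures `1 ≤ B`. -/
theorem exists_sum_exp_neg_sq_le :
    ∃ B : ℝ, 1 ≤ B ∧ ∀ (s : Finset ℤ) (k : ℤ), ∑ j ∈ s, exp (-((j : ℝ) - k) ^ 2) ≤ B := by
  have hs : Summable fun j : ℤ => exp (-(j : ℝ) ^ 2) := by
    have h1 : Summable fun j : ℤ => 1 / (j : ℝ) ^ 2 + if j = 0 then (1 : ℝ) else 0 :=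
      (Real.summable_one_div_int_pow.2 one_lt_two).add (hasSum_ite_eq 0 1).summable
    refine Summable.of_nonneg_of_le (fun _ => (exp_pos _).le) (fun j => ?_) h1
    by_cases hj : j = 0
    · simp [hj]
    · rw [if_neg hj, add_zero, exp_neg, one_div]
      have : (0 : ℝ) < (j : ℝ) ^ 2 := by positivity
      gcongr
      linarith [add_one_le_exp ((j : ℝ) ^ 2)]
  refine ⟨∑' j : ℤ, exp (-(j : ℝ) ^ 2) + 1, ?_, fun s k => ?_⟩
  · have : 0 ≤ ∑' j : ℤ, exp (-(j : ℝ) ^ 2) := tsum_nonneg fun j => (exp_pos _).le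
    linarith
  · have h2 : Summable fun j : ℤ => exp (-((j : ℝ) - k) ^ 2) := by
      have := (Equiv.subRight k).summable_iff.2 hs
      simpa [Function.comp_def] using this
    have h3 : ∑' j : ℤ, exp (-((j : ℝ) - k) ^ 2) = ∑' j : ℤ, exp (-(j : ℝ) ^ 2) := by
      have := (Equiv.subRight k).tsum_eq fun j : ℤ => exp (-(j : ℝ) ^ 2)
      simpa using this
    have h4 := h2.sum_le_tsum s fun _ _ => (exp_pos _).le
    linarith

variable {P : Type*} [Fintype P] [DecidableEq P]

/-- The number of integer points of a Euclidean ball of radius `√dim`. -/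
theorem card_filter_sum_sq_le {B : ℝ}
    (hB : ∀ (s : Finset ℤ) (k : ℤ), ∑ j ∈ s, exp (-((j : ℝ) - k) ^ 2) ≤ B)
    (I : Finset ℤ) (b : P → ℤ) :
    (#{a ∈ Fintype.piFinset fun _ : P => I |
      ∑ p, ((a p : ℝ) - b p) ^ 2 ≤ Fintype.card P} : ℝ) ≤ (exp 1 * B) ^ Fintype.card P := by
  calc (#{a ∈ Fintype.piFinset fun _ : P => I |
      ∑ p, ((a p : ℝ) - b p) ^ 2 ≤ Fintype.card P} : ℝ)
      = ∑ a ∈ Fintype.piFinset (fun _ : P => I) with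
          ∑ p, ((a p : ℝ) - b p) ^ 2 ≤ Fintype.card P, (1 : ℝ) := by simp
    -- On the ball the Gaussian weight is at least `exp (-dim)`, so each product is at least 1. Over
    -- the whole grid the sum of products factorizes.
    _ ≤ ∑ a ∈ Fintype.piFinset (fun _ : P => I) with
          ∑ p, ((a p : ℝ) - b p) ^ 2 ≤ Fintype.card P,
          ∏ p, (exp 1 * exp (-((a p : ℝ) - b p) ^ 2)) := by
        refine sum_le_sum fun a ha => ?_
        rw [mem_filter] at ha
        simp only [← exp_add, ← exp_sum, sum_add_distrib, sum_neg_distrib]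
        refine one_le_exp ?_
        simpa using ha.2
    _ ≤ ∑ a ∈ Fintype.piFinset (fun _ : P => I),
          ∏ p, (exp 1 * exp (-((a p : ℝ) - b p) ^ 2)) :=
        sum_le_sum_of_subset_of_nonneg (filter_subset _ _) fun _ _ _ => by positivity
    _ = ∏ p : P, ∑ j ∈ I, exp 1 * exp (-((j : ℝ) - b p) ^ 2) :=
        (prod_univ_sum (fun _ : P => I) fun p j => exp 1 * exp (-((j : ℝ) - b p) ^ 2)).symm
    _ ≤ ∏ _p : P, (exp 1 * B) := by
        refine prod_le_prod (fun p _ => sum_nonneg fun _ _ => by positivity) fun p _ => ?_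
        rw [← mul_sum]
        gcongr
        exact hB I (b p)
    _ = _ := by simp

variable (P) in
/-- The integer points of the cube `[-m, m] ^ P`. -/
noncomputable def gridPoints (m : ℕ) : Finset (P → ℤ) := Fintype.piFinset fun _ => Icc (-(m : ℤ)) m

theorem card_gridPoints (m : ℕ) : (#(gridPoints P m) : ℝ) = (2 * m + 1) ^ Fintype.card P := by
  rw [gridPoints, Fintype.card_piFinset, prod_const, card_univ, Int.card_Icc]
  have : ((m : ℤ) + 1 - -m).toNat = 2 * m + 1 := by omega
  rw [this]
  push_cast
  ring

/-- Hoeffding's lemma for the uniform distribution on the grid: by symmetry the exponential becomes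
`cosh`, and `cosh x ≤ exp (x ^ 2 / 2)`. It includes `m = 0`, where `j / m` is 0. -/
theorem sum_exp_mul_le (m : ℕ) (c : ℝ) :
    ∑ j ∈ Icc (-(m : ℤ)) m, exp (c * (j / m)) ≤ (2 * m + 1) * exp (c ^ 2 / 2) := by
  have hsymm : ∑ j ∈ Icc (-(m : ℤ)) m, exp (c * (j / m)) =
      ∑ j ∈ Icc (-(m : ℤ)) m, exp (-(c * (j / m))) := by
    refine sum_bij (fun j _ => -j) (fun j hj => ?_) (fun _ _ _ _ h => neg_injective h)
      (fun j hj => ⟨-j, ?_, by simp⟩) fun j _ => ?_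
    · rw [mem_Icc] at hj ⊢; omega
    · rw [mem_Icc] at hj ⊢; omega
    · push_cast; ring_nf
  have h : ∑ j ∈ Icc (-(m : ℤ)) m, exp (c * (j / m)) =
      ∑ j ∈ Icc (-(m : ℤ)) m, cosh (c * (j / m)) := by
    simp only [cosh_eq]
    rw [← sum_div, sum_add_distrib, ← hsymm]
    ring
  rw [h]
  have hb : ∀ j ∈ Icc (-(m : ℤ)) m, cosh (c * (j / m)) ≤ exp (c ^ 2 / 2) := fun j hj => by
    refine (cosh_le_exp_half_sq _).trans (exp_le_exp.2 ?_)
    rw [mem_Icc] at hj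
    have h1 : ((j : ℝ) / m) ^ 2 ≤ 1 := by
      rw [div_pow]
      refine div_le_one_of_le₀ ?_ (by positivity)
      have h2 : -(m : ℝ) ≤ j := by exact_mod_cast hj.1
      have h3 : (j : ℝ) ≤ m := by exact_mod_cast hj.2
      nlinarith
    rw [mul_pow]
    nlinarith [sq_nonneg c]
  refine (sum_le_card_nsmul _ _ _ hb).trans_eq ?_
  rw [Int.card_Icc, nsmul_eq_mul]
  congr 1
  have : ((m : ℤ) + 1 - -m).toNat = 2 * m + 1 := by omega
  rw [this]
  push_cast
  ring

/-- A Chernoff bound for linear forms on the cube. -/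
theorem card_filter_lt_sum_le (m : ℕ) (c : P → ℝ) (hc : ∑ p, c p ^ 2 ≤ 2) (t : ℝ) (ht : 0 ≤ t) :
    (#{a ∈ gridPoints P m | t < ∑ p, c p * ((a p : ℝ) / m)} : ℝ) ≤
      (2 * m + 1) ^ Fintype.card P * exp (-(t ^ 2 / 4)) := by
  calc (#{a ∈ gridPoints P m | t < ∑ p, c p * ((a p : ℝ) / m)} : ℝ)
      = ∑ a ∈ gridPoints P m with
          t < ∑ p, c p * ((a p : ℝ) / m), (1 : ℝ) := by simp
    -- Markov's inequality for the exponential moment with parameter `t / 2`. The product of the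
    -- one-dimensional moments adds `t ^ 2 / 8 * ∑ c p ^ 2 ≤ t ^ 2 / 4` to the exponent `-t ^ 2 /
    -- 2`.
    _ ≤ ∑ a ∈ gridPoints P m with
          t < ∑ p, c p * ((a p : ℝ) / m),
          exp (-(t ^ 2 / 2)) * ∏ p, exp ((t / 2 * c p) * (a p / m)) := by
        refine sum_le_sum fun a ha => ?_
        rw [mem_filter] at ha
        rw [← exp_sum, ← exp_add]
        refine one_le_exp ?_
        simp only [mul_assoc]
        rw [← mul_sum]
        nlinarith [ha.2]
    _ ≤ ∑ a ∈ gridPoints P m,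
          exp (-(t ^ 2 / 2)) * ∏ p, exp ((t / 2 * c p) * (a p / m)) :=
        sum_le_sum_of_subset_of_nonneg (filter_subset _ _) fun _ _ _ => by positivity
    _ = exp (-(t ^ 2 / 2)) *
          ∏ p : P, ∑ j ∈ Icc (-(m : ℤ)) m, exp ((t / 2 * c p) * (j / m)) := by
        rw [← mul_sum]
        congr 1
        exact (prod_univ_sum (fun _ : P => Icc (-(m : ℤ)) m)
          fun p j => exp ((t / 2 * c p) * (j / m))).symm
    _ ≤ exp (-(t ^ 2 / 2)) * ∏ p : P, ((2 * m + 1) * exp ((t / 2 * c p) ^ 2 / 2)) := by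
        gcongr with p
        exact sum_exp_mul_le m _
    _ = (2 * m + 1) ^ Fintype.card P *
          exp (-(t ^ 2 / 2) + t ^ 2 / 8 * ∑ p, c p ^ 2) := by
        rw [prod_mul_distrib, ← exp_sum, exp_add, prod_const, card_univ, mul_sum]
        have : ∀ p, (t / 2 * c p) ^ 2 / 2 = t ^ 2 / 8 * c p ^ 2 := fun p => by ring
        simp only [this]
        ring
    _ ≤ _ := by
        gcongr
        nlinarith [sq_nonneg t]

end Counting

/-! ### Hermitian matrices of small operator norm are abundant -/

section OperatorNorm

open scoped Matrix.Norms.L2Operator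
open Finset

/-- The operator norm can be estimated on a `1/2`-net of the unit ball. -/
theorem opNorm_le_of_net {E : Type*} [NormedAddCommGroup E] [InnerProductSpace ℂ E]
    (L : E →L[ℂ] E) (T : Finset E) (hT : ∀ x : E, ‖x‖ ≤ 1 → ∃ y ∈ T, ‖x - y‖ ≤ 1 / 2)
    {t : ℝ} (ht : 0 ≤ t) (h : ∀ x ∈ T, ∀ y ∈ T, (inner ℂ y (L x)).re ≤ t) : ‖L‖ ≤ 4 * t := by
  -- The normalized vector `L x` attains `‖L x‖` as an inner product, and moving it to the net loses
  -- at most half. The same halving in the other argument gives `‖L‖ ≤ 2 t + ‖L‖ / 2`.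
  have h1 : ∀ x ∈ T, ‖L x‖ ≤ 2 * t := fun x hx => by
    by_cases hw : ‖L x‖ = 0
    · rw [hw]; positivity
    have hpos : 0 < ‖L x‖ := lt_of_le_of_ne (norm_nonneg _) (Ne.symm hw)
    set y : E := ((‖L x‖⁻¹ : ℝ) : ℂ) • L x with hy
    have hy1 : ‖y‖ ≤ 1 := by
      rw [hy, norm_smul, Complex.norm_real, norm_inv, norm_norm, inv_mul_cancel₀ hw]
    have hyL : (inner ℂ y (L x)).re = ‖L x‖ := by
      rw [hy, inner_smul_left, inner_self_eq_norm_sq_to_K]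
      simp only [Complex.conj_ofReal]
      change (((‖L x‖⁻¹ : ℝ) : ℂ) * ((‖L x‖ : ℝ) : ℂ) ^ 2).re = _
      rw [← Complex.ofReal_pow, ← Complex.ofReal_mul, Complex.ofReal_re]
      field_simp
    obtain ⟨z, hz, hyz⟩ := hT y hy1
    have h2 : (inner ℂ (y - z) (L x)).re ≤ 1 / 2 * ‖L x‖ :=
      (Complex.re_le_norm _).trans ((norm_inner_le_norm _ _).trans (by gcongr))
    rw [inner_sub_left, Complex.sub_re, hyL] at h2
    linarith [h x hx z hz]
  have h2 : ‖L‖ ≤ 2 * t + ‖L‖ * (1 / 2) := by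
    let _ : NormedSpace ℝ E := NormedSpace.restrictScalars ℝ ℂ E
    refine ContinuousLinearMap.opNorm_le_of_unit_norm (by positivity) fun x hx => ?_
    obtain ⟨z, hz, hxz⟩ := hT x hx.le
    calc ‖L x‖ = ‖L z + L (x - z)‖ := by rw [← map_add]; congr 2; abel
      _ ≤ ‖L z‖ + ‖L (x - z)‖ := norm_add_le _ _
      _ ≤ 2 * t + ‖L‖ * (1 / 2) := by
        gcongr
        · exact h1 z hz
        · exact (L.le_opNorm _).trans (by gcongr)
  linarith

variable {ι : Type*} [Fintype ι] [DecidableEq ι]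

/-- Matrix elements are real-linear in the coordinates `A`. The bound 2 on the squared coefficients
is the one required by `card_filter_lt_sum_le`. -/
theorem exists_re_inner_hermitianOfReal_eq (x y : EuclideanSpace ℂ ι) (hx : ‖x‖ ≤ 1)
    (hy : ‖y‖ ≤ 1) : ∃ c : ι × ι → ℝ, ∑ p, c p ^ 2 ≤ 2 ∧ ∀ A : Matrix ι ι ℝ,
      (inner ℂ y (Matrix.toEuclideanCLM (n := ι) (𝕜 := ℂ) (hermitianOfReal A) x)).re =
        ∑ p : ι × ι, c p * A p.1 p.2 := by
  set u : ι → ι → ℂ := fun i j => (starRingEnd ℂ) (y i) * x j with hu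
  refine ⟨fun p => ((u p.1 p.2).re - (u p.1 p.2).im + (u p.2 p.1).re + (u p.2 p.1).im) / 2,
    ?_, fun A => ?_⟩
  · have hsum : ∑ i, ∑ j, ‖u i j‖ ^ 2 ≤ 1 := by
      have : ∑ i, ∑ j, ‖u i j‖ ^ 2 = ‖y‖ ^ 2 * ‖x‖ ^ 2 := by
        rw [EuclideanSpace.norm_sq_eq, EuclideanSpace.norm_sq_eq, sum_mul_sum]
        simp only [hu, norm_mul, RCLike.norm_conj, mul_pow]
      rw [this]
      exact mul_le_one₀ (pow_le_one₀ (norm_nonneg _) hy) (sq_nonneg _)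
        (pow_le_one₀ (norm_nonneg _) hx)
    have hle : ∀ i j, (((u i j).re - (u i j).im + (u j i).re + (u j i).im) / 2) ^ 2 ≤
        ‖u i j‖ ^ 2 + ‖u j i‖ ^ 2 := fun i j => by
      rw [← Complex.normSq_eq_norm_sq, ← Complex.normSq_eq_norm_sq, Complex.normSq_apply,
        Complex.normSq_apply]
      nlinarith [sq_nonneg ((u i j).re + (u i j).im), sq_nonneg ((u i j).re - (u j i).re),
        sq_nonneg ((u i j).re - (u j i).im), sq_nonneg ((u i j).im + (u j i).re),
        sq_nonneg ((u i j).im + (u j i).im), sq_nonneg ((u j i).re - (u j i).im)]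
    rw [Fintype.sum_prod_type]
    calc _ ≤ ∑ i, ∑ j, (‖u i j‖ ^ 2 + ‖u j i‖ ^ 2) :=
          sum_le_sum fun i _ => sum_le_sum fun j _ => hle i j
      _ = 2 * ∑ i, ∑ j, ‖u i j‖ ^ 2 := by
          simp only [sum_add_distrib]
          rw [sum_comm (f := fun i j => ‖u j i‖ ^ 2)]
          ring
      _ ≤ 2 := by linarith
  · have h1 : inner ℂ y (Matrix.toEuclideanCLM (n := ι) (𝕜 := ℂ) (hermitianOfReal A) x) =
        ∑ i, ∑ j, hermitianOfReal A i j * u i j := by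
      rw [PiLp.inner_apply]
      refine sum_congr rfl fun i _ => ?_
      rw [Matrix.ofLp_toEuclideanCLM, Matrix.mulVec, dotProduct, RCLike.inner_apply, sum_mul]
      refine sum_congr rfl fun j _ => ?_
      simp only [hu]
      ring
    rw [h1, Fintype.sum_prod_type, Complex.re_sum]
    simp only [Complex.re_sum]
    have h2 : ∀ i j, (hermitianOfReal A i j * u i j).re =
        A i j * (((u i j).re - (u i j).im) / 2) + A j i * (((u i j).re + (u i j).im) / 2) := by
      intro i j
      rw [hermitianOfReal_apply]
      simp only [Complex.mul_re, Complex.add_re, Complex.add_im, Complex.ofReal_re,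
        Complex.ofReal_im, Complex.mul_im, Complex.I_re, Complex.I_im]
      ring
    simp only [h2, sum_add_distrib]
    rw [sum_comm (f := fun i j => A j i * (((u i j).re + (u i j).im) / 2)), ← sum_add_distrib]
    refine sum_congr rfl fun i _ => ?_
    rw [← sum_add_distrib]
    refine sum_congr rfl fun j _ => ?_
    ring

/-- The matrix with entries `a i j / (m √d)`, in dimension `d`. -/
noncomputable def gridMatrix (m : ℕ) (a : ι × ι → ℤ) : Matrix ι ι ℝ :=
  Matrix.of fun i j => (a (i, j) : ℝ) / (m * √(Fintype.card ι))

open Classical in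
/-- At least half of the grid matrices give Hermitian matrices of operator norm at most `24`. -/
theorem half_le_card_filter_norm_le [Nonempty ι] (m : ℕ) :
    (2 * m + 1 : ℝ) ^ Fintype.card (ι × ι) ≤
      2 * #{a ∈ gridPoints (ι × ι) m |
        ‖hermitianOfReal (gridMatrix m a)‖ ≤ 24} := by
  set d : ℕ := Fintype.card ι with hd
  have hd1 : (1 : ℝ) ≤ d := by exact_mod_cast Fintype.card_pos
  have hds : 0 < √(d : ℝ) := Real.sqrt_pos.2 (by linarith)
  obtain ⟨T, hT1, hT, hTc⟩ := exists_finset_net (E := EuclideanSpace ℂ ι) zero_le_one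
    (one_half_pos (α := ℝ)) (Metric.closedBall 0 1) (fun x hx => by simpa using hx)
  have hrank : Module.finrank ℝ (EuclideanSpace ℂ ι) = 2 * d := by
    rw [finrank_real_of_complex, finrank_euclideanSpace]
  rw [hrank] at hTc
  norm_num at hTc
  choose! c hc hcA using fun (x : EuclideanSpace ℂ ι) (y : EuclideanSpace ℂ ι) (hx : ‖x‖ ≤ 1)
    (hy : ‖y‖ ≤ 1) => exists_re_inner_hermitianOfReal_eq x y hx hy
  have hTn : ∀ x ∈ T, ‖x‖ ≤ 1 := fun x hx => by simpa using hT1 hx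
  set F := gridPoints (ι × ι) m with hF
  have hFc : (#F : ℝ) = (2 * m + 1) ^ Fintype.card (ι × ι) :=
    card_gridPoints m
  -- Then `t ^ 2 / 4 = 8 d`. The union bound runs over at most `5 ^ (4 d) = 625 ^ d` pairs of net
  -- points, and `exp 8 ≥ 1250` leaves `2 ^ (-d) ≤ 1 / 2`.
  set t : ℝ := √(32 * d) with ht
  have ht0 : 0 ≤ t := Real.sqrt_nonneg _
  have ht2 : t ^ 2 = 32 * d := Real.sq_sqrt (by positivity)
  -- If all linear forms are at most `t`, the matrix elements on the net are at most `t / √d = √32`,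
  -- so the norm is at most `4 √32 ≤ 24`.
  have hbad : {a ∈ F | ¬ ‖hermitianOfReal (gridMatrix m a)‖ ≤ 24} ⊆
      (T ×ˢ T).biUnion fun q => {a ∈ F | t < ∑ p, c q.1 q.2 p * ((a p : ℝ) / m)} := by
    intro a ha
    rw [mem_filter] at ha
    by_contra hcon
    simp only [mem_biUnion, mem_product, mem_filter, not_exists, not_and, not_lt] at hcon
    apply ha.2
    rw [Matrix.cstar_norm_def]
    have hts : t = √32 * √d := Real.sqrt_mul (by norm_num) _
    refine (opNorm_le_of_net _ T (fun x hx => hT x (by simpa using hx))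
      (Real.sqrt_nonneg 32) fun x hx y hy => ?_).trans ?_
    · have h1 := hcon (x, y) ⟨hx, hy⟩ ha.1
      simp only at h1
      rw [hcA x y (hTn x hx) (hTn y hy)]
      have h2 : ∑ p : ι × ι, c x y p * gridMatrix m a p.1 p.2 =
          (∑ p, c x y p * (a p / m)) / √d := by
        rw [sum_div]
        refine sum_congr rfl fun p _ => ?_
        simp only [gridMatrix, Matrix.of_apply, ← hd]
        rw [mul_div_assoc, div_div]
      rw [h2, div_le_iff₀ hds, ← hts]
      exact h1
    · have : √32 ≤ (6 : ℝ) := Real.sqrt_le_iff.2 ⟨by norm_num, by norm_num⟩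
      linarith
  have hbadc : (#{a ∈ F | ¬ ‖hermitianOfReal (gridMatrix m a)‖ ≤ 24} : ℝ) ≤ #F / 2 := by
    have h1 : (#{a ∈ F | ¬ ‖hermitianOfReal (gridMatrix m a)‖ ≤ 24} : ℝ) ≤
        ∑ q ∈ T ×ˢ T, (#{a ∈ F | t < ∑ p, c q.1 q.2 p * ((a p : ℝ) / m)} : ℝ) := by
      exact_mod_cast (card_le_card hbad).trans card_biUnion_le
    have h2 : ∀ q ∈ T ×ˢ T, (#{a ∈ F | t < ∑ p, c q.1 q.2 p * ((a p : ℝ) / m)} : ℝ) ≤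
        #F * Real.exp (-(8 * d)) := fun q hq => by
      rw [mem_product] at hq
      have := card_filter_lt_sum_le m (c q.1 q.2) (hc _ _ (hTn _ hq.1) (hTn _ hq.2)) t ht0
      rw [ht2, ← hFc] at this
      convert this using 3
      ring
    have h3 := h1.trans (sum_le_card_nsmul _ _ _ h2)
    rw [card_product, nsmul_eq_mul] at h3
    push_cast at h3
    have he : (1250 : ℝ) ≤ Real.exp 8 := by
      have h := Real.exp_one_gt_d9
      have h8 : Real.exp 8 = Real.exp 1 ^ 8 := by rw [← Real.exp_nat_mul]; norm_num
      rw [h8]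
      calc (1250 : ℝ) ≤ 2.7 ^ 8 := by norm_num
        _ ≤ _ := by gcongr; linarith
    have h4 : (#T : ℝ) * #T ≤ 625 ^ d := by
      calc (#T : ℝ) * #T ≤ 5 ^ (2 * d) * 5 ^ (2 * d) := by gcongr
        _ = 625 ^ d := by rw [← pow_add, ← two_mul, ← mul_assoc, pow_mul]; norm_num
    have h5 : (625 : ℝ) ^ d * Real.exp (-(8 * d)) ≤ 1 / 2 := by
      have h6 : Real.exp (-(8 * d)) = ((Real.exp 8) ^ d)⁻¹ := by
        rw [Real.exp_neg, ← Real.exp_nat_mul]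
        congr 2
        ring
      have h7 : (2 : ℝ) * 625 ^ d ≤ Real.exp 8 ^ d := by
        calc (2 : ℝ) * 625 ^ d ≤ 2 ^ d * 625 ^ d := by
              gcongr
              exact le_self_pow₀ one_le_two (Fintype.card_pos.ne')
          _ = 1250 ^ d := by rw [← mul_pow]; norm_num
          _ ≤ _ := by gcongr
      rw [h6, ← div_eq_mul_inv, div_le_iff₀ (by positivity)]
      linarith
    calc _ ≤ _ := h3
      _ ≤ 625 ^ d * (#F * Real.exp (-(8 * d))) := by gcongr
      _ = #F * (625 ^ d * Real.exp (-(8 * d))) := by ring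
      _ ≤ #F * (1 / 2) := by gcongr
      _ = _ := by ring
  have htot := card_filter_add_card_filter_not (s := F)
    fun a => ‖hermitianOfReal (gridMatrix m a)‖ ≤ 24
  have htot' : (#{a ∈ F | ‖hermitianOfReal (gridMatrix m a)‖ ≤ 24} : ℝ) +
      #{a ∈ F | ¬ ‖hermitianOfReal (gridMatrix m a)‖ ≤ 24} = #F := by exact_mod_cast htot
  rw [← hFc]
  linarith

end OperatorNorm

/-! ### The lower bound for the Frobenius distance -/

section FrobeniusLowerBound

open scoped Matrix.Norms.L2Operator
open Finset

/-- The Cayley transforms of the Hermitian matrices of size `d` cannot be covered by fewer than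
`(c / ε) ^ (d ^ 2)` sets of normalized Frobenius diameter `2 ε`. -/
theorem exists_pow_le_card_of_frobeniusNorm_cayley_le :
    ∃ c : ℝ, 0 < c ∧ ∀ (ι : Type) [Fintype ι] [DecidableEq ι] [Nonempty ι] (X : Type)
      (N : Finset X) (f : Matrix ι ι ℂ → X) (ε : ℝ), 0 < ε →
      (∀ H : Matrix ι ι ℂ, H.IsHermitian → f H ∈ N) →
      (∀ H H' : Matrix ι ι ℂ, H.IsHermitian → H'.IsHermitian → f H = f H' →
        frobeniusNorm (cayley H - cayley H') ≤ 2 * ε * √(Fintype.card ι)) →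
      (c / ε) ^ Fintype.card (ι × ι) ≤ N.card := by
  obtain ⟨B, hB1, hB⟩ := exists_sum_exp_neg_sq_le
  have he1 : 1 ≤ Real.exp 1 := Real.one_le_exp zero_le_one
  have heB : 1 ≤ Real.exp 1 * B := by nlinarith
  refine ⟨1 / (1250 * (Real.exp 1 * B)), by positivity, ?_⟩
  intro ι _ _ _ X N f ε hε hfN hf
  classical
  let P := ι × ι
  have hPpos : 0 < Fintype.card P := Fintype.card_pos
  set d : ℕ := Fintype.card ι with hd
  have hPd : (Fintype.card P : ℝ) = (d : ℝ) ^ 2 := by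
    rw [Fintype.card_prod]
    push_cast
    ring
  have hd1 : (1 : ℝ) ≤ d := by exact_mod_cast Fintype.card_pos
  have hds : 0 < √(d : ℝ) := Real.sqrt_pos.2 (by linarith)
  -- For norms at most 24 the inverse Cayley bound has the factor `25 * 25 / 2`, which turns the
  -- distance `2 ε √d` into `r √d`.
  set r : ℝ := 625 * ε with hr
  have hr0 : 0 < r := by positivity
  -- For large `ε` the base of the claimed power is at most 1, and a nonempty `N` suffices.
  rcases lt_or_ge 1 r with h1r | hr1
  · have hN : (1 : ℝ) ≤ N.card := by
      exact_mod_cast Finset.card_pos.2 ⟨_, hfN 0 (Matrix.isHermitian_zero)⟩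
    refine le_trans (pow_le_one₀ (by positivity) ?_) hN
    rw [div_div, div_le_one (by positivity)]
    nlinarith
  -- In integer coordinates a fibre then lies in a ball of radius `m r d ≤ d`, the square root of
  -- the dimension `d ^ 2`, while the grid still has at least `1 / r` values per coordinate.
  set m : ℕ := ⌊1 / r⌋₊ with hm
  have hmr : m * r ≤ 1 := by
    have := Nat.floor_le (one_div_pos.2 hr0).le
    rwa [← hm, le_div_iff₀ hr0] at this
  have hm1 : 1 ≤ m := Nat.le_floor (by rw [Nat.cast_one, le_div_iff₀ hr0]; linarith)
  have hm1' : (1 : ℝ) ≤ m := by exact_mod_cast hm1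
  have h2m : 1 / r ≤ 2 * m + 1 := by
    have := Nat.lt_floor_add_one (1 / r)
    rw [← hm] at this
    linarith
  set F := {a ∈ gridPoints P m | ‖hermitianOfReal (gridMatrix m a)‖ ≤ 24} with hF
  have hhalf : (2 * m + 1 : ℝ) ^ Fintype.card P ≤ 2 * #F := half_le_card_filter_norm_le m
  set g : (P → ℤ) → X := fun a => f (hermitianOfReal (gridMatrix m a)) with hg
  have hgN : ∀ a ∈ F, g a ∈ N := fun a _ => hfN _ (isHermitian_hermitianOfReal _)
  have hfiber : ∀ x ∈ N, (#{a ∈ F | g a = x} : ℝ) ≤ (Real.exp 1 * B) ^ Fintype.card P := by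
    intro x _
    rcases ({a ∈ F | g a = x}).eq_empty_or_nonempty with h0 | ⟨b, hb⟩
    · rw [h0, card_empty, Nat.cast_zero]
      positivity
    refine le_trans ?_ (card_filter_sum_sq_le hB (Icc (-(m : ℤ)) m) b)
    refine Nat.cast_le.2 (card_le_card fun a ha => ?_)
    rw [mem_filter, hF, mem_filter] at ha hb
    rw [mem_filter]
    refine ⟨ha.1.1, ?_⟩
    have h1 := hf _ _ (isHermitian_hermitianOfReal (gridMatrix m a))
      (isHermitian_hermitianOfReal (gridMatrix m b)) (ha.2.trans hb.2.symm)
    have h2 := frobeniusNorm_sub_le_of_cayley (isHermitian_hermitianOfReal (gridMatrix m a))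
      (isHermitian_hermitianOfReal (gridMatrix m b))
    have h3 : frobeniusNorm (hermitianOfReal (gridMatrix m a) - hermitianOfReal (gridMatrix m b))
        ≤ r * √d := by
      refine h2.trans ?_
      calc _ ≤ (1 + 24) * (1 + 24) / 2 * (2 * ε * √d) := by
            gcongr
            · exact frobeniusNorm_nonneg _
            · exact ha.1.2
            · exact hb.1.2
        _ = r * √d := by rw [hr]; ring
    rw [← map_sub] at h3
    have h4 := pow_le_pow_left₀ (frobeniusNorm_nonneg _) h3 2
    rw [frobeniusNorm_hermitianOfReal_sq, mul_pow, Real.sq_sqrt (by positivity)] at h4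
    have h5 : ∑ i, ∑ j, (gridMatrix m a - gridMatrix m b) i j ^ 2 =
        (∑ p, ((a p : ℝ) - b p) ^ 2) / (m ^ 2 * d) := by
      rw [Fintype.sum_prod_type, sum_div]
      refine sum_congr rfl fun i _ => ?_
      rw [sum_div]
      refine sum_congr rfl fun j _ => ?_
      simp only [gridMatrix, Matrix.sub_apply, Matrix.of_apply, ← hd]
      rw [← sub_div, div_pow, mul_pow, Real.sq_sqrt (by positivity)]
    rw [h5, div_le_iff₀ (by positivity)] at h4
    rw [hPd]
    calc _ ≤ _ := h4
      _ = (m * r) ^ 2 * d ^ 2 := by ring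
      _ ≤ 1 ^ 2 * d ^ 2 := by gcongr
      _ = _ := by ring
  have hcount : (#F : ℝ) ≤ N.card * (Real.exp 1 * B) ^ Fintype.card P := by
    rw [card_eq_sum_card_fiberwise hgN]
    push_cast
    refine (sum_le_card_nsmul _ _ _ hfiber).trans_eq ?_
    rw [nsmul_eq_mul]
  have h2 : (2 : ℝ) ≤ 2 ^ Fintype.card P := le_self_pow₀ one_le_two hPpos.ne'
  -- The factor 2 lost by keeping only half of the grid is absorbed into `2 ^ (d ^ 2)`; hence 1250 =
  -- 2 · 625 in the constant.
  have hfinal : (1 / r) ^ Fintype.card P ≤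
      N.card * (2 * (Real.exp 1 * B)) ^ Fintype.card P := by
    calc (1 / r) ^ Fintype.card P ≤ (2 * m + 1) ^ Fintype.card P := by gcongr
      _ ≤ 2 * #F := hhalf
      _ ≤ 2 ^ Fintype.card P * (N.card * (Real.exp 1 * B) ^ Fintype.card P) := by gcongr
      _ = _ := by rw [mul_pow]; ring
  have : 1 / (1250 * (Real.exp 1 * B)) / ε = (1 / r) / (2 * (Real.exp 1 * B)) := by
    rw [hr, div_div, div_div]
    ring_nf
  rw [this, div_pow, div_le_iff₀ (by positivity)]
  exact hfinal

/-- Lower bound for the number of points of an (external) net of the `G`-gate unitaries with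
respect to the normalized Frobenius distance. -/
theorem exists_pow_le_card_of_frobeniusDist_le :
    ∃ c : ℝ, 0 < c ∧ ∀ (n k G : ℕ) (ε : ℝ) (N : Finset (QubitUnitary n)), 2 ≤ k → k ≤ n →
      15 * 4 ^ k ≤ G → 0 < ε → (∀ U ∈ gateUnitaries n G, ∃ V ∈ N, frobeniusDist U V ≤ ε) →
      (c / ε) ^ 4 ^ k ≤ (N.card : ℝ) := by
  obtain ⟨c, hc, h⟩ := exists_pow_le_card_of_frobeniusNorm_cayley_le
  refine ⟨c, hc, fun n k G ε N hk hkn hG hε hN => ?_⟩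
  classical
  have hn : 2 ≤ n := hk.trans hkn
  let σ : Fin k ↪ Fin n := Fin.castLEEmb hkn
  have hcirc : ∀ H : Matrix (QubitBasis k) (QubitBasis k) ℂ, H.IsHermitian →
      ∃ V ∈ N, frobeniusNorm (liftQubits σ (cayley H) - V.1) / √(2 ^ n) ≤ ε := by
    intro H hH
    obtain ⟨U, hU, hUH⟩ := ((isCircuit_cayley hk hH).liftQubits σ).mono hn hG
    obtain ⟨V, hV, hUV⟩ := hN U hU
    exact ⟨V, hV, by rw [← hUH]; exact hUV⟩
  -- `f` assigns a net point to every Hermitian matrix; two matrices with the same point are within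
  -- `2 ε`. The net itself need not consist of circuits.
  choose! f hfN hf using hcirc
  have hcard : Fintype.card (QubitBasis k × QubitBasis k) = 4 ^ k := by
    rw [Fintype.card_prod]
    simp [← mul_pow]
  have := h (QubitBasis k) (QubitUnitary n) N f ε hε hfN fun H H' hH hH' hff => ?_
  · rwa [hcard] at this
  · have h1 := hf H hH
    have h2 := hf H' hH'
    rw [← hff] at h2
    have h3 := frobeniusNorm_add_le (liftQubits σ (cayley H) - (f H).1)
      (-(liftQubits σ (cayley H') - (f H).1))
    rw [frobeniusNorm_neg, neg_sub, sub_add_sub_cancel, ← map_sub] at h3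
    have hs : (0 : ℝ) < √(2 ^ n) := by positivity
    have hs' : (0 : ℝ) < √(2 ^ k) := by positivity
    have h4 : frobeniusNorm (liftQubits σ (cayley H - cayley H')) / √(2 ^ n) ≤ 2 * ε := by
      refine (div_le_div_of_nonneg_right h3 hs.le).trans ?_
      rw [add_div]
      linarith
    rw [frobeniusNorm_liftQubits_div, div_le_iff₀ hs'] at h4
    simpa using h4

end FrobeniusLowerBound

/-! ### Nets of two-qubit gates and circuits in operator norm -/

section OperatorNets

open scoped Matrix.Norms.L2Operator

/-- The norm of `F` is pulled back to `E`, so the exponent is the dimension of `E`. For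
`hermitianOfReal` this is `d ^ 2`, half of the real dimension of the complex matrices. -/
theorem exists_finset_net_of_injective {E F : Type*} [AddCommGroup E] [Module ℝ E]
    [FiniteDimensional ℝ E] [NormedAddCommGroup F] [NormedSpace ℝ F] (f : E →ₗ[ℝ] F)
    (hf : Function.Injective f) {R δ : ℝ} (hR : 0 ≤ R) (hδ : 0 < δ) :
    ∃ T : Finset E, (∀ x, ‖f x‖ ≤ R → ∃ y ∈ T, ‖f x - f y‖ ≤ δ) ∧
      (T.card : ℝ) ≤ (1 + 2 * R / δ) ^ Module.finrank ℝ E := by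
  let _ : NormedAddCommGroup E := NormedAddCommGroup.induced E F f hf
  let _ : NormedSpace ℝ E := NormedSpace.induced ℝ E F f
  have hnorm : ∀ x : E, ‖x‖ = ‖f x‖ := fun _ => rfl
  obtain ⟨T, -, hT, hc⟩ := exists_finset_net hR hδ {x : E | ‖x‖ ≤ R} fun x hx => hx
  refine ⟨T, fun x hx => ?_, hc⟩
  obtain ⟨y, hy, hxy⟩ := hT x (by rwa [Set.mem_ofPred_eq, hnorm])
  exact ⟨y, hy, by rwa [← map_sub, ← hnorm]⟩

variable {ι : Type*}

theorem hermitianOfReal_injective : Function.Injective (hermitianOfReal (ι := ι)) := by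
  intro A B h
  ext i j
  have h1 := congrArg (fun M : Matrix ι ι ℂ => (M i j).re + (M i j).im) h
  simp [hermitianOfReal_apply] at h1
  linarith

variable [Fintype ι]

theorem norm_trace_mul_le (A B : Matrix ι ι ℂ) :
    ‖(A * B).trace‖ ≤ frobeniusNorm A * frobeniusNorm B := by
  have h1 : (A * B).trace = ∑ p : ι × ι, A p.1 p.2 * B p.2 p.1 := by
    rw [Fintype.sum_prod_type]
    rfl
  rw [h1, frobeniusNorm_eq_sqrt A, ← frobeniusNorm_conjTranspose B, frobeniusNorm_eq_sqrt Bᴴ,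
    ← Fintype.sum_prod_type', ← Fintype.sum_prod_type']
  refine (norm_sum_le _ _).trans ?_
  simp only [norm_mul, Matrix.conjTranspose_apply, norm_star]
  exact Real.sum_mul_le_sqrt_mul_sqrt _ _ _

variable [DecidableEq ι]

theorem exists_finset_net_unitaryGroup {δ : ℝ} (hδ : 0 < δ) :
    ∃ T : Finset (Matrix ι ι ℂ), ↑T ⊆ (Matrix.unitaryGroup ι ℂ : Set (Matrix ι ι ℂ)) ∧
      (∀ V ∈ Matrix.unitaryGroup ι ℂ, ∃ W ∈ T, ‖V - W‖ ≤ δ) ∧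
      (T.card : ℝ) ≤ (1 + 2 / δ) ^ (2 * (Fintype.card ι * Fintype.card ι)) := by
  obtain ⟨T, hT1, hT, hc⟩ := exists_finset_net (E := Matrix ι ι ℂ) zero_le_one hδ
    (Matrix.unitaryGroup ι ℂ : Set (Matrix ι ι ℂ))
    fun x hx => norm_le_one_of_mem_unitaryGroup hx
  refine ⟨T, hT1, hT, ?_⟩
  have : Module.finrank ℝ (Matrix ι ι ℂ) = 2 * (Fintype.card ι * Fintype.card ι) := by
    rw [finrank_real_of_complex, Module.finrank_matrix, Module.finrank_self, mul_one]
  rwa [this, mul_one] at hc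

theorem norm_mul_eq_of_mem_unitaryGroup {U : Matrix ι ι ℂ} (hU : U ∈ Matrix.unitaryGroup ι ℂ)
    (A : Matrix ι ι ℂ) : ‖U * A‖ = ‖A‖ :=
  CStarRing.norm_mem_unitary_mul A hU

/-- Nets of the unitary group whose cardinality has the exponent given by its dimension. -/
theorem exists_finset_net_unitaryGroup_dim {δ : ℝ} (hδ : 0 < δ) (hδ1 : δ ≤ 1) :
    ∃ T : Finset (Matrix ι ι ℂ), ↑T ⊆ (Matrix.unitaryGroup ι ℂ : Set (Matrix ι ι ℂ)) ∧
      (∀ V ∈ Matrix.unitaryGroup ι ℂ, ∃ W ∈ T, ‖V - W‖ ≤ δ) ∧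
      (T.card : ℝ) ≤ (325 / δ) ^ (Fintype.card ι * Fintype.card ι) := by
  classical
  -- `25 ^ D` centres at scale 1/2, with `D = d ^ 2`. Around each, the chart `U * cayley H` with
  -- `‖H‖ ≤ 3` is 2-Lipschitz, so a net of the `H` at scale `δ / 2`, with at most `(13 / δ) ^ D`
  -- points, suffices. The constant is 25 · 13 = 325.
  obtain ⟨T₀, hT₀U, hT₀, hc₀⟩ := exists_finset_net_unitaryGroup (ι := ι) (one_half_pos (α := ℝ))
  obtain ⟨T₁, hT₁, hc₁⟩ := exists_finset_net_of_injective (hermitianOfReal (ι := ι))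
    hermitianOfReal_injective (R := 3) (by norm_num) (half_pos hδ)
  refine ⟨Finset.image₂ (fun U A => U * cayley (hermitianOfReal A)) T₀ T₁, ?_, ?_, ?_⟩
  · intro W hW
    obtain ⟨U, hU, A, -, rfl⟩ := Finset.mem_image₂.1 (Finset.mem_coe.1 hW)
    exact mul_mem (hT₀U hU) (cayley_mem_unitaryGroup (isHermitian_hermitianOfReal A))
  · intro V hV
    obtain ⟨U, hU, hVU⟩ := hT₀ V hV
    have hUU := hT₀U hU
    have h1 : U * (star U * V) = V := by
      rw [← mul_assoc, Matrix.mem_unitaryGroup_iff.1 hUU, one_mul]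
    have hW : star U * V ∈ Matrix.unitaryGroup ι ℂ := mul_mem (Unitary.star_mem hUU) hV
    have h2 : ‖star U * V - 1‖ ≤ 1 / 2 := by
      rw [← norm_mul_eq_of_mem_unitaryGroup hUU, mul_sub, h1, mul_one]
      exact hVU
    obtain ⟨H, hH, hH3, hHV⟩ := exists_cayley_eq_of_norm_sub_one_le hW h2
    obtain ⟨A, rfl, -⟩ := exists_hermitianOfReal_eq hH
    obtain ⟨A', hA', hAA'⟩ := hT₁ A hH3
    refine ⟨_, Finset.mem_image₂_of_mem hU hA', ?_⟩
    rw [← h1, ← mul_sub, norm_mul_eq_of_mem_unitaryGroup hUU, ← hHV]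
    refine (norm_cayley_sub_cayley_le (isHermitian_hermitianOfReal A)
      (isHermitian_hermitianOfReal A')).trans ?_
    linarith
  · rw [Module.finrank_matrix, Module.finrank_self, mul_one] at hc₁
    set D := Fintype.card ι * Fintype.card ι
    have h1 : (1 + 2 * 3 / (δ / 2) : ℝ) ≤ 13 / δ := by
      have : (1 : ℝ) ≤ 1 / δ := by rw [le_div_iff₀ hδ]; linarith
      have h2 : (2 * 3 / (δ / 2) : ℝ) = 12 * (1 / δ) := by field_simp; norm_num
      have h3 : (13 / δ : ℝ) = 13 * (1 / δ) := by ring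
      linarith
    have h2 : (1 + 2 / (1 / 2) : ℝ) = 5 := by norm_num
    rw [h2] at hc₀
    calc _ ≤ ((T₀.card * T₁.card : ℕ) : ℝ) := Nat.cast_le.2 (Finset.card_image₂_le _ _ _)
      _ = (T₀.card : ℝ) * T₁.card := by push_cast; ring
      _ ≤ 5 ^ (2 * D) * (1 + 2 * 3 / (δ / 2)) ^ D := by gcongr
      _ ≤ 5 ^ (2 * D) * (13 / δ) ^ D := by gcongr
      _ = _ := by rw [pow_mul, ← mul_pow]; congr 1; ring

variable {n : ℕ}

theorem norm_sub_le_of_mul {U V U' V' : Matrix ι ι ℂ} (hU : U ∈ Matrix.unitaryGroup ι ℂ)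
    (hV' : V' ∈ Matrix.unitaryGroup ι ℂ) :
    ‖U * V - U' * V'‖ ≤ ‖U - U'‖ + ‖V - V'‖ := by
  have h : U * V - U' * V' = U * (V - V') + (U - U') * V' := by noncomm_ring
  rw [h, add_comm]
  refine (norm_add_le _ _).trans (add_le_add ?_ (norm_mul_eq_of_mem_unitaryGroup hU _).le)
  exact (CStarRing.norm_mul_mem_unitary _ hV').le

/-- A net of `U(4)` gives a net of the `G`-gate unitaries. -/
theorem exists_finset_net_gateUnitaries (hn : 2 ≤ n) {δ : ℝ}
    (T : Finset (Matrix (Fin 2 × Fin 2) (Fin 2 × Fin 2) ℂ))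
    (hTU : ∀ V ∈ T, V ∈ Matrix.unitaryGroup (Fin 2 × Fin 2) ℂ)
    (hT : ∀ V ∈ Matrix.unitaryGroup (Fin 2 × Fin 2) ℂ, ∃ W ∈ T, ‖V - W‖ ≤ δ) (G : ℕ) :
    ∃ N : Finset (QubitUnitary n), ↑N ⊆ gateUnitaries n G ∧
      (∀ U ∈ gateUnitaries n G, ∃ V ∈ N, ‖U.1 - V.1‖ ≤ G * δ) ∧
      N.card ≤ (n ^ 2 * T.card) ^ G := by
  classical
  -- Invalid data, such as equal qubits, give the identity, which is also a gate; so all `n ^ 2`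
  -- pairs may be counted.
  let gate : (Fin n × Fin n) × Matrix (Fin 2 × Fin 2) (Fin 2 × Fin 2) ℂ → QubitUnitary n :=
    fun q => if h : q.1.1 ≠ q.1.2 ∧ q.2 ∈ Matrix.unitaryGroup (Fin 2 × Fin 2) ℂ then
      ⟨actOnPair q.1.1 q.1.2 q.2, actOnPair_mem_unitaryGroup h.1 h.2⟩ else 1
  have hgate : ∀ q, IsTwoQubitGate (gate q) := fun q => by
    by_cases h : q.1.1 ≠ q.1.2 ∧ q.2 ∈ Matrix.unitaryGroup (Fin 2 × Fin 2) ℂ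
    · simp only [gate, dif_pos h]
      exact ⟨_, _, h.1, _, h.2, rfl⟩
    · simp only [gate, dif_neg h]
      exact isTwoQubitGate_one hn
  set Γ : Finset (QubitUnitary n) := (Finset.univ ×ˢ T).image gate with hΓ
  have hΓc : Γ.card ≤ n ^ 2 * T.card := by
    refine Finset.card_image_le.trans_eq ?_
    rw [Finset.card_product, Finset.card_univ, Fintype.card_prod, Fintype.card_fin, sq]
  have hΓnet : ∀ U : QubitUnitary n, IsTwoQubitGate U → ∃ V ∈ Γ, ‖U.1 - V.1‖ ≤ δ := by
    rintro U ⟨i, j, hij, V, hV, hUV⟩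
    obtain ⟨W, hW, hVW⟩ := hT V hV
    refine ⟨gate ((i, j), W), Finset.mem_image_of_mem _ (by simp [hW]), ?_⟩
    have h : ((i, j), W).1.1 ≠ ((i, j), W).1.2 ∧
      ((i, j), W).2 ∈ Matrix.unitaryGroup (Fin 2 × Fin 2) ℂ := ⟨hij, hTU W hW⟩
    simp only [gate, dif_pos h]
    rw [hUV]
    exact (norm_actOnPair_sub_le hij V W).trans hVW
  induction G with
  | zero =>
    refine ⟨{1}, ?_, ?_, by simp⟩
    · rw [Finset.coe_singleton, Set.singleton_subset_iff]
      exact one_mem_gateUnitaries_zero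
    · rintro U ⟨l, hl, -, rfl⟩
      rw [List.length_eq_zero_iff] at hl
      subst hl
      exact ⟨1, by simp, by simp⟩
  | succ G ih =>
    obtain ⟨N, hN1, hN2, hN3⟩ := ih
    refine ⟨Finset.image₂ (· * ·) Γ N, ?_, ?_, ?_⟩
    · intro U hU
      obtain ⟨g, hg, V, hV, rfl⟩ := Finset.mem_image₂.1 (Finset.mem_coe.1 hU)
      obtain ⟨q, -, rfl⟩ := Finset.mem_image.1 hg
      have := mul_mem_gateUnitaries (a := 1) (U := gate q) ⟨[gate q], rfl, by simpa using hgate q,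
        by simp⟩ (hN1 hV)
      rwa [add_comm] at this
    · rintro U ⟨l, hl, hg, rfl⟩
      cases l with
      | nil => simp at hl
      | cons g l =>
        obtain ⟨V, hV, hUV⟩ := hΓnet g (hg g List.mem_cons_self)
        obtain ⟨W, hW, hlW⟩ := hN2 l.prod ⟨l, by simpa using hl,
          fun g' hg' => hg g' (List.mem_cons_of_mem _ hg'), rfl⟩
        refine ⟨V * W, Finset.mem_image₂_of_mem hV hW, ?_⟩
        rw [List.prod_cons, Submonoid.coe_mul, Submonoid.coe_mul]
        refine (norm_sub_le_of_mul g.2 W.2).trans ?_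
        refine (add_le_add hUV hlW).trans_eq ?_
        push_cast
        ring
    · refine (Finset.card_image₂_le _ _ _).trans ?_
      rw [pow_succ, mul_comm]
      exact Nat.mul_le_mul hN3 hΓc

/-- An upper bound for the metric entropy with respect to a distance that is dominated by the
operator norm. -/
theorem metricEntropy_gateUnitaries_le (hn : 2 ≤ n) {G : ℕ}
    {dist : QubitUnitary n → QubitUnitary n → ℝ} {L δ ε a : ℝ} {p : ℕ} (hL : 0 ≤ L)
    (ha : 1 ≤ a) (hδ : L * (G * δ) ≤ ε) (hdist : ∀ U V, dist U V ≤ L * ‖U.1 - V.1‖)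
    (T : Finset (Matrix (Fin 2 × Fin 2) (Fin 2 × Fin 2) ℂ))
    (hTU : ↑T ⊆ (Matrix.unitaryGroup (Fin 2 × Fin 2) ℂ :
      Set (Matrix (Fin 2 × Fin 2) (Fin 2 × Fin 2) ℂ)))
    (hT : ∀ V ∈ Matrix.unitaryGroup (Fin 2 × Fin 2) ℂ, ∃ W ∈ T, ‖V - W‖ ≤ δ)
    (hTc : (T.card : ℝ) ≤ a ^ p) :
    metricEntropy dist (gateUnitaries n G) ε ≤
      ((p * G * Real.log a + 2 * G * Real.log n : ℝ) : EReal) := by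
  obtain ⟨N, hN1, hN2, hN3⟩ := exists_finset_net_gateUnitaries hn T (fun V hV => hTU hV) hT G
  have hmem : (1 : QubitUnitary n) ∈ gateUnitaries n G :=
    gateUnitaries_mono hn (Nat.zero_le G) one_mem_gateUnitaries_zero
  obtain ⟨V0, hV0, -⟩ := hN2 1 hmem
  have hNpos : (0 : ℝ) < N.card := by exact_mod_cast Finset.card_pos.2 ⟨V0, hV0⟩
  refine metricEntropy_le (N := N) ⟨hN1, fun U hU => ?_⟩ ⟨V0, hV0⟩ ?_
  · obtain ⟨V, hV, hUV⟩ := hN2 U hU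
    exact ⟨V, hV, (hdist U V).trans ((mul_le_mul_of_nonneg_left hUV hL).trans hδ)⟩
  · have hn0 : (0 : ℝ) < n := by exact_mod_cast (by omega : 0 < n)
    have h1 : (N.card : ℝ) ≤ ((n : ℝ) ^ 2 * a ^ p) ^ G := by
      have : (N.card : ℝ) ≤ ((n : ℝ) ^ 2 * T.card) ^ G := by exact_mod_cast hN3
      exact this.trans (by gcongr)
    refine (Real.log_le_log hNpos h1).trans_eq ?_
    rw [Real.log_pow, Real.log_mul (by positivity) (by positivity), Real.log_pow, Real.log_pow]
    push_cast
    ring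

theorem frobeniusDist_le (U V : QubitUnitary n) : frobeniusDist U V ≤ 1 * ‖U.1 - V.1‖ := by
  rw [frobeniusDist, one_mul, div_le_iff₀ (by positivity)]
  have := frobeniusNorm_le_opNorm (U.1 - V.1)
  simpa using this

/-! ### The diamond distance -/

/-- Trace norm duality from the polar decomposition: `S` is the pseudo-inverse of `|M|` times `Mᴴ`,
a partial isometry. -/
theorem exists_trace_mul_eq_traceNorm (M : Matrix ι ι ℂ) :
    ∃ S : Matrix ι ι ℂ, ‖S‖ ≤ 1 ∧ (S * M).trace = traceNorm M := by
  set hH := Matrix.isHermitian_conjTranspose_mul_self M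
  set Q : Matrix ι ι ℂ := hH.eigenvectorUnitary.1
  have hQ : Q ∈ Matrix.unitaryGroup ι ℂ := hH.eigenvectorUnitary.2
  set l := hH.eigenvalues with hl
  have hl0 : ∀ i, 0 ≤ l i := fun i => (Matrix.posSemidef_conjTranspose_mul_self M).eigenvalues_nonneg i
  have hM : Mᴴ * M = Q * Matrix.diagonal (fun i => (l i : ℂ)) * Qᴴ := by
    conv_lhs => rw [hH.spectral_theorem]
    rfl
  -- Inverse singular values; the convention `0⁻¹ = 0` gives the pseudo-inverse on the kernel.
  set w : ι → ℝ := fun i => (√(l i))⁻¹ with hw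
  have hwl : ∀ i, w i * l i = √(l i) := fun i => by
    simp only [hw]
    by_cases h0 : √(l i) = 0
    · rw [h0, (Real.sqrt_eq_zero (hl0 i)).1 h0]; simp
    · nth_rewrite 2 [← Real.mul_self_sqrt (hl0 i)]
      field_simp
  have hD : (Q * Matrix.diagonal (fun i => (w i : ℂ)) * Qᴴ)ᴴ =
      Q * Matrix.diagonal (fun i => (w i : ℂ)) * Qᴴ := by
    rw [Matrix.conjTranspose_mul, Matrix.conjTranspose_mul, Matrix.diagonal_conjTranspose,
      Matrix.conjTranspose_conjTranspose, mul_assoc]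
    congr 3
    funext i
    simp
  refine ⟨Q * Matrix.diagonal (fun i => (w i : ℂ)) * Qᴴ * Mᴴ, ?_, ?_⟩
  · set S := Q * Matrix.diagonal (fun i => (w i : ℂ)) * Qᴴ * Mᴴ with hS
    have h1 : Sᴴᴴ * Sᴴ = Q * Matrix.diagonal (fun i => (w i : ℂ) * (l i) * w i) * Qᴴ := by
      rw [Matrix.conjTranspose_conjTranspose, hS, Matrix.conjTranspose_mul,
        Matrix.conjTranspose_conjTranspose, hD, mul_assoc, ← mul_assoc Mᴴ, hM,
        ← mul_assoc, conj_unitary_diagonal_mul hQ, conj_unitary_diagonal_mul hQ]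
    have h2 : ‖Sᴴᴴ * Sᴴ‖ ≤ 1 := by
      rw [h1]
      refine norm_conj_unitary_diagonal_le hQ zero_le_one fun i => ?_
      rw [← Complex.ofReal_mul, ← Complex.ofReal_mul, Complex.norm_real, hwl]
      simp only [hw, Real.norm_eq_abs]
      by_cases h0 : √(l i) = 0
      · simp [h0]
      · rw [mul_inv_cancel₀ h0, abs_one]
    rw [Matrix.l2_opNorm_conjTranspose_mul_self, Matrix.l2_opNorm_conjTranspose] at h2
    nlinarith [norm_nonneg S]
  · rw [mul_assoc, hM, conj_unitary_diagonal_mul hQ, Matrix.trace_mul_cycle,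
      ← Matrix.star_eq_conjTranspose, Matrix.mem_unitaryGroup_iff'.1 hQ, one_mul,
      Matrix.trace_diagonal, traceNorm]
    push_cast
    refine Finset.sum_congr rfl fun i _ => ?_
    rw [← Complex.ofReal_mul, hwl]

open scoped MatrixOrder in
-- Write `ρ = Bᴴ * B` with `B` of Frobenius norm 1 and apply Cauchy–Schwarz.
theorem norm_trace_mul_densityMatrix_le (X : Matrix ι ι ℂ) {ρ : Matrix ι ι ℂ}
    (hρ : IsDensityMatrix ρ) : ‖(X * ρ).trace‖ ≤ ‖X‖ := by
  obtain ⟨B, hB⟩ : ∃ B, ρ = Bᴴ * B :=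
    CStarAlgebra.nonneg_iff_eq_star_mul_self.1 (Matrix.nonneg_iff_posSemidef.2 hρ.1)
  have h1 : frobeniusNorm B ^ 2 = 1 := by
    have := trace_conjTranspose_mul_self B
    rw [← hB, hρ.2] at this
    exact_mod_cast this.symm
  rw [hB, ← mul_assoc]
  refine (norm_trace_mul_le _ _).trans ?_
  calc _ ≤ ‖X‖ * frobeniusNorm Bᴴ * frobeniusNorm B :=
        mul_le_mul_of_nonneg_right (frobeniusNorm_mul_le_left _ _) (frobeniusNorm_nonneg _)
    _ = ‖X‖ * frobeniusNorm B ^ 2 := by rw [frobeniusNorm_conjTranspose]; ring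
    _ = ‖X‖ := by rw [h1, mul_one]

/-- Telescoping: the difference is `(U - V) ρ Uᴴ + V ρ (U - V)ᴴ`. Tested against the dual
contraction, each term contributes at most `‖U - V‖`. -/
theorem traceNorm_conj_sub_conj_le {U V ρ : Matrix ι ι ℂ} (hU : U ∈ Matrix.unitaryGroup ι ℂ)
    (hV : V ∈ Matrix.unitaryGroup ι ℂ) (hρ : IsDensityMatrix ρ) :
    traceNorm (U * ρ * Uᴴ - V * ρ * Vᴴ) ≤ 2 * ‖U - V‖ := by
  obtain ⟨S, hS, hSt⟩ := exists_trace_mul_eq_traceNorm (U * ρ * Uᴴ - V * ρ * Vᴴ)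
  have h1 : (S * (U * ρ * Uᴴ - V * ρ * Vᴴ)).trace =
      (Uᴴ * S * (U - V) * ρ).trace + ((U - V)ᴴ * S * V * ρ).trace := by
    have e1 : S * (U * ρ * Uᴴ - V * ρ * Vᴴ) =
        (S * (U - V) * ρ) * Uᴴ + (S * V * ρ) * (U - V)ᴴ := by
      rw [Matrix.conjTranspose_sub]
      noncomm_ring
    rw [e1, Matrix.trace_add, Matrix.trace_mul_comm, Matrix.trace_mul_comm (S * V * ρ)]
    simp only [mul_assoc]
  have hU' : ‖Uᴴ‖ ≤ 1 := by
    rw [Matrix.l2_opNorm_conjTranspose]; exact norm_le_one_of_mem_unitaryGroup hU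
  have hV' := norm_le_one_of_mem_unitaryGroup hV
  have h2 : ‖Uᴴ * S * (U - V)‖ ≤ ‖U - V‖ := by
    calc _ ≤ ‖Uᴴ‖ * ‖S‖ * ‖U - V‖ :=
          (norm_mul_le _ _).trans (by gcongr; exact norm_mul_le _ _)
      _ ≤ 1 * 1 * ‖U - V‖ := by gcongr
      _ = _ := by ring
  have h3 : ‖(U - V)ᴴ * S * V‖ ≤ ‖U - V‖ := by
    calc _ ≤ ‖(U - V)ᴴ‖ * ‖S‖ * ‖V‖ :=
          (norm_mul_le _ _).trans (by gcongr; exact norm_mul_le _ _)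
      _ ≤ ‖U - V‖ * 1 * 1 := by
          rw [Matrix.l2_opNorm_conjTranspose]
          gcongr
      _ = _ := by ring
  have h4 : traceNorm (U * ρ * Uᴴ - V * ρ * Vᴴ) ≤
      ‖(S * (U * ρ * Uᴴ - V * ρ * Vᴴ)).trace‖ := by
    rw [hSt, Complex.norm_real]
    exact le_abs_self _
  rw [h1] at h4
  have h5 := norm_add_le (Uᴴ * S * (U - V) * ρ).trace ((U - V)ᴴ * S * V * ρ).trace
  have h6 := norm_trace_mul_densityMatrix_le (Uᴴ * S * (U - V)) hρ
  have h7 := norm_trace_mul_densityMatrix_le ((U - V)ᴴ * S * V) hρ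
  linarith

theorem diamondDist_le (U V : QubitUnitary n) : diamondDist U V ≤ 2 * ‖U.1 - V.1‖ := by
  refine Real.sSup_le ?_ (by positivity)
  rintro r ⟨m, ρ, hρ, rfl⟩
  let Φ := tensorFactorHom (Equiv.refl (QubitBasis n × Fin m))
  have hΦ : ∀ A, A ⊗ₖ (1 : Matrix (Fin m) (Fin m) ℂ) = Φ A := fun _ => rfl
  rw [hΦ, hΦ]
  refine (traceNorm_conj_sub_conj_le (tensorFactorHom_mem_unitaryGroup _ U.2)
    (tensorFactorHom_mem_unitaryGroup _ V.2) hρ).trans ?_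
  rw [← map_sub]
  gcongr
  exact norm_tensorFactorHom_le _ _

end OperatorNets

/-! ### The trace distance of pure states -/

section TraceDistance

variable {ι : Type*} [Fintype ι]

theorem star_dotProduct_self (v : ι → ℂ) : star v ⬝ᵥ v = ((∑ i, ‖v i‖ ^ 2 : ℝ) : ℂ) := by
  rw [dotProduct]
  push_cast
  refine Finset.sum_congr rfl fun i _ => ?_
  rw [mul_comm]
  exact RCLike.mul_conj _

theorem star_dotProduct_comm (v w : ι → ℂ) : star w ⬝ᵥ v = star (star v ⬝ᵥ w) := by
  rw [Matrix.star_dotProduct]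

theorem star_mulVec_dotProduct (A : Matrix ι ι ℂ) (v w : ι → ℂ) :
    star (A *ᵥ v) ⬝ᵥ w = star v ⬝ᵥ (Aᴴ *ᵥ w) := by
  rw [Matrix.star_mulVec, Matrix.dotProduct_mulVec]

variable [DecidableEq ι]

theorem sum_norm_sq_mulVec_of_mem_unitaryGroup {U : Matrix ι ι ℂ}
    (hU : U ∈ Matrix.unitaryGroup ι ℂ) (v : ι → ℂ) :
    ∑ i, ‖(U *ᵥ v) i‖ ^ 2 = ∑ i, ‖v i‖ ^ 2 := by
  have h : star (U *ᵥ v) ⬝ᵥ (U *ᵥ v) = star v ⬝ᵥ v := by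
    rw [star_mulVec_dotProduct, Matrix.mulVec_mulVec, ← Matrix.star_eq_conjTranspose,
      Matrix.mem_unitaryGroup_iff'.1 hU, Matrix.one_mulVec]
  rw [star_dotProduct_self, star_dotProduct_self] at h
  exact_mod_cast h

/-- The square `N` of the difference of the two rank-one projections satisfies `N * N = s • N` and
has trace `2 s`. Its eigenvalues are therefore 0 or `s`, and their square roots add up to `2 √s`; no
eigenvectors are needed. -/
theorem traceDist_sq {ψ φ : ι → ℂ} (hψ : ∑ i, ‖ψ i‖ ^ 2 = 1) (hφ : ∑ i, ‖φ i‖ ^ 2 = 1) :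
    traceDist ψ φ ^ 2 = 1 - ‖star ψ ⬝ᵥ φ‖ ^ 2 := by
  set s : ℝ := 1 - ‖star ψ ⬝ᵥ φ‖ ^ 2 with hs
  set A := Matrix.vecMulVec ψ (star ψ) with hA
  set B := Matrix.vecMulVec φ (star φ) with hB
  have hψ1 : star ψ ⬝ᵥ ψ = 1 := by rw [star_dotProduct_self, hψ, Complex.ofReal_one]
  have hφ1 : star φ ⬝ᵥ φ = 1 := by rw [star_dotProduct_self, hφ, Complex.ofReal_one]
  have hc : (star ψ ⬝ᵥ φ) * (star φ ⬝ᵥ ψ) = 1 - (s : ℂ) := by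
    rw [star_dotProduct_comm ψ φ, hs]
    push_cast
    rw [sub_sub_cancel]
    exact RCLike.mul_conj _
  have hAA : A * A = A := by
    rw [hA, Matrix.vecMulVec_mul_vecMulVec, hψ1]; simp
  have hBB : B * B = B := by
    rw [hB, Matrix.vecMulVec_mul_vecMulVec, hφ1]; simp
  have hABA : A * B * A = (1 - (s : ℂ)) • A := by
    rw [hA, hB, Matrix.vecMulVec_mul_vecMulVec, Matrix.vecMulVec_mul_vecMulVec, ← hc]
    ext i j
    simp only [Matrix.vecMulVec_apply, Matrix.smul_apply, Pi.smul_apply, smul_eq_mul,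
      smul_dotProduct]
    ring
  have hBAB : B * A * B = (1 - (s : ℂ)) • B := by
    rw [hA, hB, Matrix.vecMulVec_mul_vecMulVec, Matrix.vecMulVec_mul_vecMulVec, ← hc]
    ext i j
    simp only [Matrix.vecMulVec_apply, Matrix.smul_apply, Pi.smul_apply, smul_eq_mul,
      smul_dotProduct]
    ring
  have hMH : (A - B)ᴴ = A - B := by
    rw [Matrix.conjTranspose_sub, hA, hB, Matrix.conjTranspose_vecMulVec,
      Matrix.conjTranspose_vecMulVec, star_star, star_star]
  set N := (A - B)ᴴ * (A - B) with hN
  have hN1 : N = A + B - A * B - B * A := by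
    rw [hN, hMH]
    have : (A - B) * (A - B) = A * A + B * B - A * B - B * A := by noncomm_ring
    rw [this, hAA, hBB]
  have hAN : A * N = (s : ℂ) • A := by
    have : A * N = A * A + A * B - A * A * B - A * B * A := by rw [hN1]; noncomm_ring
    rw [this, hAA, hABA]
    module
  have hBN : B * N = (s : ℂ) • B := by
    have : B * N = B * A + B * B - B * A * B - B * B * A := by rw [hN1]; noncomm_ring
    rw [this, hBB, hBAB]
    module
  have hNN : N * N = (s : ℂ) • N := by
    have : N * N = A * N + B * N - A * (B * N) - B * (A * N) := by
      nth_rewrite 1 [hN1]; noncomm_ring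
    rw [this, hAN, hBN, Matrix.mul_smul, Matrix.mul_smul, hN1]
    module
  set hH := Matrix.isHermitian_conjTranspose_mul_self (A - B)
  set Q : Matrix ι ι ℂ := hH.eigenvectorUnitary.1
  have hQ : Q ∈ Matrix.unitaryGroup ι ℂ := hH.eigenvectorUnitary.2
  have hQ' : Qᴴ * Q = 1 := Matrix.mem_unitaryGroup_iff'.1 hQ
  set l := hH.eigenvalues with hl
  have hl0 : ∀ i, 0 ≤ l i := fun i =>
    (Matrix.posSemidef_conjTranspose_mul_self (A - B)).eigenvalues_nonneg i
  have hD : N = Q * Matrix.diagonal (fun i => (l i : ℂ)) * Qᴴ := by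
    conv_lhs => rw [hN, hH.spectral_theorem]
    rfl
  have hll : ∀ i, l i * l i = s * l i := by
    have h1 : Qᴴ * (N * N) * Q = Matrix.diagonal (fun i => (l i : ℂ) * l i) := by
      rw [hD, conj_unitary_diagonal_mul hQ, mul_assoc, mul_assoc, hQ', mul_one, ← mul_assoc, hQ',
        one_mul]
    have h2 : Qᴴ * ((s : ℂ) • N) * Q = (s : ℂ) • Matrix.diagonal (fun i => (l i : ℂ)) := by
      rw [Matrix.mul_smul, Matrix.smul_mul, hD, mul_assoc, mul_assoc, hQ', mul_one, ← mul_assoc,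
        hQ', one_mul]
    intro i
    have h3 := congrFun (congrFun (h1.symm.trans ((congrArg (fun X => Qᴴ * X * Q) hNN).trans h2))
      i) i
    rw [Matrix.smul_apply, Matrix.diagonal_apply_eq, Matrix.diagonal_apply_eq, smul_eq_mul] at h3
    exact_mod_cast h3
  have htr : ∑ i, l i = 2 * s := by
    have h1 := hH.trace_eq_sum_eigenvalues
    have h2 : N.trace = 2 * s := by
      rw [hN1, Matrix.trace_sub, Matrix.trace_sub, Matrix.trace_add, Matrix.trace_mul_comm B A,
        hA, hB, Matrix.vecMulVec_mul_vecMulVec, Matrix.trace_vecMulVec, Matrix.trace_vecMulVec,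
        Matrix.trace_vecMulVec, dotProduct_comm ψ, dotProduct_comm φ, hψ1, hφ1]
      simp only [dotProduct_smul, smul_eq_mul, dotProduct_comm ψ (star φ)]
      rw [hc]
      ring
    have h3 : ((∑ i, l i : ℝ) : ℂ) = ((2 * s : ℝ) : ℂ) := by
      push_cast
      rw [← h2, hN, h1]
      rfl
    exact_mod_cast h3
  have hs0 : 0 ≤ s := by
    have := Finset.sum_nonneg fun i (_ : i ∈ Finset.univ) => hl0 i
    linarith
  have hnorm : traceNorm (A - B) = 2 * √s := by
    have hsq : ∀ i, √(l i) * √s = l i := fun i => by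
      rw [← Real.sqrt_mul (hl0 i), mul_comm, ← hll, Real.sqrt_mul_self (hl0 i)]
    by_cases h0 : √s = 0
    · have : ∀ i, l i = 0 := fun i => by rw [← hsq i, h0, mul_zero]
      simp only [traceNorm, ← hl, this, h0]
      simp
    · have h4 : traceNorm (A - B) * √s = 2 * √s * √s := by
        rw [traceNorm, Finset.sum_mul, mul_assoc, Real.mul_self_sqrt hs0, ← htr]
        exact Finset.sum_congr rfl fun i _ => hsq i
      exact mul_right_cancel₀ h0 h4
  rw [traceDist, hnorm, mul_div_cancel_left₀ _ two_ne_zero, Real.sq_sqrt hs0]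

theorem traceDist_mulVec_sq {U V : Matrix ι ι ℂ} (hU : U ∈ Matrix.unitaryGroup ι ℂ)
    (hV : V ∈ Matrix.unitaryGroup ι ℂ) {ψ : ι → ℂ} (hψ : ∑ i, ‖ψ i‖ ^ 2 = 1) :
    traceDist (U *ᵥ ψ) (V *ᵥ ψ) ^ 2 = 1 - ‖star ψ ⬝ᵥ ((Uᴴ * V) *ᵥ ψ)‖ ^ 2 := by
  rw [traceDist_sq (by rwa [sum_norm_sq_mulVec_of_mem_unitaryGroup hU])
    (by rwa [sum_norm_sq_mulVec_of_mem_unitaryGroup hV]), star_mulVec_dotProduct,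
    Matrix.mulVec_mulVec]

open scoped Matrix.Norms.L2Operator in
-- With `z` the overlap of the two states, `1 - |z| ^ 2 ≤ 2 - 2 Re z = ‖(U - V) ψ‖ ^ 2`, since `|z -
-- 1| ^ 2 ≥ 0`.
theorem traceDist_mulVec_sq_le {U V : Matrix ι ι ℂ} (hU : U ∈ Matrix.unitaryGroup ι ℂ)
    (hV : V ∈ Matrix.unitaryGroup ι ℂ) {ψ : ι → ℂ} (hψ : ∑ i, ‖ψ i‖ ^ 2 = 1) :
    traceDist (U *ᵥ ψ) (V *ᵥ ψ) ^ 2 ≤ ‖U - V‖ ^ 2 := by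
  have hUψ := (sum_norm_sq_mulVec_of_mem_unitaryGroup hU ψ).trans hψ
  have hVψ := (sum_norm_sq_mulVec_of_mem_unitaryGroup hV ψ).trans hψ
  rw [traceDist_sq hUψ hVψ]
  have h1 := sum_norm_sq_mulVec_le (U - V) ψ
  rw [hψ, mul_one] at h1
  refine le_trans ?_ h1
  set a := U *ᵥ ψ
  set b := V *ᵥ ψ
  have h2 : ((∑ i, ‖((U - V) *ᵥ ψ) i‖ ^ 2 : ℝ) : ℂ) =
      1 + 1 - star a ⬝ᵥ b - star (star a ⬝ᵥ b) := by
    rw [← star_dotProduct_self, Matrix.sub_mulVec, star_sub, sub_dotProduct, dotProduct_sub,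
      dotProduct_sub, star_dotProduct_self a, star_dotProduct_self b, hUψ, hVψ,
      star_dotProduct_comm a b, Complex.ofReal_one]
    ring
  have h3 := congrArg Complex.re h2
  simp only [Complex.ofReal_re, Complex.sub_re, Complex.add_re, Complex.one_re,
    RCLike.star_def, Complex.conj_re] at h3
  rw [h3, ← Complex.normSq_eq_norm_sq, Complex.normSq_apply]
  nlinarith [sq_nonneg ((star a ⬝ᵥ b).re - 1), sq_nonneg ((star a ⬝ᵥ b).im)]

end TraceDistance

/-! ### Moments of Haar-random states -/

section Haar

open MeasureTheory

variable {n : ℕ}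

instance isProbabilityMeasure_haarUnitary : IsProbabilityMeasure (haarUnitary n) := by
  refine ⟨?_⟩
  have := Measure.haarMeasure_self (K₀ := (⊤ : TopologicalSpace.PositiveCompacts (QubitUnitary n)))
  rwa [TopologicalSpace.PositiveCompacts.coe_top] at this

instance isMulLeftInvariant_haarUnitary : (haarUnitary n).IsMulLeftInvariant := by
  unfold haarUnitary
  infer_instance

/-- The Haar-random state `W|0⟩`. -/
def haarState (W : QubitUnitary n) : QubitBasis n → ℂ := W.1 *ᵥ zeroState n

theorem sum_norm_sq_haarState (W : QubitUnitary n) : ∑ x, ‖haarState W x‖ ^ 2 = 1 := by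
  rw [haarState, sum_norm_sq_mulVec_of_mem_unitaryGroup W.2, zeroState,
    Finset.sum_eq_single 0 (fun x _ hx => by simp [hx]) (by simp)]
  simp

theorem continuous_haarState : Continuous (haarState (n := n)) :=
  continuous_subtype_val.matrix_mulVec continuous_const

theorem integrable_haarUnitary {f : QubitUnitary n → ℝ} (hf : Continuous f) :
    Integrable f (haarUnitary n) :=
  hf.integrable_of_hasCompactSupport (HasCompactSupport.of_compactSpace f)

@[fun_prop]
theorem continuous_norm_dotProduct_haarState (v : QubitBasis n → ℂ) :
    Continuous fun W : QubitUnitary n => ‖star v ⬝ᵥ haarState W‖ :=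
  (continuous_const.dotProduct continuous_haarState).norm

theorem star_mulVec_dotProduct_haarState_mul (Q W : QubitUnitary n) (v : QubitBasis n → ℂ) :
    star (Q.1 *ᵥ v) ⬝ᵥ haarState (Q * W) = star v ⬝ᵥ haarState W := by
  rw [star_mulVec_dotProduct, haarState, haarState, Matrix.mulVec_mulVec, Submonoid.coe_mul,
    ← mul_assoc, ← Matrix.star_eq_conjTranspose, Matrix.mem_unitaryGroup_iff'.1 Q.2, one_mul]

/-- The fourth moment of the overlap with a unit vector does not depend on the vector. -/
theorem exists_integral_norm_pow_four_eq (hn : 2 ≤ n) :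
    ∃ a : ℝ, ∀ v : QubitBasis n → ℂ, ∑ x, ‖v x‖ ^ 2 = 1 →
      ∫ W, ‖star v ⬝ᵥ haarState W‖ ^ 4 ∂haarUnitary n = a := by
  refine ⟨∫ W, ‖star (Pi.single 0 1 : QubitBasis n → ℂ) ⬝ᵥ haarState W‖ ^ 4 ∂haarUnitary n,
    fun v hv => ?_⟩
  -- State preparation supplies a unitary taking the zero state to `v`; left invariance of Haar
  -- measure absorbs it.
  obtain ⟨M, hM, rfl⟩ := exists_isCircuit_mulVec_eq hn v hv
  rw [← integral_mul_left_eq_self _ (⟨M, hM.mem_unitaryGroup⟩ : QubitUnitary n)]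
  exact integral_congr_ae (.of_forall fun W => by
    simp only
    rw [star_mulVec_dotProduct_haarState_mul ⟨M, hM.mem_unitaryGroup⟩])

/-- Polarization: averaging over the phases ±1, ±i cancels the odd cross terms and expresses the
mixed moment by fourth powers. -/
theorem sum_norm_pow_four_eq (x y : ℂ) :
    ‖x + y‖ ^ 4 + ‖x - y‖ ^ 4 + ‖x + Complex.I * y‖ ^ 4 + ‖x - Complex.I * y‖ ^ 4 =
      4 * ‖x‖ ^ 4 + 4 * ‖y‖ ^ 4 + 16 * (‖x‖ ^ 2 * ‖y‖ ^ 2) := by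
  have h : ∀ z : ℂ, ‖z‖ ^ 4 = (z.re * z.re + z.im * z.im) ^ 2 := fun z => by
    rw [← Complex.normSq_apply, Complex.normSq_eq_norm_sq]
    ring
  have h2 : ∀ z : ℂ, ‖z‖ ^ 2 = z.re * z.re + z.im * z.im := fun z => by
    rw [← Complex.normSq_apply, Complex.normSq_eq_norm_sq]
  simp only [h, h2, Complex.add_re, Complex.add_im, Complex.sub_re, Complex.sub_im,
    Complex.mul_re, Complex.mul_im, Complex.I_re, Complex.I_im]
  ring

/-- Each combination of `u` and `v` with a relative phase has norm `√2`, hence fourth moment `4 a`.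
Polarization gives `16 a = 4 a + 4 a + 16 x` for the mixed moment `x`. -/
theorem integral_norm_sq_mul_norm_sq {a : ℝ}
    (ha : ∀ v : QubitBasis n → ℂ, ∑ x, ‖v x‖ ^ 2 = 1 →
      ∫ W, ‖star v ⬝ᵥ haarState W‖ ^ 4 ∂haarUnitary n = a)
    {u v : QubitBasis n → ℂ} (hu : star u ⬝ᵥ u = 1) (hv : star v ⬝ᵥ v = 1)
    (huv : star u ⬝ᵥ v = 0) :
    ∫ W, ‖star u ⬝ᵥ haarState W‖ ^ 2 * ‖star v ⬝ᵥ haarState W‖ ^ 2 ∂haarUnitary n = a / 2 := by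
  have hvu : star v ⬝ᵥ u = 0 := by rw [star_dotProduct_comm u v, huv, star_zero]
  have hunit : ∀ w : QubitBasis n → ℂ, star w ⬝ᵥ w = 1 → ∑ x, ‖w x‖ ^ 2 = 1 := fun w hw => by
    rw [star_dotProduct_self] at hw
    exact_mod_cast hw
  have hcomb : ∀ ω : ℂ, ‖ω‖ = 1 →
      ∫ W, ‖star u ⬝ᵥ haarState W + ω * (star v ⬝ᵥ haarState W)‖ ^ 4 ∂haarUnitary n = 4 * a := by
    intro ω hω
    have hωω : ω * star ω = 1 := by
      have := RCLike.mul_conj ω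
      simpa [hω] using this
    have hr : (((√2)⁻¹ : ℝ) : ℂ) * (((√2)⁻¹ : ℝ) : ℂ) = 1 / 2 := by
      rw [← Complex.ofReal_mul, ← mul_inv, Real.mul_self_sqrt zero_le_two]
      norm_num
    set w : QubitBasis n → ℂ := (((√2)⁻¹ : ℝ) : ℂ) • (u + star ω • v) with hw
    have hsw : star w = (((√2)⁻¹ : ℝ) : ℂ) • (star u + ω • star v) := by
      rw [hw, star_smul, star_add, star_smul, star_star]
      simp
    have hw1 : star w ⬝ᵥ w = 1 := by
      rw [hsw, hw]
      simp only [smul_dotProduct, dotProduct_smul, add_dotProduct, dotProduct_add, hu, hv, huv,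
        hvu, smul_eq_mul]
      linear_combination (1 + ω * star ω) * hr + (1 / 2) * hωω
    have h1 := ha w (hunit w hw1)
    have h2 : ∀ W, ‖star w ⬝ᵥ haarState W‖ ^ 4 =
        (1 / 4) * ‖star u ⬝ᵥ haarState W + ω * (star v ⬝ᵥ haarState W)‖ ^ 4 := fun W => by
      rw [hsw]
      simp only [smul_dotProduct, add_dotProduct, smul_eq_mul, norm_mul, mul_pow,
        Complex.norm_real, norm_inv, Real.norm_eq_abs, abs_of_nonneg (Real.sqrt_nonneg 2)]
      have : (√2)⁻¹ ^ 4 = (1 / 4 : ℝ) := by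
        rw [inv_pow, show (4 : ℕ) = 2 * 2 from rfl, pow_mul, Real.sq_sqrt zero_le_two]
        norm_num
      rw [this]
    simp only [h2] at h1
    rw [integral_const_mul] at h1
    linarith
  have hint : ∀ ω : ℂ, Integrable (fun W => ‖star u ⬝ᵥ haarState W +
      ω * (star v ⬝ᵥ haarState W)‖ ^ 4) (haarUnitary n) := fun ω => by
    refine integrable_haarUnitary (Continuous.pow (Continuous.norm ?_) 4)
    exact (continuous_const.dotProduct continuous_haarState).add
      (continuous_const.mul (continuous_const.dotProduct continuous_haarState))
  have h1 := hcomb 1 (by simp)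
  have h2 := hcomb (-1) (by simp)
  have h3 := hcomb Complex.I (by simp)
  have h4 := hcomb (-Complex.I) (by simp)
  have hsum := integral_add (((hint 1).add (hint (-1))).add (hint Complex.I)) (hint (-Complex.I))
  have hsum2 := integral_add ((hint 1).add (hint (-1))) (hint Complex.I)
  have hsum3 := integral_add (hint 1) (hint (-1))
  simp only [Pi.add_apply] at hsum hsum2 hsum3
  rw [hsum2, hsum3, h1, h2, h3, h4] at hsum
  have hiu : Integrable (fun W => ‖star u ⬝ᵥ haarState W‖ ^ 4) (haarUnitary n) :=
    integrable_haarUnitary (by fun_prop)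
  have hiv : Integrable (fun W => ‖star v ⬝ᵥ haarState W‖ ^ 4) (haarUnitary n) :=
    integrable_haarUnitary (by fun_prop)
  have hiuv : Integrable (fun W => ‖star u ⬝ᵥ haarState W‖ ^ 2 * ‖star v ⬝ᵥ haarState W‖ ^ 2)
    (haarUnitary n) := integrable_haarUnitary (by fun_prop)
  have hrhs : ∫ W, (4 * ‖star u ⬝ᵥ haarState W‖ ^ 4 + 4 * ‖star v ⬝ᵥ haarState W‖ ^ 4 +
      16 * (‖star u ⬝ᵥ haarState W‖ ^ 2 * ‖star v ⬝ᵥ haarState W‖ ^ 2)) ∂haarUnitary n =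
      4 * a + 4 * a + 16 * ∫ W, ‖star u ⬝ᵥ haarState W‖ ^ 2 * ‖star v ⬝ᵥ haarState W‖ ^ 2
        ∂haarUnitary n := by
    have h5 := integral_add ((hiu.const_mul 4).add (hiv.const_mul 4)) (hiuv.const_mul 16)
    simp only [Pi.add_apply] at h5
    rw [h5, integral_add (hiu.const_mul 4) (hiv.const_mul 4), integral_const_mul, integral_const_mul,
      integral_const_mul, ha u (hunit u hu), ha v (hunit v hv)]
  have hpt : ∀ W : QubitUnitary n, ‖star u ⬝ᵥ haarState W + 1 * (star v ⬝ᵥ haarState W)‖ ^ 4 +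
      ‖star u ⬝ᵥ haarState W + -1 * (star v ⬝ᵥ haarState W)‖ ^ 4 +
      ‖star u ⬝ᵥ haarState W + Complex.I * (star v ⬝ᵥ haarState W)‖ ^ 4 +
      ‖star u ⬝ᵥ haarState W + -Complex.I * (star v ⬝ᵥ haarState W)‖ ^ 4 =
      4 * ‖star u ⬝ᵥ haarState W‖ ^ 4 + 4 * ‖star v ⬝ᵥ haarState W‖ ^ 4 +
      16 * (‖star u ⬝ᵥ haarState W‖ ^ 2 * ‖star v ⬝ᵥ haarState W‖ ^ 2) := fun W => by
    rw [← sum_norm_pow_four_eq, one_mul, neg_one_mul, neg_mul, ← sub_eq_add_neg, ← sub_eq_add_neg]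
  simp only [hpt] at hsum
  rw [hrhs] at hsum
  linarith

/-- The second moment of the expectation of a Hermitian operator in a Haar-random state. -/
theorem integral_norm_sq_expectation {a : ℝ}
    (ha : ∀ v : QubitBasis n → ℂ, ∑ x, ‖v x‖ ^ 2 = 1 →
      ∫ W, ‖star v ⬝ᵥ haarState W‖ ^ 4 ∂haarUnitary n = a)
    {H : Matrix (QubitBasis n) (QubitBasis n) ℂ} (hH : H.IsHermitian) :
    (∀ W : QubitUnitary n, (star (haarState W) ⬝ᵥ (H *ᵥ haarState W)).im = 0) ∧
    ∫ W, (star (haarState W) ⬝ᵥ (H *ᵥ haarState W)).re ^ 2 ∂haarUnitary n =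
      a / 2 * (‖H.trace‖ ^ 2 + frobeniusNorm H ^ 2) := by
  obtain ⟨Q, hQ, l, hHQ⟩ := exists_unitary_diagonal hH
  have hQ' : Qᴴ * Q = 1 := Matrix.mem_unitaryGroup_iff'.1 hQ
  set q : QubitBasis n → QubitBasis n → ℂ := fun i => Q *ᵥ Pi.single i 1 with hq
  have hqq : ∀ i j, star (q i) ⬝ᵥ q j = if i = j then 1 else 0 := fun i j => by
    simp only [hq]
    rw [star_mulVec_dotProduct, Matrix.mulVec_mulVec, hQ', Matrix.one_mulVec]
    by_cases hij : i = j
    · subst hij; simp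
    · simp [hij]
  have hqs : ∀ i (ψ : QubitBasis n → ℂ), star (q i) ⬝ᵥ ψ = (Qᴴ *ᵥ ψ) i := fun i ψ => by
    simp only [hq]
    rw [star_mulVec_dotProduct]
    simp
  have hexp : ∀ ψ : QubitBasis n → ℂ, star ψ ⬝ᵥ (H *ᵥ ψ) =
      ((∑ i, l i * ‖star (q i) ⬝ᵥ ψ‖ ^ 2 : ℝ) : ℂ) := fun ψ => by
    have : star ψ ⬝ᵥ (H *ᵥ ψ) = star (Qᴴ *ᵥ ψ) ⬝ᵥ
        (Matrix.diagonal (fun i => (l i : ℂ)) *ᵥ (Qᴴ *ᵥ ψ)) := by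
      rw [star_mulVec_dotProduct, Matrix.conjTranspose_conjTranspose, Matrix.mulVec_mulVec,
        Matrix.mulVec_mulVec, hHQ, mul_assoc]
    rw [this, dotProduct]
    push_cast
    refine Finset.sum_congr rfl fun i _ => ?_
    rw [Matrix.mulVec_diagonal, hqs, Pi.star_apply, mul_left_comm, mul_comm (star _)]
    congr 1
    exact RCLike.mul_conj _
  -- In an eigenbasis all pairs contribute `a / 2`, which gives the squared trace; the diagonal
  -- pairs contribute another `a / 2`, which gives the squared Frobenius norm.
  have hpij : ∀ i j, ∫ W, ‖star (q i) ⬝ᵥ haarState W‖ ^ 2 * ‖star (q j) ⬝ᵥ haarState W‖ ^ 2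
      ∂haarUnitary n = a / 2 * (1 + if i = j then 1 else 0) := fun i j => by
    by_cases hij : i = j
    · subst hij
      have h1 := ha (q i) (by
        have := hqq i i
        rw [star_dotProduct_self, if_pos rfl] at this
        exact_mod_cast this)
      simp only [← pow_add, if_true]
      rw [h1]
      ring
    · rw [integral_norm_sq_mul_norm_sq ha (by rw [hqq, if_pos rfl]) (by rw [hqq, if_pos rfl])
        (by rw [hqq, if_neg hij]), if_neg hij]
      ring
  have hint : ∀ i j, Integrable (fun W => l i * l j * (‖star (q i) ⬝ᵥ haarState W‖ ^ 2 *
      ‖star (q j) ⬝ᵥ haarState W‖ ^ 2)) (haarUnitary n) := fun i j =>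
    integrable_haarUnitary (by fun_prop)
  have htr : ‖H.trace‖ ^ 2 = (∑ i, l i) ^ 2 := by
    have : H.trace = ((∑ i, l i : ℝ) : ℂ) := by
      rw [hHQ, Matrix.trace_mul_cycle, hQ', one_mul, Matrix.trace_diagonal]
      push_cast
      rfl
    rw [this, Complex.norm_real, Real.norm_eq_abs, sq_abs]
  have hfr : frobeniusNorm H ^ 2 = ∑ i, l i ^ 2 := by
    have h1 := trace_conjTranspose_mul_self H
    rw [hH.eq, hHQ, conj_unitary_diagonal_mul hQ, Matrix.trace_mul_cycle, hQ', one_mul,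
      Matrix.trace_diagonal, ← hHQ] at h1
    have h2 : ((∑ i, l i ^ 2 : ℝ) : ℂ) = ((frobeniusNorm H ^ 2 : ℝ) : ℂ) := by
      rw [← h1]
      push_cast
      exact Finset.sum_congr rfl fun i _ => sq _
    exact_mod_cast h2.symm
  refine ⟨fun W => by rw [hexp, Complex.ofReal_im], ?_⟩
  have hpt : ∀ W : QubitUnitary n, (star (haarState W) ⬝ᵥ (H *ᵥ haarState W)).re ^ 2 =
      ∑ i, ∑ j, l i * l j * (‖star (q i) ⬝ᵥ haarState W‖ ^ 2 *
        ‖star (q j) ⬝ᵥ haarState W‖ ^ 2) := fun W => by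
    rw [hexp, Complex.ofReal_re, sq, Finset.sum_mul_sum]
    exact Finset.sum_congr rfl fun i _ => Finset.sum_congr rfl fun j _ => by ring
  simp only [hpt]
  rw [integral_finsetSum _ fun i _ => integrable_finsetSum _ fun j _ => hint i j]
  simp only [integral_finsetSum _ fun j _ => hint _ j, integral_const_mul, hpij]
  rw [htr, hfr, sq (∑ i, l i), Finset.sum_mul_sum, ← Finset.sum_add_distrib, Finset.mul_sum]
  refine Finset.sum_congr rfl fun i _ => ?_
  have : ∀ j, l i * l j * (a / 2 * (1 + if i = j then 1 else 0)) =
      a / 2 * (l i * l j) + if i = j then a / 2 * (l i * l j) else 0 := fun j => by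
    split_ifs <;> ring
  simp only [this]
  rw [Finset.sum_add_distrib, Finset.sum_ite_eq, if_pos (Finset.mem_univ i), ← Finset.mul_sum]
  ring

theorem frobeniusNorm_sq_of_mem_unitaryGroup {ι : Type*} [Fintype ι] [DecidableEq ι]
    {U : Matrix ι ι ℂ} (hU : U ∈ Matrix.unitaryGroup ι ℂ) :
    frobeniusNorm U ^ 2 = Fintype.card ι := by
  have h := trace_conjTranspose_mul_self U
  rw [← Matrix.star_eq_conjTranspose, Matrix.mem_unitaryGroup_iff'.1 hU, Matrix.trace_one] at h
  exact_mod_cast h.symm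

/-- The constant is fixed by the identity operator, whose expectation is always 1: `1 = a / 2 * (d ^
2 + d)` with `d = 2 ^ n`. -/
theorem exists_fourth_moment (hn : 2 ≤ n) :
    ∀ v : QubitBasis n → ℂ, ∑ x, ‖v x‖ ^ 2 = 1 →
      ∫ W, ‖star v ⬝ᵥ haarState W‖ ^ 4 ∂haarUnitary n = 2 / (2 ^ n * (2 ^ n + 1)) := by
  obtain ⟨a, ha⟩ := exists_integral_norm_pow_four_eq hn
  have h := (integral_norm_sq_expectation ha Matrix.isHermitian_one).2
  have h1 : ∀ W : QubitUnitary n, (star (haarState W) ⬝ᵥ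
      ((1 : Matrix (QubitBasis n) (QubitBasis n) ℂ) *ᵥ haarState W)).re ^ 2 = 1 := fun W => by
    rw [Matrix.one_mulVec, star_dotProduct_self, sum_norm_sq_haarState]
    simp
  simp only [h1] at h
  rw [frobeniusNorm_one_sq, Matrix.trace_one] at h
  simp at h
  have hd : (0 : ℝ) < 2 ^ n := by positivity
  have ha2 : a = 2 / (2 ^ n * (2 ^ n + 1)) := by
    rw [eq_div_iff (by positivity)]
    linarith
  rwa [ha2] at ha

/-- The Hermitian and the skew-Hermitian part of a unitary matrix. -/
theorem exists_isHermitian_add_I_smul_eq {ι : Type*} [Fintype ι] [DecidableEq ι]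
    {A : Matrix ι ι ℂ} (hA : A ∈ Matrix.unitaryGroup ι ℂ) :
    ∃ H K : Matrix ι ι ℂ, H.IsHermitian ∧ K.IsHermitian ∧ A = H + Complex.I • K ∧
      H * H + K * K = 1 := by
  refine ⟨(1 / 2 : ℂ) • (A + Aᴴ), (-Complex.I / 2) • (A - Aᴴ), ?_, ?_, ?_, ?_⟩
  · rw [Matrix.IsHermitian, Matrix.conjTranspose_smul, Matrix.conjTranspose_add,
      Matrix.conjTranspose_conjTranspose, add_comm]
    simp
  · rw [Matrix.IsHermitian, Matrix.conjTranspose_smul, Matrix.conjTranspose_sub,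
      Matrix.conjTranspose_conjTranspose]
    simp only [RCLike.star_def, map_div₀, map_neg, Complex.conj_I, map_ofNat]
    module
  · rw [smul_smul]
    have : Complex.I * (-Complex.I / 2) = 1 / 2 := by
      rw [← mul_div_assoc, mul_neg, Complex.I_mul_I, neg_neg]
    rw [this]
    module
  · have hAA : Aᴴ * A = 1 := Matrix.mem_unitaryGroup_iff'.1 hA
    have hAA' : A * Aᴴ = 1 := Matrix.mem_unitaryGroup_iff.1 hA
    have e : (-Complex.I / 2) * (-Complex.I / 2) = -(1 / 4 : ℂ) := by
      ring_nf
      rw [Complex.I_sq]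
      ring
    rw [Matrix.smul_mul, Matrix.mul_smul, Matrix.smul_mul, Matrix.mul_smul, smul_smul,
      smul_smul, e, add_mul, mul_add, mul_add, sub_mul, mul_sub, mul_sub, hAA, hAA']
    module

/-- The second moment of the expectation of a unitary operator in a Haar-random state. -/
theorem integral_norm_sq_unitary_expectation (hn : 2 ≤ n)
    {A : Matrix (QubitBasis n) (QubitBasis n) ℂ}
    (hA : A ∈ Matrix.unitaryGroup (QubitBasis n) ℂ) :
    ∫ W, ‖star (haarState W) ⬝ᵥ (A *ᵥ haarState W)‖ ^ 2 ∂haarUnitary n =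
      (‖A.trace‖ ^ 2 + 2 ^ n) / (2 ^ n * (2 ^ n + 1)) := by
  have ha := exists_fourth_moment hn
  obtain ⟨H, K, hHh, hKh, hAHK, h4⟩ := exists_isHermitian_add_I_smul_eq hA
  obtain ⟨hHi, hHint⟩ := integral_norm_sq_expectation ha hHh
  obtain ⟨hKi, hKint⟩ := integral_norm_sq_expectation ha hKh
  -- The expectations of `H` and `K` are real, so the squared modulus splits; the squared trace and
  -- Frobenius norm split likewise.
  have hpt : ∀ W : QubitUnitary n, ‖star (haarState W) ⬝ᵥ (A *ᵥ haarState W)‖ ^ 2 =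
      (star (haarState W) ⬝ᵥ (H *ᵥ haarState W)).re ^ 2 +
        (star (haarState W) ⬝ᵥ (K *ᵥ haarState W)).re ^ 2 := fun W => by
    rw [hAHK, Matrix.add_mulVec, Matrix.smul_mulVec, dotProduct_add, dotProduct_smul, smul_eq_mul,
      ← Complex.normSq_eq_norm_sq, Complex.normSq_apply]
    simp only [Complex.add_re, Complex.add_im, Complex.mul_re, Complex.mul_im, Complex.I_re,
      Complex.I_im, hHi, hKi]
    ring
  have hcont : ∀ B : Matrix (QubitBasis n) (QubitBasis n) ℂ, Integrable
      (fun W => (star (haarState W) ⬝ᵥ (B *ᵥ haarState W)).re ^ 2) (haarUnitary n) := fun B =>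
    integrable_haarUnitary ((Complex.continuous_re.comp
      (continuous_haarState.star.dotProduct
        (continuous_const.matrix_mulVec continuous_haarState))).pow 2)
  simp only [hpt]
  rw [integral_add (hcont H) (hcont K), hHint, hKint]
  have htr : ‖A.trace‖ ^ 2 = ‖H.trace‖ ^ 2 + ‖K.trace‖ ^ 2 := by
    have him : ∀ B : Matrix (QubitBasis n) (QubitBasis n) ℂ, B.IsHermitian → B.trace.im = 0 := by
      intro B hB
      have h1 : star B.trace = B.trace := by rw [← Matrix.trace_conjTranspose, hB.eq]
      exact Complex.conj_eq_iff_im.1 h1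
    have h1 : A.trace = H.trace + Complex.I * K.trace := by
      conv_lhs => rw [hAHK, Matrix.trace_add, Matrix.trace_smul, smul_eq_mul]
    rw [h1]
    simp only [← Complex.normSq_eq_norm_sq, Complex.normSq_apply, Complex.add_re, Complex.add_im,
      Complex.mul_re, Complex.mul_im, Complex.I_re, Complex.I_im, him H hHh, him K hKh]
    ring
  have hfr : frobeniusNorm H ^ 2 + frobeniusNorm K ^ 2 = 2 ^ n := by
    have h1 := frobeniusNorm_sq_of_mem_unitaryGroup hA
    have h2 := trace_conjTranspose_mul_self H
    have h3 := trace_conjTranspose_mul_self K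
    rw [hHh.eq] at h2
    rw [hKh.eq] at h3
    have h5 := congrArg Matrix.trace h4
    rw [Matrix.trace_add, h2, h3, Matrix.trace_one] at h5
    simp at h5
    exact_mod_cast h5
  rw [htr, ← hfr]
  ring

theorem averageDist_sq (hn : 2 ≤ n) (U V : QubitUnitary n) :
    averageDist U V ^ 2 =
      ((2 ^ n) ^ 2 - ‖(U.1ᴴ * V.1).trace‖ ^ 2) / (2 ^ n * (2 ^ n + 1)) := by
  have hpt : ∀ W : QubitUnitary n,
      traceDist (U.1 *ᵥ (W.1 *ᵥ zeroState n)) (V.1 *ᵥ (W.1 *ᵥ zeroState n)) ^ 2 =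
        1 - ‖star (haarState W) ⬝ᵥ ((U.1ᴴ * V.1) *ᵥ haarState W)‖ ^ 2 := fun W =>
    traceDist_mulVec_sq U.2 V.2 (sum_norm_sq_haarState W)
  have hA : U.1ᴴ * V.1 ∈ Matrix.unitaryGroup (QubitBasis n) ℂ :=
    mul_mem (Unitary.star_mem U.2) V.2
  have hint : Integrable (fun W => ‖star (haarState W) ⬝ᵥ ((U.1ᴴ * V.1) *ᵥ haarState W)‖ ^ 2)
      (haarUnitary n) :=
    integrable_haarUnitary ((continuous_haarState.star.dotProduct
        (continuous_const.matrix_mulVec continuous_haarState)).norm.pow 2)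
  rw [averageDist, Real.sq_sqrt (integral_nonneg fun W => sq_nonneg _)]
  simp only [hpt]
  rw [integral_sub (integrable_const 1) hint, integral_norm_sq_unitary_expectation hn hA]
  simp only [integral_const, probReal_univ, smul_eq_mul, mul_one]
  have hd : (0 : ℝ) < 2 ^ n := by positivity
  field_simp
  ring

open scoped Matrix.Norms.L2Operator in
theorem averageDist_le (U V : QubitUnitary n) : averageDist U V ≤ 1 * ‖U.1 - V.1‖ := by
  rw [one_mul, averageDist]
  refine Real.sqrt_le_iff.2 ⟨norm_nonneg _, ?_⟩
  have h := integral_mono_of_nonneg (μ := haarUnitary n)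
    (f := fun W => traceDist (U.1 *ᵥ (W.1 *ᵥ zeroState n)) (V.1 *ᵥ (W.1 *ᵥ zeroState n)) ^ 2)
    (g := fun _ => ‖U.1 - V.1‖ ^ 2) (.of_forall fun W => sq_nonneg _) (integrable_const _)
    (.of_forall fun W => traceDist_mulVec_sq_le U.2 V.2 (sum_norm_sq_haarState W))
  simpa using h

/-- Up to a global phase, the average-case distance dominates the Frobenius distance. -/
theorem exists_phase_frobeniusDist_le (hn : 2 ≤ n) (U V : QubitUnitary n) :
    ∃ z : ℂ, ‖z‖ = 1 ∧ frobeniusNorm (U.1 - z • V.1) / √(2 ^ n) ≤ 2 * averageDist U V := by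
  set τ := (U.1ᴴ * V.1).trace with hτ
  have hd : (1 : ℝ) ≤ 2 ^ n := one_le_pow₀ one_le_two
  -- The phase that makes the overlap trace real and nonnegative minimizes the Frobenius distance.
  obtain ⟨z, hz, hzτ⟩ : ∃ z : ℂ, ‖z‖ = 1 ∧ z * τ = ‖τ‖ := by
    by_cases h0 : τ = 0
    · exact ⟨1, by simp, by simp [h0]⟩
    · have hn0 : (‖τ‖ : ℂ) ≠ 0 := by simpa using h0
      refine ⟨star τ / ‖τ‖, by simp [h0], ?_⟩
      rw [div_mul_eq_mul_div, div_eq_iff hn0, mul_comm]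
      have := RCLike.mul_conj τ
      rw [sq] at this
      exact this
  refine ⟨z, hz, ?_⟩
  have hzz : star z * z = 1 := by
    rw [mul_comm]
    have := RCLike.mul_conj z
    simpa [hz] using this
  have hF : frobeniusNorm (U.1 - z • V.1) ^ 2 = 2 * 2 ^ n - 2 * ‖τ‖ := by
    have h1 := trace_conjTranspose_mul_self (U.1 - z • V.1)
    have h2 : (U.1 - z • V.1)ᴴ * (U.1 - z • V.1) =
        U.1ᴴ * U.1 + (star z * z) • (V.1ᴴ * V.1) - z • (U.1ᴴ * V.1) -
          (z • (U.1ᴴ * V.1))ᴴ := by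
      rw [Matrix.conjTranspose_sub, Matrix.conjTranspose_smul, Matrix.conjTranspose_smul,
        Matrix.conjTranspose_mul, Matrix.conjTranspose_conjTranspose, sub_mul, mul_sub, mul_sub,
        Matrix.smul_mul, Matrix.smul_mul, Matrix.mul_smul, Matrix.mul_smul, smul_smul]
      abel
    have h3 : U.1ᴴ * U.1 = 1 := Matrix.mem_unitaryGroup_iff'.1 U.2
    have h4 : V.1ᴴ * V.1 = 1 := Matrix.mem_unitaryGroup_iff'.1 V.2
    rw [h2, h3, h4, hzz, one_smul, Matrix.trace_sub, Matrix.trace_sub, Matrix.trace_add,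
      Matrix.trace_conjTranspose, Matrix.trace_smul, Matrix.trace_one, smul_eq_mul, ← hτ,
      hzτ] at h1
    simp at h1
    have h5 : (((2 * 2 ^ n - 2 * ‖τ‖ : ℝ)) : ℂ) = ((frobeniusNorm (U.1 - z • V.1) ^ 2 : ℝ) : ℂ) := by
      push_cast
      rw [← h1]
      ring
    exact_mod_cast h5.symm
  have hτd : ‖τ‖ ≤ 2 ^ n := by nlinarith [sq_nonneg (frobeniusNorm (U.1 - z • V.1))]
  have hav0 : 0 ≤ averageDist U V := Real.sqrt_nonneg _
  refine le_of_sq_le_sq ?_ (by positivity)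
  rw [div_pow, Real.sq_sqrt (by positivity), hF, mul_pow, averageDist_sq hn, ← hτ,
    div_le_iff₀ (by positivity)]
  rw [mul_div_assoc', div_mul_eq_mul_div, le_div_iff₀ (by positivity)]
  -- Up to a positive factor, the difference of the two sides of the squared inequality.
  have hfac : (0 : ℝ) ≤ (2 ^ n - ‖τ‖) * (2 ^ n * (2 ^ n + 2 * ‖τ‖ - 1)) :=
    mul_nonneg (by linarith) (mul_nonneg (by positivity) (by linarith [norm_nonneg τ]))
  nlinarith

end Haar

/-! ### Covering numbers of the `G`-gate unitaries -/

section MainTheorem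

open scoped Matrix.Norms.L2Operator

variable {n : ℕ}

/-- Each gate gets accuracy `ε / G`. The base could be `325 * G / ε`; it is doubled because the same
`c₂` appears halved in the average-case lower bound, where 325 phases per unit of `1 / ε` must be
paid for. -/
theorem metricEntropy_gateUnitaries_le_of_dim (hn : 2 ≤ n) {G : ℕ} (hG : 1 ≤ G) {ε : ℝ}
    (hε : 0 < ε) (hε1 : ε ≤ 1) {dist : QubitUnitary n → QubitUnitary n → ℝ}
    (hdist : ∀ U V, dist U V ≤ 1 * ‖U.1 - V.1‖) :
    metricEntropy dist (gateUnitaries n G) ε ≤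
      ((16 * G * Real.log (650 * G / ε) + 2 * G * Real.log n : ℝ) : EReal) := by
  have hG0 : (1 : ℝ) ≤ G := by exact_mod_cast hG
  obtain ⟨T, hT1, hT2, hT3⟩ := exists_finset_net_unitaryGroup_dim (ι := Fin 2 × Fin 2)
    (δ := ε / G) (by positivity) (div_le_one_of_le₀ (hε1.trans hG0) (by positivity))
  have hcard : (T.card : ℝ) ≤ (650 * G / ε) ^ 16 := by
    refine hT3.trans ?_
    have h16 : Fintype.card (Fin 2 × Fin 2) * Fintype.card (Fin 2 × Fin 2) = 16 := by simp
    rw [h16, div_div_eq_mul_div]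
    gcongr
    norm_num
  have h1 : (1 : ℝ) ≤ 650 * G / ε := by
    rw [le_div_iff₀ hε]
    linarith
  have := metricEntropy_gateUnitaries_le hn (dist := dist) (ε := ε) zero_le_one h1
    (by rw [one_mul, mul_div_cancel₀]; positivity) hdist T hT1 hT2 hcard
  exact_mod_cast this

theorem metricEntropy_diamondDist_le (hn : 2 ≤ n) {G : ℕ} (hG : 1 ≤ G) {ε : ℝ}
    (hε : 0 < ε) (hε1 : ε ≤ 1) :
    metricEntropy diamondDist (gateUnitaries n G) ε ≤
      ((32 * G * Real.log (12 * G / ε) + 2 * G * Real.log n : ℝ) : EReal) := by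
  have hG0 : (1 : ℝ) ≤ G := by exact_mod_cast hG
  obtain ⟨T, hT1, hT2, hT3⟩ := exists_finset_net_unitaryGroup (ι := Fin 2 × Fin 2)
    (δ := ε / (2 * G)) (by positivity)
  have hcard : (T.card : ℝ) ≤ (12 * G / ε) ^ 32 := by
    refine hT3.trans ?_
    have h32 : 2 * (Fintype.card (Fin 2 × Fin 2) * Fintype.card (Fin 2 × Fin 2)) = 32 := by simp
    rw [h32]
    gcongr
    rw [div_div_eq_mul_div, le_div_iff₀ hε, add_mul, div_mul_cancel₀ _ hε.ne']
    linarith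
  have h1 : (1 : ℝ) ≤ 12 * G / ε := by
    rw [le_div_iff₀ hε]
    linarith
  have := metricEntropy_gateUnitaries_le hn (dist := diamondDist) (ε := ε) zero_le_two h1
    (by rw [← mul_assoc, mul_div_cancel₀]; positivity) diamondDist_le T hT1 hT2 hcard
  exact_mod_cast this

/-- Take the largest `k ≤ n` with `15 * 4 ^ k ≤ G`. Since 240 = 15 · 4², `k = 2` is admissible. The
last bound follows from maximality if `k < n`, and from the upper bound on `G` if `k = n`. -/
theorem exists_qubits_of_gates (hn : 2 ≤ n) {G : ℕ} (hG : 1 ≤ (G : ℝ) / 240)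
    (hG' : (G : ℝ) / 240 ≤ 4 ^ (n + 1)) :
    ∃ k, 2 ≤ k ∧ k ≤ n ∧ 15 * 4 ^ k ≤ G ∧ (G : ℝ) / (4 * 240) ≤ 4 ^ k := by
  have hG2 : 15 * 4 ^ 2 ≤ G := by
    rw [le_div_iff₀ (by norm_num)] at hG
    have : (15 * 4 ^ 2 : ℝ) ≤ G := by linarith
    exact_mod_cast this
  have hspec := Nat.findGreatest_spec (P := fun k => 15 * 4 ^ k ≤ G) hn hG2
  have h2 := Nat.le_findGreatest (P := fun k => 15 * 4 ^ k ≤ G) hn hG2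
  set k := Nat.findGreatest (fun k => 15 * 4 ^ k ≤ G) n with hk
  have hkn : k ≤ n := Nat.findGreatest_le n
  refine ⟨k, h2, hkn, hspec, ?_⟩
  rcases hkn.eq_or_lt with h | h
  · rw [h]
    rw [pow_succ] at hG'
    linarith
  · have h3 := Nat.findGreatest_is_greatest (P := fun k => 15 * 4 ^ k ≤ G) (Nat.lt_succ_self k) h
    rw [not_le] at h3
    have h4 : (G : ℝ) < 15 * 4 ^ (k + 1) := by exact_mod_cast h3
    rw [pow_succ] at h4
    have : (0 : ℝ) < 4 ^ k := by positivity
    linarith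

/-- The constant of the lower bounds, with the number of qubits adapted to the number of gates. -/
theorem exists_exp_le_card_of_frobeniusDist_le :
    ∃ c : ℝ, 0 < c ∧ ∀ (n G : ℕ) (ε : ℝ) (N : Finset (QubitUnitary n)), 2 ≤ n →
      1 ≤ (G : ℝ) / 240 → (G : ℝ) / 240 ≤ 4 ^ (n + 1) → 0 < ε →
      (∀ U ∈ gateUnitaries n G, ∃ V ∈ N, frobeniusDist U V ≤ ε) →
      Real.exp ((G : ℝ) / (4 * 240) * Real.log (c / ε)) ≤ N.card := by
  obtain ⟨c, hc, h⟩ := exists_pow_le_card_of_frobeniusDist_le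
  refine ⟨c, hc, fun n G ε N hn hG hG' hε hN => ?_⟩
  obtain ⟨k, hk2, hkn, hkG, hGk⟩ := exists_qubits_of_gates hn hG hG'
  have hN1 := h n k G ε N hk2 hkn hkG hε hN
  obtain ⟨V, hV, -⟩ := hN 1 (gateUnitaries_mono hn (Nat.zero_le G) one_mem_gateUnitaries_zero)
  have hN0 : (1 : ℝ) ≤ N.card := by exact_mod_cast Finset.card_pos.2 ⟨V, hV⟩
  have hcε : 0 < c / ε := by positivity
  -- Replacing the exponent `4 ^ k` by the smaller `G / 960` needs a nonnegative logarithm;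
  -- otherwise the bound is at most 1.
  rcases le_total 1 (c / ε) with h1 | h1
  · refine le_trans ?_ hN1
    rw [← Real.exp_log (pow_pos hcε _), Real.log_pow]
    refine Real.exp_le_exp.2 ?_
    push_cast
    exact mul_le_mul_of_nonneg_right hGk (Real.log_nonneg h1)
  · refine le_trans (Real.exp_le_one_iff.2 ?_) hN0
    exact mul_nonpos_of_nonneg_of_nonpos (by positivity) (Real.log_nonpos hcε.le h1)

/-- The unit circle is U(1), so this is the one-dimensional case of the unitary net. -/
theorem exists_finset_phases {ε : ℝ} (hε : 0 < ε) (hε1 : ε ≤ 1) :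
    ∃ Z : Finset ℂ, (∀ z ∈ Z, ‖z‖ = 1) ∧ (∀ z : ℂ, ‖z‖ = 1 → ∃ w ∈ Z, ‖z - w‖ ≤ ε) ∧
      (Z.card : ℝ) ≤ 325 / ε := by
  classical
  have hdiag : ∀ A : Matrix Unit Unit ℂ, A = Matrix.diagonal fun _ => A () () := fun A => by
    ext
    simp
  have hnorm : ∀ A : Matrix Unit Unit ℂ, ‖A‖ = ‖A () ()‖ := fun A => by
    conv_lhs => rw [hdiag A, Matrix.l2_opNorm_diagonal]
    exact pi_norm_const _
  obtain ⟨T, hT1, hT2, hT3⟩ := exists_finset_net_unitaryGroup_dim (ι := Unit) hε hε1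
  refine ⟨T.image fun A => A () (), ?_, fun z hz => ?_, ?_⟩
  · intro z hz
    obtain ⟨A, hA, rfl⟩ := Finset.mem_image.1 hz
    rw [← hnorm]
    exact CStarRing.norm_of_mem_unitary (hT1 hA)
  · have hmem : (Matrix.diagonal fun _ => z : Matrix Unit Unit ℂ) ∈
        Matrix.unitaryGroup Unit ℂ := by
      have := conj_unitary_diagonal_mem (one_mem (Matrix.unitaryGroup Unit ℂ))
        (z := fun _ => z) fun _ => hz
      simpa using this
    obtain ⟨W, hW, hzW⟩ := hT2 _ hmem
    refine ⟨_, Finset.mem_image_of_mem _ hW, ?_⟩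
    rw [hnorm] at hzW
    simpa using hzW
  · refine (Nat.cast_le.2 Finset.card_image_le).trans (hT3.trans_eq ?_)
    simp

theorem smul_mem_unitaryGroup {ι : Type*} [Fintype ι] [DecidableEq ι] {z : ℂ} (hz : ‖z‖ = 1)
    {U : Matrix ι ι ℂ} (hU : U ∈ Matrix.unitaryGroup ι ℂ) : z • U ∈ Matrix.unitaryGroup ι ℂ := by
  have h : z * star z = 1 := by
    have := RCLike.mul_conj z
    simpa [hz] using this
  rw [Matrix.mem_unitaryGroup_iff, star_smul, Matrix.smul_mul, Matrix.mul_smul, smul_smul, h,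
    one_smul]
  exact Matrix.mem_unitaryGroup_iff.1 hU

/-- A net for the average-case distance gives a net for the Frobenius distance by adding phases. -/
theorem exists_frobenius_net_of_average_net (hn : 2 ≤ n) {K : Set (QubitUnitary n)} {ε : ℝ}
    (hε : 0 < ε) (hε1 : ε ≤ 1) (N : Finset (QubitUnitary n))
    (hN : ∀ U ∈ K, ∃ V ∈ N, averageDist U V ≤ ε) :
    ∃ N' : Finset (QubitUnitary n), (∀ U ∈ K, ∃ V ∈ N', frobeniusDist U V ≤ 3 * ε) ∧
      (N'.card : ℝ) ≤ 325 / ε * N.card := by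
  classical
  obtain ⟨Z, hZ1, hZ2, hZ3⟩ := exists_finset_phases hε hε1
  let f : ℂ → QubitUnitary n → QubitUnitary n := fun z V =>
    if hz : ‖z‖ = 1 then ⟨z • V.1, smul_mem_unitaryGroup hz V.2⟩ else 1
  refine ⟨Finset.image₂ f Z N, fun U hU => ?_, ?_⟩
  · obtain ⟨V, hV, hUV⟩ := hN U hU
    obtain ⟨z, hz, hzUV⟩ := exists_phase_frobeniusDist_le hn U V
    obtain ⟨w, hw, hzw⟩ := hZ2 z hz
    refine ⟨f w V, Finset.mem_image₂_of_mem hw hV, ?_⟩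
    have hf : (f w V).1 = w • V.1 := by
      simp only [f, dif_pos (hZ1 w hw)]
    have hs : (0 : ℝ) < √(2 ^ n) := by positivity
    have hVn : frobeniusNorm V.1 = √(2 ^ n) := by
      rw [← Real.sqrt_sq (frobeniusNorm_nonneg V.1), frobeniusNorm_sq_of_mem_unitaryGroup V.2]
      simp
    rw [frobeniusDist, hf]
    -- The optimal phase `z` costs `2 ε`; rounding it to `w` costs `ε`, as `V` has normalized
    -- Frobenius norm 1.
    have h1 : U.1 - w • V.1 = (U.1 - z • V.1) + (z - w) • V.1 := by module
    have h2 := frobeniusNorm_add_le (U.1 - z • V.1) ((z - w) • V.1)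
    rw [← h1, frobeniusNorm_smul, hVn] at h2
    refine (div_le_div_of_nonneg_right h2 hs.le).trans ?_
    rw [add_div, mul_div_assoc, div_self hs.ne', mul_one]
    linarith
  · calc ((Finset.image₂ f Z N).card : ℝ) ≤ ((Z.card * N.card : ℕ) : ℝ) :=
          Nat.cast_le.2 (Finset.card_image₂_le _ _ _)
      _ = (Z.card : ℝ) * N.card := by push_cast; ring
      _ ≤ _ := by gcongr

end MainTheorem

theorem mainTheorem9 :
    -- normalized Frobenius distance
    (∃ c₁ c₂ C : ℝ, 0 < c₁ ∧ 0 < c₂ ∧ 0 < C ∧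
      ∀ (n G : ℕ) (ε : ℝ), 2 ≤ n → 0 < ε → ε ≤ 1 → 1 ≤ (G : ℝ) / C → (G : ℝ) / C ≤ 4 ^ (n + 1) →
        (((G : ℝ) / (4 * C) * Real.log (c₁ / ε) : ℝ) : EReal)
            ≤ metricEntropy frobeniusDist (gateUnitaries n G) ε ∧
        metricEntropy frobeniusDist (gateUnitaries n G) ε
            ≤ ((16 * G * Real.log (c₂ * G / ε) + 2 * G * Real.log n : ℝ) : EReal)) ∧
    -- diamond distance
    (∀ (n G : ℕ) (ε : ℝ), 2 ≤ n → 1 ≤ G → 0 < ε → ε ≤ 1 →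
      metricEntropy diamondDist (gateUnitaries n G) ε
          ≤ ((32 * G * Real.log (12 * G / ε) + 2 * G * Real.log n : ℝ) : EReal)) ∧
    -- average-case distance
    (∃ c₁ c₂ C : ℝ, 0 < c₁ ∧ 0 < c₂ ∧ 0 < C ∧
      ∀ (n G : ℕ) (ε : ℝ), 2 ≤ n → 0 < ε → ε ≤ 1 → 1 ≤ (G : ℝ) / C → (G : ℝ) / C ≤ 4 ^ (n + 1) →
        (((G : ℝ) / (4 * C) * Real.log (c₁ / (8 * ε)) - Real.log (c₂ / (2 * ε)) : ℝ) : EReal)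
            ≤ metricEntropy averageDist (gateUnitaries n G) ε ∧
        metricEntropy averageDist (gateUnitaries n G) ε
            ≤ ((16 * G * Real.log (c₂ * G / ε) + 2 * G * Real.log n : ℝ) : EReal)) := by
  obtain ⟨c, hc, hlower⟩ := exists_exp_le_card_of_frobeniusDist_le
  have hG1 : ∀ G : ℕ, 1 ≤ (G : ℝ) / 240 → 1 ≤ G := fun G hG => by
    rw [le_div_iff₀ (by norm_num)] at hG
    have : (1 : ℝ) ≤ G := by linarith
    exact_mod_cast this
  -- The factor `8 / 3` in the third part turns `c₁ / (8 ε)` into `c / (3 ε)`, the Frobenius bound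
  -- at scale `3 ε`; `650 / (2 ε)` is the number of phases `325 / ε`.
  refine ⟨⟨c, 650, 240, hc, by norm_num, by norm_num, fun n G ε hn hε hε1 hG hG' => ⟨?_, ?_⟩⟩,
    fun n G ε hn hG hε hε1 => metricEntropy_diamondDist_le hn hG hε hε1,
    ⟨8 / 3 * c, 650, 240, by positivity, by norm_num, by norm_num,
      fun n G ε hn hε hε1 hG hG' => ⟨?_, ?_⟩⟩⟩
  · exact le_metricEntropy fun N hN => hlower n G ε N hn hG hG' hε hN.2
  · exact metricEntropy_gateUnitaries_le_of_dim hn (hG1 G hG) hε hε1 frobeniusDist_le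
  · refine le_metricEntropy fun N hN => ?_
    obtain ⟨N', hN', hcard⟩ := exists_frobenius_net_of_average_net hn hε hε1 N hN.2
    have h := hlower n G (3 * ε) N' hn hG hG' (by positivity) hN'
    have h1 : 8 / 3 * c / (8 * ε) = c / (3 * ε) := by
      field_simp
    have h2 : (650 / (2 * ε) : ℝ) = 325 / ε := by
      field_simp
      norm_num
    rw [Real.exp_sub, h1, h2, Real.exp_log (by positivity), div_le_iff₀ (by positivity)]
    exact (h.trans hcard).trans_eq (mul_comm _ _)
  · exact metricEntropy_gateUnitaries_le_of_dim hn (hG1 G hG) hε hε1 averageDist_le
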